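/- **Setting.** For each $n$ let latent variables $X_n$ and raw data $Y_n$ have joint density $p_{\rm obs}(y\mid x,\xi)\,p_{\rm sci}(x\mid\theta)$ with respect to a product of σ-finite measures, with $(\theta,\xi)\in\Psi_n\subseteq\mathbb R^d\times\mathbb R^{k_n}$, $d$ fixed and $\sup_n k_n<\infty$. The likelihood from $Y_n$ is $\int p_{\rm obs}(y\mid x,\xi)p_{\rm sci}(x\mid\theta)\,dx$. Let $T_n=T_n(Y_n)$ be a measurable function of $Y_n$ (the preprocessed data), whose laws have densities with respect to a σ-finite measure. Let $\psi_{0}=(\theta_0,\xi_{0,n})\in\Psi_n$ be the true parameter and $N_n>0$, $N_n\to\infty$, the information size. **Regularity.** Assume for the sequence of experiments of observing $Y_n$, and likewise for that of observing $T_n$, with log-likelihood $\ell_n$ (all probabilities and expectations taken at the truth): 1. all densities in the model have the same support; 2. for some $r>0$ and $C$ independent of $n$, $\Psi_n$ contains the ball of radius $r$ about $\psi_0$, and on it $\ell_n$ is a.s. $C^3$ with third derivative bounded in norm by a random variable of mean at most $CN_n$; 3. the first two derivatives in $\psi$ of the density are dominated, near $\psi_0$, by an integrable function; 4. for some $c>0$,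 the Fisher information matrix for $(\theta,\xi)$ at $\psi_0$ is $\ge cN_n I$ for all large $n$; 5. $\|\nabla\ell_n(\psi_0)\|^2/N_n$ is uniformly integrable, and $N_n^{-1}\bigl(\nabla^2\ell_n(\psi_0)-E\nabla^2\ell_n(\psi_0)\bigr)\to0$ in probability; 6. for each $\varepsilon>0$ there is $c>0$ such that, with probability tending to one, $\ell_n(\psi)<\ell_n(\psi_0)-cN_n$ for all $\psi\in\Psi_n$ at distance at least $\varepsilon$ from $\psi_0$. Let $\hat\theta(Y),\hat\theta(T)$ be the $\theta$-components of measurable estimators of $(\theta,\xi)$ that, with probability tending to one, maximize the likelihood from $Y_n$, respectively $T_n$, over $\Psi_n$. Let $I_Y,I_T$ be the observed Fisher informations of the profile likelihoods, i.e. minus the Hessian at $\hat\theta(Y)$, respectively $\hat\theta(T)$, of $\theta\mapsto\sup_{\xi}\ell_n(\theta,\xi)$. Suppose that $I_Y^{-1}(I_Y-I_T)$ converges in probability to a matrix $F$ (the limiting fraction of missing information). **Theorem.** As $n\to\infty$, $$\operatorname{Var}\bigl(\hat\theta(T)-\hat\theta(Y)\bigr)\bigl[\operatorname{Var}\hat\theta(T)\bigr]^{-1}\to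 F,\qquad \operatorname{Var}\bigl(\hat\theta(Y)\bigr)\bigl[\operatorname{Var}\hat\theta(T)\bigr]^{-1}\to I-F,$$ in each of the following senses (the inverted matrices being invertible eventually, respectively in the limit): (a) for asymptotic variances, without further assumption: with $\operatorname{Var}$ replaced by the covariance matrices of the vectors $\sqrt{N_n}(\hat\theta(T)-\hat\theta(Y))$, $\sqrt{N_n}(\hat\theta(Y)-\theta_0)$ and $\sqrt{N_n}(\hat\theta(T)-\theta_0)$, each set to $0$ where its norm exceeds $K$, the two ratios converge to $F$ and $I-F$ as first $n\to\infty$ and then $K\to\infty$ (for every $\varepsilon>0$ there is $K_0$ such that for all $K\ge K_0$ the ratios are within $\varepsilon$ of their limits for all large $n$); (b) for variances of limit laws: whenever $\bigl(\sqrt{N_n}(\hat\theta(Y)-\theta_0),\sqrt{N_n}(\hat\theta(T)-\theta_0)\bigr)$ converges in distribution to some $(W_Y,W_T)$, the limit has finite second moments, $\operatorname{Var}(W_T-W_Y)\operatorname{Var}(W_T)^{-1}=F$ and $\operatorname{Var}(W_Y)\operatorname{Var}(W_T)^{-1}=I-F$; (c) for the actual variances of the estimators, whenever $N_n\|\hat\theta(Y)-\theta_0\|^2$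 and $N_n\|\hat\theta(T)-\theta_0\|^2$ are uniformly integrable. -/

import Mathlib

open MeasureTheory ProbabilityTheory Filter
open scoped Topology ENNReal

noncomputable section

namespace Multiphase

/-- Full parameters `(θ, ξ)`: parameter of interest and nuisance parameter. -/
abbrev Param (d k : ℕ) : Type := EuclideanSpace ℝ (Fin d) × EuclideanSpace ℝ (Fin k)

/-- The coordinate directions of the full parameter space. -/
def coordVec (d k : ℕ) : Fin d ⊕ Fin k → Param d k :=
  Sum.elim (fun i => (EuclideanSpace.single i 1, 0)) (fun j => (0, EuclideanSpace.single j 1))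

/-- A dominated statistical experiment with sample space `S` and parameter space `Ψ`:
densities with respect to a σ-finite reference measure. -/
structure Experiment (S : Type*) [MeasurableSpace S] {d k : ℕ} (Ψ : Set (Param d k)) where
  ref : Measure S
  sigmaFinite : SigmaFinite ref
  dens : S → Param d k → ℝ
  measurable_dens : ∀ ψ, Measurable fun y => dens y ψ
  dens_nonneg : ∀ y ψ, 0 ≤ dens y ψ
  lintegral_dens : ∀ ψ ∈ Ψ, ∫⁻ y, ENNReal.ofReal (dens y ψ) ∂ref = 1

namespace Experiment

variable {S : Type*} [MeasurableSpace S] {d k : ℕ} {Ψ : Set (Param d k)}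

/-- The distribution of the data under `ψ`. -/
def law (E : Experiment S Ψ) (ψ : Ψ) : Measure S :=
  E.ref.withDensity fun y => ENNReal.ofReal (E.dens y ψ)

instance (E : Experiment S Ψ) (ψ : Ψ) : IsProbabilityMeasure (E.law ψ) :=
  ⟨by rw [law, withDensity_apply _ MeasurableSet.univ, Measure.restrict_univ,
    E.lintegral_dens _ ψ.2]⟩

def logLik (E : Experiment S Ψ) (y : S) (ψ : Param d k) : ℝ := Real.log (E.dens y ψ)

/-- The score vector (gradient of the log-likelihood in `(θ, ξ)`). -/
def score (E : Experiment S Ψ) (y : S) (ψ : Param d k) (a : Fin d ⊕ Fin k) : ℝ :=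
  fderiv ℝ (E.logLik y) ψ (coordVec d k a)

/-- Minus the Hessian matrix of the log-likelihood in `(θ, ξ)`. -/
def negHessian (E : Experiment S Ψ) (y : S) (ψ : Param d k) :
    Matrix (Fin d ⊕ Fin k) (Fin d ⊕ Fin k) ℝ :=
  Matrix.of fun a b =>
    -(fderiv ℝ (fderiv ℝ (E.logLik y)) ψ (coordVec d k a) (coordVec d k b))

/-- The (expected) Fisher information matrix for `(θ, ξ)`. -/
def fisherInfo (E : Experiment S Ψ) (ψ : Ψ) : Matrix (Fin d ⊕ Fin k) (Fin d ⊕ Fin k) ℝ :=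
  Matrix.of fun a b => ∫ y, E.score y ψ a * E.score y ψ b ∂(E.law ψ)

/-- The profile log-likelihood of `θ`: the supremum over `ξ` of the log-likelihood. -/
def profileLogLik (E : Experiment S Ψ) (y : S) (θ : EuclideanSpace ℝ (Fin d)) : ℝ :=
  sSup ((fun ξ => E.logLik y (θ, ξ)) '' {ξ | (θ, ξ) ∈ Ψ})

/-- Minus the Hessian matrix of the profile log-likelihood; at the maximum likelihood estimate
of `θ` this is the observed Fisher information of the profile likelihood. -/
def profileInfo (E : Experiment S Ψ) (y : S) (θ : EuclideanSpace ℝ (Fin d)) :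
    Matrix (Fin d) (Fin d) ℝ :=
  Matrix.of fun i j =>
    -(fderiv ℝ (fderiv ℝ (E.profileLogLik y)) θ
        (EuclideanSpace.single i 1) (EuclideanSpace.single j 1))

/-- `ψ` is a maximum likelihood estimate of the full parameter from the data `y`. -/
def IsMLE (E : Experiment S Ψ) (y : S) (ψ : Param d k) : Prop :=
  ψ ∈ Ψ ∧ ∀ ψ' ∈ Ψ, E.dens y ψ' ≤ E.dens y ψ

end Experiment

/-- The two-phase model: latent scientific variables `x` with density `sci x θ`, and raw data `y`
with conditional density `obs y x ξ` given `x`. -/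
structure TwoPhaseModel (X Y : Type*) [MeasurableSpace X] [MeasurableSpace Y] {d k : ℕ}
    (Ψ : Set (Param d k)) where
  refX : Measure X
  refY : Measure Y
  sigmaFiniteX : SigmaFinite refX
  sigmaFiniteY : SigmaFinite refY
  sci : X → EuclideanSpace ℝ (Fin d) → ℝ
  obs : Y → X → EuclideanSpace ℝ (Fin k) → ℝ
  measurable_sci : ∀ θ, Measurable fun x => sci x θ
  measurable_obs : ∀ ξ, Measurable fun z : Y × X => obs z.1 z.2 ξ
  sci_nonneg : ∀ x θ, 0 ≤ sci x θ
  obs_nonneg : ∀ y x ξ, 0 ≤ obs y x ξ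
  lintegral_sci : ∀ ψ ∈ Ψ, ∫⁻ x, ENNReal.ofReal (sci x ψ.1) ∂refX = 1
  lintegral_obs : ∀ ψ ∈ Ψ, ∀ x, ∫⁻ y, ENNReal.ofReal (obs y x ψ.2) ∂refY = 1

/-- The experiment of observing the raw data only: the density of `y` under `(θ, ξ)` is
`∫ obs(y | x, ξ) sci(x | θ) dx`. -/
def TwoPhaseModel.marginal {X Y : Type*} [MeasurableSpace X] [MeasurableSpace Y] {d k : ℕ}
    {Ψ : Set (Param d k)} (M : TwoPhaseModel X Y Ψ) : Experiment Y Ψ where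
  ref := M.refY
  sigmaFinite := M.sigmaFiniteY
  dens := fun y ψ => ∫ x, M.obs y x ψ.2 * M.sci x ψ.1 ∂M.refX
  measurable_dens := fun ψ => by
    have := M.sigmaFiniteX
    have h : Measurable fun z : Y × X => M.obs z.1 z.2 ψ.2 * M.sci z.2 ψ.1 :=
      (M.measurable_obs _).mul ((M.measurable_sci _).comp measurable_snd)
    exact (h.stronglyMeasurable.integral_prod_right' (ν := M.refX)).measurable
  dens_nonneg := fun y ψ =>
    integral_nonneg fun x => mul_nonneg (M.obs_nonneg _ _ _) (M.sci_nonneg _ _)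
  lintegral_dens := fun ψ hψ => by
    have := M.sigmaFiniteX
    have := M.sigmaFiniteY
    have h : Measurable fun z : Y × X => M.obs z.1 z.2 ψ.2 * M.sci z.2 ψ.1 :=
      (M.measurable_obs _).mul ((M.measurable_sci _).comp measurable_snd)
    have h0 : ∀ y x, 0 ≤ M.obs y x ψ.2 * M.sci x ψ.1 := fun y x =>
      mul_nonneg (M.obs_nonneg _ _ _) (M.sci_nonneg _ _)
    have key : ∫⁻ y, ∫⁻ x, ENNReal.ofReal (M.obs y x ψ.2 * M.sci x ψ.1) ∂M.refX ∂M.refY = 1 := by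
      rw [lintegral_lintegral_swap h.ennreal_ofReal.aemeasurable, ← M.lintegral_sci ψ hψ]
      refine lintegral_congr fun x => ?_
      simp_rw [ENNReal.ofReal_mul (M.obs_nonneg _ _ _)]
      have hx : Measurable fun y => ENNReal.ofReal (M.obs y x ψ.2) :=
        ((M.measurable_obs ψ.2).comp (measurable_prodMk_right (y := x))).ennreal_ofReal
      rw [lintegral_mul_const _ hx, M.lintegral_obs ψ hψ x, one_mul]
    have hm : Measurable fun y => ∫⁻ x, ENNReal.ofReal (M.obs y x ψ.2 * M.sci x ψ.1) ∂M.refX :=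
      h.ennreal_ofReal.lintegral_prod_right'
    have hfin : ∀ᵐ y ∂M.refY,
        ∫⁻ x, ENNReal.ofReal (M.obs y x ψ.2 * M.sci x ψ.1) ∂M.refX < ∞ :=
      ae_lt_top hm (by rw [key]; exact ENNReal.one_ne_top)
    rw [← key]
    refine lintegral_congr_ae ?_
    filter_upwards [hfin] with y hy
    rw [integral_eq_lintegral_of_nonneg_ae (Eventually.of_forall (h0 y))
      (h.comp measurable_prodMk_left).aestronglyMeasurable]
    exact ENNReal.ofReal_toReal hy.ne

/-- Uniform integrability of a sequence of nonnegative random variables, each on its own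
probability space. -/
def UnifInt {S : ℕ → Type*} [∀ n, MeasurableSpace (S n)] (P : ∀ n, Measure (S n))
    (f : ∀ n, S n → ℝ) : Prop :=
  ∀ ε > 0, ∃ K : ℝ, ∀ n,
    ∫⁻ y in {y | K ≤ f n y}, ENNReal.ofReal (f n y) ∂(P n) ≤ ENNReal.ofReal ε

/-- Standard regularity conditions for the joint likelihood of `(θ, ξ)` at the true values
`ψ₀ n`, along a sequence of experiments with information size `N n`. -/
structure Regular {S : ℕ → Type*} [∀ n, MeasurableSpace (S n)] {d : ℕ} {k : ℕ → ℕ}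
    {Ψ : ∀ n, Set (Param d (k n))} (N : ℕ → ℝ) (E : ∀ n, Experiment (S n) (Ψ n))
    (ψ₀ : ∀ n, Ψ n) : Prop where
  /-- All densities have the same support. -/
  common_support : ∀ n, ∀ᵐ y ∂(E n).ref, ∀ ψ ∈ Ψ n, ∀ ψ' ∈ Ψ n,
    0 < (E n).dens y ψ → 0 < (E n).dens y ψ'
  /-- On a neighbourhood of the truth contained in the parameter space, the log-likelihood is
  three times continuously differentiable, with third derivatives bounded by a random variable
  whose mean is at most of the order of the information size. -/
  third_derivative : ∃ r > 0, ∃ C : ℝ, ∀ n,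
    Metric.ball (ψ₀ n : Param d (k n)) r ⊆ Ψ n ∧
    ∃ B : S n → ℝ, Integrable B ((E n).law (ψ₀ n)) ∧ ∫ y, B y ∂((E n).law (ψ₀ n)) ≤ C * N n ∧
      ∀ᵐ y ∂((E n).law (ψ₀ n)),
        ContDiffOn ℝ 3 ((E n).logLik y) (Metric.ball (ψ₀ n : Param d (k n)) r) ∧
        ∀ ψ ∈ Metric.ball (ψ₀ n : Param d (k n)) r, ‖iteratedFDeriv ℝ 3 ((E n).logLik y) ψ‖ ≤ B y
  /-- The density may be differentiated twice under the integral sign at the truth. -/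
  dominated : ∀ n, ∃ U ∈ 𝓝 (ψ₀ n : Param d (k n)), ∃ g : S n → ℝ, Integrable g (E n).ref ∧
    ∀ᵐ y ∂(E n).ref, ∀ ψ ∈ U, ‖fderiv ℝ ((E n).dens y) ψ‖ ≤ g y ∧
      ‖fderiv ℝ (fderiv ℝ ((E n).dens y)) ψ‖ ≤ g y
  /-- The Fisher information for `(θ, ξ)` has full rank, uniformly at the scale of the
  information size. -/
  full_rank : ∃ c > 0, ∀ᶠ n in atTop, ∀ v : Fin d ⊕ Fin (k n) → ℝ,
    c * N n * (v ⬝ᵥ v) ≤ v ⬝ᵥ ((E n).fisherInfo (ψ₀ n)).mulVec v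
  /-- Accumulation of information: the squared score per unit of information is uniformly
  integrable. -/
  score_unifInt : UnifInt (fun n => (E n).law (ψ₀ n))
    (fun n y => (∑ a, (E n).score y (ψ₀ n) a ^ 2) / N n)
  /-- Accumulation of information: law of large numbers for minus the Hessian of the
  log-likelihood at the truth. -/
  hessian_lln : ∀ ε > 0, Tendsto (fun n => (E n).law (ψ₀ n)
    {y | ∃ a b, ε * N n ≤ |(E n).negHessian y (ψ₀ n) a b
      - ∫ y', (E n).negHessian y' (ψ₀ n) a b ∂((E n).law (ψ₀ n))|}) atTop (𝓝 0)
  /-- Accumulation of information: identifiability. Against all parameters at distance at least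
  `ε` from the truth, the log-likelihood ratio grows at least linearly in the information size,
  with probability tending to one. -/
  identifiable : ∀ ε > 0, ∃ c > 0, Tendsto (fun n => (E n).law (ψ₀ n)
    {y | ∃ ψ ∈ Ψ n, ε ≤ dist ψ (ψ₀ n : Param d (k n)) ∧
      (E n).logLik y (ψ₀ n) - c * N n ≤ (E n).logLik y ψ}) atTop (𝓝 0)

/-- The covariance matrix `Var(Z)` of a random vector. -/
def covMatrix {S : Type*} [MeasurableSpace S] {d : ℕ} (P : Measure S)
    (Z : S → EuclideanSpace ℝ (Fin d)) : Matrix (Fin d) (Fin d) ℝ :=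
  Matrix.of fun i j => cov[fun y => Z y i, fun y => Z y j; P]

/-- Truncation of a vector at norm `K`. -/
def truncate {d : ℕ} (K : ℝ) (z : EuclideanSpace ℝ (Fin d)) : EuclideanSpace ℝ (Fin d) :=
  open Classical in if ‖z‖ ≤ K then z else 0

/-- The ratio `Var(A) Var(B)⁻¹` of asymptotic variances is `R`: variances are computed after
truncation at `K`, and then `n → ∞` followed by `K → ∞`. No moments need exist. -/
def AsympVarRatio {S : ℕ → Type*} [∀ n, MeasurableSpace (S n)] {d : ℕ} (P : ∀ n, Measure (S n))
    (A B : ∀ n, S n → EuclideanSpace ℝ (Fin d)) (R : Matrix (Fin d) (Fin d) ℝ) : Prop :=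
  ∀ ε > 0, ∃ K₀ : ℝ, ∀ K ≥ K₀, ∀ᶠ n in atTop,
    IsUnit (covMatrix (P n) fun y => truncate K (B n y)).det ∧
    ∀ i j, |(covMatrix (P n) (fun y => truncate K (A n y)) *
      (covMatrix (P n) fun y => truncate K (B n y))⁻¹ - R) i j| < ε

/-- `Var(A) Var(B)⁻¹ → R` for the actual variances. -/
def VarRatioTendsto {S : ℕ → Type*} [∀ n, MeasurableSpace (S n)] {d : ℕ} (P : ∀ n, Measure (S n))
    (A B : ∀ n, S n → EuclideanSpace ℝ (Fin d)) (R : Matrix (Fin d) (Fin d) ℝ) : Prop :=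
  (∀ᶠ n in atTop, IsUnit (covMatrix (P n) (B n)).det) ∧
    Tendsto (fun n => covMatrix (P n) (A n) * (covMatrix (P n) (B n))⁻¹) atTop (𝓝 R)

end Multiphase

end

open Multiphase

/-!
Under the regularity conditions a maximum likelihood estimator is, uniformly along the sequence of
experiments, a *linear statistic* plus a negligible error: with `A` the Fisher information divided
by `N` and `s` the score at the truth, `√N (θ̂ - θ₀)` differs by `o_P(1)` from the `θ`-block `L` of
`A⁻¹ (s / √N)` (`Multiphase.Regular.asympLinear`). This follows from consistency, the bound on
third derivatives and the convergence of the scaled Hessian to `-A`, applied to the mean value form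
of the likelihood equation. The statistic `L` has mean `0` and covariance `V`, the `θ`-block of
`A⁻¹`. Asymptotic normality is not assumed, nor is it needed: only second moments enter.

The key identity concerns both data sets. As `T` is a function of `Y`, the score for `T` is the
conditional expectation of the score for `Y`; this is seen by differentiating the expectation of a
bounded function of `T`, which both experiments give. Thus `Cov(s_Y, s_T) = Var(s_T)`
(`integral_score_mul_score`). Hence `Cov(L_Y, L_T) = Var(L_Y)` (`integral_linStat_mul_linStat`), and
`L_T - L_Y` has covariance `V_T - V_Y`, so that the two ratios of variances are `1 - V_Y V_T⁻¹` and
`V_Y V_T⁻¹`.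

It remains to find the limit of `V_Y V_T⁻¹`. By the implicit function theorem the nuisance
parameter is profiled out along a smooth curve near the maximum, and the Hessian of the profile
likelihood is the Schur complement of the nuisance block; its inverse is the `θ`-block of the
inverse of the full Hessian (`exists_profile_hessian`, `isUnit_and_inv_profile`). So `N I_Y⁻¹` and
`N I_T⁻¹` are close to `V_Y` and `V_T` with high probability, and `I_Y⁻¹ (I_Y - I_T)` is close to
the deterministic matrix `1 - V_Y V_T⁻¹`, which must then converge to `F`
(`tendsto_ratio_of_observed`).

Finally the covariances of the linear statistics carry over to the estimators. The squared linear
statistics are uniformly integrable, so they are unaffected in the limit by truncation of the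
estimators at a large level, by passage to a weak limit, or, when the squared errors are uniformly
integrable, by replacement of the estimators themselves. Ratios are then controlled because the
`V_T` are uniformly coercive.
-/

/-! ### Coercive matrices -/

/-- Quantitative positive definiteness `c |v|² ≤ v · A v`, without symmetry. It passes to principal
blocks and bounds the entries of the inverse by `1 / c`, whatever the dimension. -/
def Coercive {ι : Type*} [Fintype ι] (c : ℝ) (A : Matrix ι ι ℝ) : Prop :=
  ∀ v : ι → ℝ, c * (v ⬝ᵥ v) ≤ v ⬝ᵥ A.mulVec v

section Coercive

variable {ι : Type*} [Fintype ι]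

lemma dotProduct_self_nonneg_real (v : ι → ℝ) : 0 ≤ v ⬝ᵥ v :=
  Finset.sum_nonneg fun i _ => mul_self_nonneg (v i)

lemma dotProduct_sq_le (u v : ι → ℝ) : (u ⬝ᵥ v) ^ 2 ≤ (u ⬝ᵥ u) * (v ⬝ᵥ v) := by
  have := Finset.sum_mul_sq_le_sq_mul_sq Finset.univ u v
  simpa [dotProduct, sq] using this

lemma sq_le_dotProduct_self (v : ι → ℝ) (i : ι) : v i ^ 2 ≤ v ⬝ᵥ v := by
  rw [sq]
  exact Finset.single_le_sum (f := fun i => v i * v i) (fun i _ => mul_self_nonneg (v i))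
    (Finset.mem_univ i)

lemma sum_abs_sq_le (v : ι → ℝ) : (∑ i, |v i|) ^ 2 ≤ Fintype.card ι * (v ⬝ᵥ v) := by
  have := sq_sum_le_card_mul_sum_sq (s := Finset.univ) (f := fun i => |v i|)
  simpa [dotProduct, sq] using this

lemma mulVec_dotProduct_self_le {A : Matrix ι ι ℝ} {M : ℝ}
    (hA : ∀ i j, |A i j| ≤ M) (v : ι → ℝ) :
    A.mulVec v ⬝ᵥ A.mulVec v ≤ (Fintype.card ι * M) ^ 2 * (v ⬝ᵥ v) := by
  have h1 : ∀ i, A.mulVec v i * A.mulVec v i ≤ M ^ 2 * (Fintype.card ι * (v ⬝ᵥ v)) := by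
    intro i
    have h2 : |A.mulVec v i| ≤ M * ∑ j, |v j| := by
      rw [Matrix.mulVec, dotProduct, Finset.mul_sum]
      refine (Finset.abs_sum_le_sum_abs _ _).trans (Finset.sum_le_sum fun j _ => ?_)
      rw [abs_mul]
      exact mul_le_mul_of_nonneg_right (hA i j) (abs_nonneg _)
    calc A.mulVec v i * A.mulVec v i = |A.mulVec v i| ^ 2 := by rw [sq_abs, sq]
      _ ≤ (M * ∑ j, |v j|) ^ 2 := pow_le_pow_left₀ (abs_nonneg _) h2 2
      _ = M ^ 2 * (∑ j, |v j|) ^ 2 := by ring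
      _ ≤ _ := mul_le_mul_of_nonneg_left (sum_abs_sq_le v) (sq_nonneg _)
  calc A.mulVec v ⬝ᵥ A.mulVec v ≤ ∑ _i : ι, M ^ 2 * (Fintype.card ι * (v ⬝ᵥ v)) :=
        Finset.sum_le_sum fun i _ => h1 i
    _ = _ := by simp; ring

lemma Coercive.perturb {A B : Matrix ι ι ℝ} {c η : ℝ} (hA : Coercive c A)
    (h : ∀ i j, |B i j - A i j| ≤ η) (hη : 0 ≤ η) :
    Coercive (c - Fintype.card ι * η) B := by
  intro v
  have h1 : |v ⬝ᵥ (B - A).mulVec v| ≤ η * (∑ i, |v i|) ^ 2 := by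
    rw [sq, Finset.sum_mul_sum, Finset.mul_sum, dotProduct]
    refine (Finset.abs_sum_le_sum_abs _ _).trans (Finset.sum_le_sum fun i _ => ?_)
    rw [abs_mul, Matrix.mulVec, dotProduct, Finset.mul_sum]
    refine (mul_le_mul_of_nonneg_left (Finset.abs_sum_le_sum_abs _ _) (abs_nonneg _)).trans ?_
    rw [Finset.mul_sum]
    refine Finset.sum_le_sum fun j _ => ?_
    rw [abs_mul, Matrix.sub_apply]
    nlinarith [mul_le_mul_of_nonneg_right (h i j)
      (mul_nonneg (abs_nonneg (v i)) (abs_nonneg (v j)))]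
  have h2 := mul_le_mul_of_nonneg_left (sum_abs_sq_le v) hη
  have h3 : v ⬝ᵥ B.mulVec v = v ⬝ᵥ A.mulVec v + v ⬝ᵥ (B - A).mulVec v := by
    rw [← dotProduct_add, ← Matrix.add_mulVec]; simp
  have h4 := hA v
  have h5 := neg_abs_le (v ⬝ᵥ (B - A).mulVec v)
  rw [h3]
  nlinarith

lemma Coercive.mono {A : Matrix ι ι ℝ} {c c' : ℝ} (hA : Coercive c A) (h : c' ≤ c) :
    Coercive c' A := fun v =>
  (mul_le_mul_of_nonneg_right h (dotProduct_self_nonneg_real v)).trans (hA v)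

lemma Coercive.toBlocks₁₁ {κ : Type*} [Fintype κ] {A : Matrix (ι ⊕ κ) (ι ⊕ κ) ℝ} {c : ℝ}
    (hA : Coercive c A) : Coercive c A.toBlocks₁₁ := by
  intro v
  have := hA (Sum.elim v 0)
  simpa [dotProduct, Matrix.mulVec, Matrix.toBlocks₁₁] using this

variable [DecidableEq ι]

lemma Coercive.isUnit_det {A : Matrix ι ι ℝ} {c : ℝ} (hc : 0 < c) (hA : Coercive c A) :
    IsUnit A.det := by
  rw [isUnit_iff_ne_zero]
  intro h0
  obtain ⟨v, hv, hv0⟩ := Matrix.exists_mulVec_eq_zero_iff.2 h0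
  have h1 := hA v
  rw [hv0, dotProduct_zero] at h1
  have h2 : v ⬝ᵥ v = 0 := le_antisymm (by nlinarith) (dotProduct_self_nonneg_real v)
  exact hv (dotProduct_self_eq_zero.1 h2)

lemma Coercive.inv_mulVec_le {A : Matrix ι ι ℝ} {c : ℝ} (hc : 0 < c) (hA : Coercive c A)
    (v : ι → ℝ) : c ^ 2 * (A⁻¹.mulVec v ⬝ᵥ A⁻¹.mulVec v) ≤ v ⬝ᵥ v := by
  set u := A⁻¹.mulVec v with hu
  have hAu : A.mulVec u = v := by
    rw [hu, Matrix.mulVec_mulVec, Matrix.mul_nonsing_inv _ (hA.isUnit_det hc), Matrix.one_mulVec]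
  have h1 := hA u
  rw [hAu] at h1
  have h2 := dotProduct_sq_le u v
  have h3 := dotProduct_self_nonneg_real u
  have h4 := dotProduct_self_nonneg_real v
  have h5 : (c * (u ⬝ᵥ u)) ^ 2 ≤ (u ⬝ᵥ u) * (v ⬝ᵥ v) :=
    (pow_le_pow_left₀ (by positivity) h1 2).trans h2
  rcases h3.eq_or_lt with h0 | h0
  · rw [← h0]; simpa using h4
  · have h6 : (u ⬝ᵥ u) * (c ^ 2 * (u ⬝ᵥ u)) ≤ (u ⬝ᵥ u) * (v ⬝ᵥ v) := by nlinarith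
    exact le_of_mul_le_mul_left h6 h0

lemma Coercive.abs_inv_le {A : Matrix ι ι ℝ} {c : ℝ} (hc : 0 < c) (hA : Coercive c A)
    (i j : ι) : |A⁻¹ i j| ≤ 1 / c := by
  have h1 := hA.inv_mulVec_le hc (Pi.single j 1)
  have h2 := sq_le_dotProduct_self (A⁻¹.mulVec (Pi.single j 1)) i
  have h3 : A⁻¹.mulVec (Pi.single j 1) i = A⁻¹ i j := by simp
  have h4 : (Pi.single j (1 : ℝ) : ι → ℝ) ⬝ᵥ Pi.single j 1 = 1 := by simp
  rw [h3] at h2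
  rw [h4] at h1
  rw [le_div_iff₀ hc]
  have h5 : (|A⁻¹ i j| * c) ^ 2 ≤ 1 ^ 2 := by
    rw [mul_pow, sq_abs]; nlinarith [sq_nonneg c]
  exact (pow_le_pow_iff_left₀ (by positivity) zero_le_one two_ne_zero).1 h5

/-- Inversion is Lipschitz on coercive matrices. -/
lemma Coercive.abs_inv_sub_inv_le {A B : Matrix ι ι ℝ} {c c' η : ℝ} (hc : 0 < c)
    (hc' : 0 < c') (hA : Coercive c A) (hB : Coercive c' B) (h : ∀ i j, |B i j - A i j| ≤ η)
    (i j : ι) : |(B⁻¹ - A⁻¹) i j| ≤ Fintype.card ι ^ 2 * η / (c * c') := by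
  have h1 : B⁻¹ - A⁻¹ = B⁻¹ * (A - B) * A⁻¹ := by
    rw [mul_sub, sub_mul, mul_assoc, Matrix.mul_nonsing_inv _ (hA.isUnit_det hc),
      Matrix.nonsing_inv_mul _ (hB.isUnit_det hc')]
    simp
  rw [h1, Matrix.mul_apply]
  have h2 : ∀ k, |(B⁻¹ * (A - B)) i k * A⁻¹ k j| ≤ Fintype.card ι * η / (c * c') := by
    intro k
    rw [abs_mul, Matrix.mul_apply]
    have h3 : |∑ l, B⁻¹ i l * (A - B) l k| ≤ ∑ _l : ι, 1 / c' * η := by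
      refine (Finset.abs_sum_le_sum_abs _ _).trans (Finset.sum_le_sum fun l _ => ?_)
      rw [abs_mul, Matrix.sub_apply, abs_sub_comm]
      exact mul_le_mul (hB.abs_inv_le hc' i l) (h l k) (abs_nonneg _) (by positivity)
    refine (mul_le_mul h3 (hA.abs_inv_le hc k j) (abs_nonneg _)
      ((abs_nonneg _).trans h3)).trans (le_of_eq ?_)
    simp; field_simp
  calc _ ≤ ∑ _k : ι, Fintype.card ι * η / (c * c') :=
        (Finset.abs_sum_le_sum_abs _ _).trans (Finset.sum_le_sum fun k _ => h2 k)
    _ = _ := by simp; field_simp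

/-- The inverse of a bounded coercive matrix is coercive: `v · A⁻¹ v = w · A w` with `w = A⁻¹ v`,
and `|v| ≤ |ι| M |w|`. -/
lemma Coercive.inv {A : Matrix ι ι ℝ} {c M : ℝ} (hc : 0 < c) (hA : Coercive c A)
    (hM : ∀ i j, |A i j| ≤ M) : Coercive (c / ((Fintype.card ι * M) ^ 2 + 1)) A⁻¹ := by
  intro v
  set w := A⁻¹.mulVec v with hw
  have hAw : A.mulVec w = v := by
    rw [hw, Matrix.mulVec_mulVec, Matrix.mul_nonsing_inv _ (hA.isUnit_det hc), Matrix.one_mulVec]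
  have h1 := hA w
  have h2 := mulVec_dotProduct_self_le hM w
  rw [hAw] at h1 h2
  rw [dotProduct_comm v w, div_mul_eq_mul_div, div_le_iff₀ (by positivity)]
  have h3 := dotProduct_self_nonneg_real w
  nlinarith [mul_nonneg (sq_nonneg (Fintype.card ι * M)) h3,
    mul_le_mul_of_nonneg_left h1 (by positivity : 0 ≤ (Fintype.card ι * M) ^ 2 + 1)]

/-- Uniform continuity of `(V, W) ↦ V W⁻¹` over bounded `V` and coercive `W`. -/
lemma exists_ratio_close (ι : Type*) [Fintype ι] [DecidableEq ι] {c M ε : ℝ} (hc : 0 < c)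
    (hM : 0 ≤ M) (hε : 0 < ε) :
    ∃ η > 0, ∀ C D V W : Matrix ι ι ℝ, Coercive c W → (∀ i j, |V i j| ≤ M) →
      (∀ i j, |C i j - V i j| ≤ η) → (∀ i j, |D i j - W i j| ≤ η) →
      IsUnit D.det ∧ ∀ i j, |(C * D⁻¹ - V * W⁻¹) i j| < ε := by
  set m : ℝ := (Fintype.card ι : ℝ) with hm
  have hm0 : 0 ≤ m := Nat.cast_nonneg _
  set Q : ℝ := m * (1 / (c / 2)) + m * (M * (m ^ 2 / (c * (c / 2)))) with hQ
  have hQ0 : 0 ≤ Q := by positivity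
  refine ⟨min (c / (2 * (m + 1))) (ε / (Q + 1)), lt_min (by positivity) (by positivity), ?_⟩
  set η := min (c / (2 * (m + 1))) (ε / (Q + 1)) with hη
  have hη0 : 0 < η := lt_min (by positivity) (by positivity)
  intro C D V W hW hV hC hD
  have h1 : m * η ≤ c / 2 := by
    have : η ≤ c / (2 * (m + 1)) := min_le_left _ _
    rw [le_div_iff₀ (by positivity)] at this
    nlinarith
  have hDc : Coercive (c / 2) D := (hW.perturb hD hη0.le).mono (by rw [← hm]; linarith)
  refine ⟨hDc.isUnit_det (by positivity), fun i j => ?_⟩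
  have h2 : C * D⁻¹ - V * W⁻¹ = (C - V) * D⁻¹ + V * (D⁻¹ - W⁻¹) := by
    rw [sub_mul, mul_sub]; abel
  have h3 : |((C - V) * D⁻¹) i j| ≤ m * (η * (1 / (c / 2))) := by
    rw [Matrix.mul_apply]
    refine (Finset.abs_sum_le_sum_abs _ _).trans
      ((Finset.sum_le_sum (g := fun _ => η * (1 / (c / 2))) fun k _ => ?_).trans (by simp [hm]))
    rw [abs_mul]
    exact mul_le_mul (hC i k) (hDc.abs_inv_le (by positivity) k j) (abs_nonneg _) hη0.le
  have h4 : |(V * (D⁻¹ - W⁻¹)) i j| ≤ m * (M * (m ^ 2 * η / (c * (c / 2)))) := by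
    rw [Matrix.mul_apply]
    refine (Finset.abs_sum_le_sum_abs _ _).trans
      ((Finset.sum_le_sum (g := fun _ => M * (m ^ 2 * η / (c * (c / 2)))) fun k _ => ?_).trans
        (by simp [hm]))
    rw [abs_mul]
    exact mul_le_mul (hV i k) (Coercive.abs_inv_sub_inv_le hc (by positivity) hW hDc hD k j)
      (abs_nonneg _) hM
  have h5 : η * (Q + 1) ≤ ε := by
    have : η ≤ ε / (Q + 1) := min_le_right _ _
    rwa [le_div_iff₀ (by positivity)] at this
  have h6 : m * (η * (1 / (c / 2))) + m * (M * (m ^ 2 * η / (c * (c / 2)))) = η * Q := by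
    rw [hQ]; ring
  rw [h2, Matrix.add_apply]
  calc _ ≤ _ := abs_add_le _ _
    _ ≤ η * Q := by rw [← h6]; exact add_le_add h3 h4
    _ < ε := by nlinarith

end Coercive

/-! ### Convergence in probability as convergence along a filter -/

/-- The filter of events of probability tending to one, for random variables that live on a
different probability space for each `n`. Convergence in probability is `Tendsto` along it. -/
def whp {S : ℕ → Type*} [∀ n, MeasurableSpace (S n)] (P : ∀ n, Measure (S n)) :
    Filter (Σ n, S n) where
  sets := {s | Tendsto (fun n => P n {y | (⟨n, y⟩ : Σ n, S n) ∉ s}) atTop (𝓝 0)}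
  univ_sets := by simp
  sets_of_superset := fun {s t} hs hst =>
    tendsto_of_tendsto_of_tendsto_of_le_of_le tendsto_const_nhds hs (fun _ => zero_le)
      fun n => measure_mono fun _ hy h => hy (hst h)
  inter_sets := fun {s t} hs ht => by
    have h := Tendsto.add (Set.mem_ofPred_eq ▸ hs : Tendsto _ _ _) (Set.mem_ofPred_eq ▸ ht)
    rw [add_zero] at h
    refine tendsto_of_tendsto_of_tendsto_of_le_of_le tendsto_const_nhds h (fun _ => zero_le)
      fun n => (measure_mono ?_).trans (measure_union_le _ _)
    intro y hy
    by_contra hcon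
    simp only [Set.mem_union, Set.mem_ofPred_eq, not_or, not_not] at hcon
    exact hy hcon

section Whp

variable {S : ℕ → Type*} [∀ n, MeasurableSpace (S n)] {P : ∀ n, Measure (S n)}

lemma eventually_whp {p : (Σ n, S n) → Prop} :
    (∀ᶠ x in whp P, p x) ↔ Tendsto (fun n => P n {y | ¬ p ⟨n, y⟩}) atTop (𝓝 0) := Iff.rfl

lemma eventually_whp_of_ae {p : (Σ n, S n) → Prop}
    (h : ∀ᶠ n in atTop, ∀ᵐ y ∂(P n), p ⟨n, y⟩) : ∀ᶠ x in whp P, p x := by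
  rw [eventually_whp]
  refine tendsto_const_nhds.congr' ?_
  filter_upwards [h] with n hn
  exact hn.symm

lemma eventually_whp_of_eventually {p : ℕ → Prop} (h : ∀ᶠ n in atTop, p n) :
    ∀ᶠ x in whp P, p x.1 :=
  eventually_whp_of_ae (h.mono fun _ hn => ae_of_all _ fun _ => hn)

lemma eventually_of_eventually_whp [∀ n, IsProbabilityMeasure (P n)] {p : ℕ → Prop}
    (h : ∀ᶠ x in whp P, p x.1) : ∀ᶠ n in atTop, p n := by
  rw [eventually_whp] at h
  filter_upwards [h.eventually (gt_mem_nhds one_pos)] with n hn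
  by_contra hcon
  simp [hcon] at hn

/-- A random statement about `T n` holds with probability tending to one as soon as it does so
under the image measures. -/
lemma eventually_whp_of_map {R : ℕ → Type*} [∀ n, MeasurableSpace (R n)] {T : ∀ n, S n → R n}
    (hT : ∀ n, Measurable (T n)) {p : (Σ n, R n) → Prop}
    (h : ∀ᶠ x in whp (fun n => (P n).map (T n)), p x) :
    ∀ᶠ x in whp P, p ⟨x.1, T x.1 x.2⟩ := by
  rw [eventually_whp] at h ⊢
  exact tendsto_of_tendsto_of_tendsto_of_le_of_le tendsto_const_nhds h (fun _ => zero_le)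
    fun n => Measure.le_map_apply (hT n).aemeasurable _

/-- Boundedness in probability. -/
def Tight (P : ∀ n, Measure (S n)) (f : ∀ n, S n → ℝ) : Prop :=
  ∀ ε : ℝ≥0∞, 0 < ε → ∃ K : ℝ, ∀ᶠ n in atTop, P n {y | K < f n y} ≤ ε

/-- To show that an event has probability tending to one, a variable that is bounded in
probability may be assumed to be bounded. -/
lemma Tight.eventually_whp {f : ∀ n, S n → ℝ} (hf : Tight P f) {p : (Σ n, S n) → Prop}
    (h : ∀ K : ℝ, ∀ᶠ x in whp P, f x.1 x.2 ≤ K → p x) : ∀ᶠ x in whp P, p x := by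
  rw [_root_.eventually_whp, ENNReal.tendsto_nhds_zero]
  intro ε hε
  obtain ⟨K, hK⟩ := hf (ε / 2) (ENNReal.half_pos hε.ne')
  have h1 := h K
  rw [_root_.eventually_whp, ENNReal.tendsto_nhds_zero] at h1
  filter_upwards [hK, h1 (ε / 2) (ENNReal.half_pos hε.ne')] with n hn1 hn2
  calc P n {y | ¬ p ⟨n, y⟩}
      ≤ P n ({y | K < f n y} ∪ {y | ¬ (f n y ≤ K → p ⟨n, y⟩)}) := by
        refine measure_mono fun y hy => ?_
        by_cases hK : K < f n y
        · exact Or.inl hK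
        · exact Or.inr fun h => hy (h (not_lt.1 hK))
    _ ≤ ε / 2 + ε / 2 := (measure_union_le _ _).trans (add_le_add hn1 hn2)
    _ = ε := ENNReal.add_halves ε

lemma tight_of_lintegral_le {f : ∀ n, S n → ℝ} (hf : ∀ n, AEMeasurable (f n) (P n)) {C : ℝ}
    (h : ∀ᶠ n in atTop, ∫⁻ y, ENNReal.ofReal (f n y) ∂(P n) ≤ ENNReal.ofReal C) :
    Tight P f := by
  intro ε hε
  rcases eq_or_ne ε ∞ with rfl | hε'
  · exact ⟨0, by simp⟩
  have hε0 : 0 < ε.toReal := ENNReal.toReal_pos hε.ne' hε'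
  refine ⟨(|C| + 1) / ε.toReal, h.mono fun n hn => ?_⟩
  have hK : 0 < (|C| + 1) / ε.toReal := by positivity
  have h1 := mul_meas_ge_le_lintegral₀ (hf n).ennreal_ofReal
    (ENNReal.ofReal ((|C| + 1) / ε.toReal))
  have h2 : P n {y | (|C| + 1) / ε.toReal < f n y} ≤
      P n {y | ENNReal.ofReal ((|C| + 1) / ε.toReal) ≤ ENNReal.ofReal (f n y)} :=
    measure_mono fun y hy => ENNReal.ofReal_le_ofReal (le_of_lt hy)
  have h3 : ENNReal.ofReal ((|C| + 1) / ε.toReal) *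
      P n {y | (|C| + 1) / ε.toReal < f n y} ≤
      ENNReal.ofReal ((|C| + 1) / ε.toReal) * ε := by
    refine (mul_le_mul_right h2 _).trans (h1.trans (hn.trans ?_))
    nth_rw 2 [← ENNReal.ofReal_toReal hε']
    rw [← ENNReal.ofReal_mul hK.le, div_mul_cancel₀ _ hε0.ne']
    exact ENNReal.ofReal_le_ofReal (by linarith [le_abs_self C])
  exact (ENNReal.mul_le_mul_iff_right (by simpa using hK) ENNReal.ofReal_ne_top).1 h3

/-! ### Uniform integrability through excesses over a level -/

/-- Asymptotic uniform integrability, expressed by the expected excess over a level `K`. Unlike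
the integral over a tail event, the excess is monotone and subadditive without any measurability
of events. -/
def UIExcess (P : ∀ n, Measure (S n)) (f : ∀ n, S n → ℝ) : Prop :=
  ∀ ε : ℝ, 0 < ε → ∃ K : ℝ, ∀ᶠ n in atTop,
    ∫⁻ y, ENNReal.ofReal (f n y - K) ∂(P n) ≤ ENNReal.ofReal ε

lemma ofReal_excess_le_indicator {Ω : Type*} (f : Ω → ℝ) (K : ℝ) (y : Ω) :
    ENNReal.ofReal (f y - max K 0) ≤
      Set.indicator {y | K ≤ f y} (fun y => ENNReal.ofReal (f y)) y := by
  by_cases h : K ≤ f y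
  · rw [Set.indicator_of_mem (show y ∈ {y | K ≤ f y} from h)]
    exact ENNReal.ofReal_le_ofReal (by linarith [le_max_right K 0])
  · rw [ENNReal.ofReal_of_nonpos (by linarith [le_max_left K 0])]
    exact zero_le

lemma Multiphase.UnifInt.excess {f : ∀ n, S n → ℝ} (hf : UnifInt P f) {ε : ℝ} (hε : 0 < ε) :
    ∃ K : ℝ, ∀ n, ∫⁻ y, ENNReal.ofReal (f n y - K) ∂(P n) ≤ ENNReal.ofReal ε := by
  obtain ⟨K, hK⟩ := hf ε hε
  exact ⟨max K 0, fun n => ((lintegral_mono (ofReal_excess_le_indicator (f n) K)).trans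
    (lintegral_indicator_le _ _)).trans (hK n)⟩

lemma Multiphase.UnifInt.uiExcess {f : ∀ n, S n → ℝ} (hf : UnifInt P f) : UIExcess P f :=
  fun _ hε => (hf.excess hε).imp fun _ h => .of_forall h

lemma UIExcess.of_le {f g : ∀ n, S n → ℝ} (hg : UIExcess P g) {C : ℝ} (hC : 0 < C)
    (h : ∀ᶠ n in atTop, ∀ y, f n y ≤ C * g n y) : UIExcess P f := by
  intro ε hε
  obtain ⟨K, hK⟩ := hg (ε / C) (by positivity)
  refine ⟨C * K, (h.and hK).mono fun n ⟨h1, h2⟩ => ?_⟩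
  calc ∫⁻ y, ENNReal.ofReal (f n y - C * K) ∂(P n)
      ≤ ∫⁻ y, ENNReal.ofReal C * ENNReal.ofReal (g n y - K) ∂(P n) := by
        refine lintegral_mono fun y => ?_
        rw [← ENNReal.ofReal_mul hC.le]
        exact ENNReal.ofReal_le_ofReal (by linarith [h1 y])
    _ = ENNReal.ofReal C * ∫⁻ y, ENNReal.ofReal (g n y - K) ∂(P n) :=
        lintegral_const_mul' _ _ ENNReal.ofReal_ne_top
    _ ≤ ENNReal.ofReal C * ENNReal.ofReal (ε / C) := by gcongr
    _ = ENNReal.ofReal ε := by rw [← ENNReal.ofReal_mul hC.le, mul_div_cancel₀ _ hC.ne']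

lemma UIExcess.add {f g : ∀ n, S n → ℝ} (hf : UIExcess P f) (hg : UIExcess P g)
    (hfm : ∀ n, AEMeasurable (f n) (P n)) : UIExcess P (fun n y => f n y + g n y) := by
  intro ε hε
  obtain ⟨K, hK⟩ := hf (ε / 2) (by positivity)
  obtain ⟨K', hK'⟩ := hg (ε / 2) (by positivity)
  refine ⟨K + K', (hK.and hK').mono fun n ⟨h1, h2⟩ => ?_⟩
  calc ∫⁻ y, ENNReal.ofReal (f n y + g n y - (K + K')) ∂(P n)
      ≤ ∫⁻ y, (ENNReal.ofReal (f n y - K) + ENNReal.ofReal (g n y - K')) ∂(P n) := by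
        refine lintegral_mono fun y => ?_
        rw [show f n y + g n y - (K + K') = (f n y - K) + (g n y - K') by ring]
        exact ENNReal.ofReal_add_le
    _ = _ := lintegral_add_left' ((hfm n).sub_const K).ennreal_ofReal _
    _ ≤ ENNReal.ofReal (ε / 2) + ENNReal.ofReal (ε / 2) := add_le_add h1 h2
    _ = ENNReal.ofReal ε := by rw [← ENNReal.ofReal_add (by positivity) (by positivity)]; simp

/-- A small expected excess over some level bounds the expectation. -/
lemma lintegral_le_of_excess {Ω : Type*} [MeasurableSpace Ω] {μ : Measure Ω}
    [IsProbabilityMeasure μ] {f : Ω → ℝ} {K ε : ℝ} (hε : 0 ≤ ε)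
    (h : ∫⁻ y, ENNReal.ofReal (f y - K) ∂μ ≤ ENNReal.ofReal ε) :
    ∫⁻ y, ENNReal.ofReal (f y) ∂μ ≤ ENNReal.ofReal (|K| + ε) := by
  calc ∫⁻ y, ENNReal.ofReal (f y) ∂μ
      ≤ ∫⁻ y, (ENNReal.ofReal |K| + ENNReal.ofReal (f y - K)) ∂μ := by
        refine lintegral_mono fun y => ?_
        refine le_trans (ENNReal.ofReal_le_ofReal ?_) ENNReal.ofReal_add_le
        linarith [le_abs_self K]
    _ = ENNReal.ofReal |K| + ∫⁻ y, ENNReal.ofReal (f y - K) ∂μ := by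
        rw [lintegral_add_left measurable_const]; simp
    _ ≤ _ := by rw [ENNReal.ofReal_add (abs_nonneg _) hε]; gcongr

lemma UIExcess.exists_bound [∀ n, IsProbabilityMeasure (P n)] {f : ∀ n, S n → ℝ}
    (hf : UIExcess P f) :
    ∃ M : ℝ, 0 ≤ M ∧ ∀ᶠ n in atTop, ∫⁻ y, ENNReal.ofReal (f n y) ∂(P n) ≤ ENNReal.ofReal M := by
  obtain ⟨K, hK⟩ := hf 1 one_pos
  exact ⟨|K| + 1, by positivity, hK.mono fun n hn => lintegral_le_of_excess zero_le_one hn⟩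

lemma UIExcess.mono_level {f : ∀ n, S n → ℝ} (hf : UIExcess P f) {ε : ℝ} (hε : 0 < ε) :
    ∃ K₀ : ℝ, ∀ K ≥ K₀, ∀ᶠ n in atTop,
      ∫⁻ y, ENNReal.ofReal (f n y - K) ∂(P n) ≤ ENNReal.ofReal ε := by
  obtain ⟨K₀, h⟩ := hf ε hε
  exact ⟨K₀, fun K hK => h.mono fun n hn =>
    (lintegral_mono fun y => ENNReal.ofReal_le_ofReal (by linarith)).trans hn⟩

/-- The error of truncating `u` at level `K`, when `u` is used to approximate `l`. If `u` is within
`δ ≤ 1` of `l` but is truncated, then `‖l‖ ≥ K / 2`, so the excess of `‖l‖²` over `K² / 8` is at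
least half of `‖l‖²`. The case that `u` is farther from `l` is left to its small probability. -/
lemma norm_trunc_sub_sq_le {G : Type*} [NormedAddCommGroup G] {τ : G → G} {K δ : ℝ}
    (h1 : ∀ u, ‖u‖ ≤ K → τ u = u) (h2 : ∀ u, ‖τ u‖ ≤ ‖u‖) (h3 : ∀ u, ‖τ u‖ ≤ K)
    (hK : 2 ≤ K) (hδ1 : δ ≤ 1) (u l : G) (D : ℝ)
    (hD : D = if δ < ‖u - l‖ then 1 else 0) :
    ‖τ u - l‖ ^ 2 ≤ 4 * K ^ 2 * D + (δ ^ 2 + 20 * max (‖l‖ ^ 2 - K ^ 2 / 8) 0) := by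
  have hm := le_max_left (‖l‖ ^ 2 - K ^ 2 / 8) 0
  have hm0 := le_max_right (‖l‖ ^ 2 - K ^ 2 / 8) 0
  have hl := norm_nonneg l
  have hτ := norm_sub_le (τ u) l
  split_ifs at hD with hd
  · have := h3 u
    have h4 : ‖τ u - l‖ ^ 2 ≤ (K + ‖l‖) ^ 2 :=
      pow_le_pow_left₀ (norm_nonneg _) (by linarith) 2
    rw [hD]
    nlinarith [sq_nonneg (K - ‖l‖), sq_nonneg δ]
  · rw [not_lt] at hd
    rw [hD]
    by_cases hu : ‖u‖ ≤ K
    · rw [h1 u hu]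
      have := pow_le_pow_left₀ (norm_nonneg _) hd 2
      linarith
    · have h5 := norm_sub_norm_le u l
      have h6 := h2 u
      have h7 : ‖τ u - l‖ ≤ 3 * ‖l‖ := by linarith
      have h8 : K / 2 ≤ ‖l‖ := by linarith
      have h9 := pow_le_pow_left₀ (norm_nonneg _) h7 2
      have h10 := pow_le_pow_left₀ (by linarith : 0 ≤ K / 2) h8 2
      nlinarith [sq_nonneg δ]

/-- If `U - L → 0` in probability and `‖L‖²` is uniformly integrable, truncations of `U` at a high
level are close to `L` in mean square. The truncation need not be continuous. -/
lemma exists_trunc_close {G : Type*} [NormedAddCommGroup G] {U L : ∀ n, S n → G}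
    [∀ n, IsProbabilityMeasure (P n)]
    (hL : ∀ n, AEMeasurable (fun y => ‖L n y‖) (P n))
    (hUL : Tendsto (fun x : Σ n, S n => ‖U x.1 x.2 - L x.1 x.2‖) (whp P) (𝓝 0))
    (hui : UIExcess P fun n y => ‖L n y‖ ^ 2) {ε : ℝ} (hε : 0 < ε) :
    ∃ K₀ : ℝ, ∀ K ≥ K₀, ∀ τ : G → G, (∀ u, ‖u‖ ≤ K → τ u = u) → (∀ u, ‖τ u‖ ≤ ‖u‖) →
      (∀ u, ‖τ u‖ ≤ K) → ∀ᶠ n in atTop,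
        ∫⁻ y, ENNReal.ofReal (‖τ (U n y) - L n y‖ ^ 2) ∂(P n) ≤ ENNReal.ofReal ε := by
  obtain ⟨K₁, hK₁⟩ := hui.mono_level (ε := ε / 3 / 20) (by positivity)
  set δ := min 1 (ε / 3) with hδ
  have hδ0 : 0 < δ := lt_min one_pos (by positivity)
  have hδ1 : δ ≤ 1 := min_le_left _ _
  have hδ2 : δ ^ 2 ≤ ε / 3 := by
    have : δ ≤ ε / 3 := min_le_right _ _
    nlinarith
  refine ⟨max 2 (8 * K₁), fun K hK τ h1 h2 h3 => ?_⟩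
  have hK2 : 2 ≤ K := (le_max_left _ _).trans hK
  have hKK : K₁ ≤ K ^ 2 / 8 := by
    have : 8 * K₁ ≤ K := (le_max_right _ _).trans hK
    nlinarith
  have hev : ∀ᶠ x in whp P, ¬ δ < ‖U x.1 x.2 - L x.1 x.2‖ := by
    filter_upwards [hUL.eventually (ge_mem_nhds hδ0)] with x hx using not_lt.2 hx
  rw [eventually_whp] at hev
  have hsmall : ∀ᶠ n in atTop, P n {y | δ < ‖U n y - L n y‖} ≤
      ENNReal.ofReal (ε / 3 / (4 * K ^ 2)) := by
    have := (ENNReal.tendsto_nhds_zero.1 hev) (ENNReal.ofReal (ε / 3 / (4 * K ^ 2)))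
      (by simp only [ENNReal.ofReal_pos]; positivity)
    simpa using this
  filter_upwards [hK₁ _ hKK, hsmall] with n hn1 hn2
  have hpt : ∀ y, ENNReal.ofReal (‖τ (U n y) - L n y‖ ^ 2) ≤
      Set.indicator {y | δ < ‖U n y - L n y‖} (fun _ => ENNReal.ofReal (4 * K ^ 2)) y +
        (ENNReal.ofReal (δ ^ 2) +
          ENNReal.ofReal 20 * ENNReal.ofReal (‖L n y‖ ^ 2 - K ^ 2 / 8)) := by
    intro y
    have := norm_trunc_sub_sq_le h1 h2 h3 hK2 hδ1 (U n y) (L n y) _ rfl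
    refine (ENNReal.ofReal_le_ofReal this).trans (ENNReal.ofReal_add_le.trans (add_le_add ?_
      (ENNReal.ofReal_add_le.trans (add_le_add le_rfl ?_))))
    · by_cases hd : δ < ‖U n y - L n y‖
      · rw [Set.indicator_of_mem (show y ∈ {y | δ < ‖U n y - L n y‖} from hd)]
        simp [hd]
      · simp [hd]
    · rw [ENNReal.ofReal_mul (by norm_num)]
      refine mul_le_mul_right (le_of_eq ?_) _
      rcases le_total (‖L n y‖ ^ 2 - K ^ 2 / 8) 0 with h | h
      · rw [max_eq_right h, ENNReal.ofReal_of_nonpos h, ENNReal.ofReal_zero]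
      · rw [max_eq_left h]
  have hmeas : AEMeasurable (fun y => ENNReal.ofReal (δ ^ 2) +
      ENNReal.ofReal 20 * ENNReal.ofReal (‖L n y‖ ^ 2 - K ^ 2 / 8)) (P n) :=
    ((((hL n).pow_const 2).sub_const _).ennreal_ofReal.const_mul _).const_add _
  refine (lintegral_mono hpt).trans ?_
  rw [lintegral_add_right' _ hmeas, lintegral_add_left measurable_const,
    lintegral_const_mul' _ _ ENNReal.ofReal_ne_top, lintegral_const, measure_univ, mul_one]
  have e1 : ∫⁻ y, Set.indicator {y | δ < ‖U n y - L n y‖}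
      (fun _ => ENNReal.ofReal (4 * K ^ 2)) y ∂(P n) ≤ ENNReal.ofReal (ε / 3) := by
    refine (lintegral_indicator_const_le _ _).trans ((mul_le_mul_right hn2 _).trans ?_)
    rw [← ENNReal.ofReal_mul (by positivity)]
    exact ENNReal.ofReal_le_ofReal (le_of_eq (by field_simp))
  have e2 : ENNReal.ofReal 20 * ∫⁻ y, ENNReal.ofReal (‖L n y‖ ^ 2 - K ^ 2 / 8) ∂(P n) ≤
      ENNReal.ofReal (ε / 3) := by
    refine (mul_le_mul_right hn1 _).trans ?_
    rw [← ENNReal.ofReal_mul (by norm_num)]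
    exact ENNReal.ofReal_le_ofReal (le_of_eq (by field_simp))
  refine (add_le_add e1 (add_le_add (ENNReal.ofReal_le_ofReal hδ2) e2)).trans (le_of_eq ?_)
  rw [← ENNReal.ofReal_add (by positivity) (by positivity),
    ← ENNReal.ofReal_add (by positivity) (by positivity)]
  congr 1; ring

end Whp

/-! ### Second moments of random vectors that are close in mean square -/

section Moments

variable {Ω : Type*} [MeasurableSpace Ω] {μ : Measure Ω}

lemma memLp_two_of_lintegral_sq {X : Ω → ℝ} (hX : AEMeasurable X μ) {C : ℝ}
    (h : ∫⁻ y, ENNReal.ofReal (X y ^ 2) ∂μ ≤ ENNReal.ofReal C) : MemLp X 2 μ := by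
  rw [memLp_two_iff_integrable_sq hX.aestronglyMeasurable]
  refine ⟨(hX.pow_const 2).aestronglyMeasurable, ?_⟩
  rw [hasFiniteIntegral_iff_ofReal (ae_of_all _ fun y => sq_nonneg _)]
  exact h.trans_lt ENNReal.ofReal_lt_top

lemma integral_sq_le_of_lintegral {X : Ω → ℝ} (hX : AEMeasurable X μ) {C : ℝ} (hC : 0 ≤ C)
    (h : ∫⁻ y, ENNReal.ofReal (X y ^ 2) ∂μ ≤ ENNReal.ofReal C) : ∫ y, X y ^ 2 ∂μ ≤ C := by
  rw [integral_eq_lintegral_of_nonneg_ae (ae_of_all _ fun y => sq_nonneg _)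
    (hX.pow_const 2).aestronglyMeasurable]
  exact ENNReal.toReal_le_of_le_ofReal hC h

lemma abs_integral_le_of_sq [IsProbabilityMeasure μ] {X : Ω → ℝ} (hX : MemLp X 2 μ) {s : ℝ}
    (hs : 0 ≤ s) (h : ∫ y, X y ^ 2 ∂μ ≤ s ^ 2) : |∫ y, X y ∂μ| ≤ s := by
  have h1 := variance_nonneg X μ
  rw [variance_eq_sub hX] at h1
  have h2 : (∫ y, X y ∂μ) ^ 2 ≤ s ^ 2 := by
    have : ∫ y, (X ^ 2) y ∂μ = ∫ y, X y ^ 2 ∂μ := rfl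
    linarith
  exact abs_le_of_sq_le_sq h2 hs

/-- Mean square closeness transfers to second moments. -/
lemma abs_integral_mul_sub_le {X Y X' Y' : Ω → ℝ} {s M : ℝ}
    (hX : MemLp X 2 μ) (hY : MemLp Y 2 μ) (hX' : MemLp X' 2 μ) (hY' : MemLp Y' 2 μ)
    (hs : 0 < s) (h1 : ∫ y, (X y - X' y) ^ 2 ∂μ ≤ s ^ 2) (h2 : ∫ y, (Y y - Y' y) ^ 2 ∂μ ≤ s ^ 2)
    (h3 : ∫ y, X' y ^ 2 ∂μ ≤ M) (h4 : ∫ y, Y' y ^ 2 ∂μ ≤ M) :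
    |∫ y, X y * Y y ∂μ - ∫ y, X' y * Y' y ∂μ| ≤ s ^ 2 + s * (1 + M) := by
  have i1 : Integrable (fun y => (X y - X' y) ^ 2) μ := (hX.sub hX').integrable_sq
  have i2 : Integrable (fun y => (Y y - Y' y) ^ 2) μ := (hY.sub hY').integrable_sq
  have i3 := hX'.integrable_sq
  have i4 := hY'.integrable_sq
  have j1 : Integrable (fun y => X y * Y y) μ := hX.integrable_mul hY
  have j2 : Integrable (fun y => X' y * Y' y) μ := hX'.integrable_mul hY'
  rw [← integral_sub j1 j2]
  refine abs_integral_le_integral_abs.trans ?_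
  have key : ∫ y, |X y * Y y - X' y * Y' y| ∂μ ≤
      ∫ y, ((1 / 2 + 1 / (2 * s)) * ((X y - X' y) ^ 2 + (Y y - Y' y) ^ 2) +
        s / 2 * (X' y ^ 2 + Y' y ^ 2)) ∂μ := by
    refine integral_mono (j1.sub j2).abs
      (((i1.add i2).const_mul _).add ((i3.add i4).const_mul _)) fun y => ?_
    have e : X y * Y y - X' y * Y' y =
      (X y - X' y) * (Y y - Y' y) + ((X y - X' y) * Y' y + X' y * (Y y - Y' y)) := by ring
    have w : ∀ a b : ℝ, |a * b| ≤ 1 / (2 * s) * a ^ 2 + s / 2 * b ^ 2 := by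
      intro a b
      rw [abs_mul, ← sq_abs a, ← sq_abs b]
      have : 1 / (2 * s) * |a| ^ 2 + s / 2 * |b| ^ 2 - |a| * |b| =
        (|a| - s * |b|) ^ 2 / (2 * s) := by field_simp; ring
      have h0 : 0 ≤ (|a| - s * |b|) ^ 2 / (2 * s) := by positivity
      linarith
    have w1 : ∀ a b : ℝ, |a * b| ≤ 1 / 2 * (a ^ 2 + b ^ 2) := by
      intro a b
      rw [abs_mul, ← sq_abs a, ← sq_abs b]
      nlinarith [sq_nonneg (|a| - |b|)]
    show |X y * Y y - X' y * Y' y| ≤ _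
    rw [e]
    have e1 := abs_add_le ((X y - X' y) * (Y y - Y' y))
      ((X y - X' y) * Y' y + X' y * (Y y - Y' y))
    have e2 := abs_add_le ((X y - X' y) * Y' y) (X' y * (Y y - Y' y))
    have e3 := w1 (X y - X' y) (Y y - Y' y)
    have e4 := w (X y - X' y) (Y' y)
    have e5 := w (Y y - Y' y) (X' y)
    rw [mul_comm (Y y - Y' y)] at e5
    nlinarith
  refine key.trans ?_
  have i12 : Integrable (fun y => (1 / 2 + 1 / (2 * s)) *
      ((X y - X' y) ^ 2 + (Y y - Y' y) ^ 2)) μ := (i1.add i2).const_mul _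
  have i34 : Integrable (fun y => s / 2 * (X' y ^ 2 + Y' y ^ 2)) μ := (i3.add i4).const_mul _
  rw [integral_add i12 i34, integral_const_mul,
    integral_const_mul, integral_add i1 i2, integral_add i3 i4]
  have hp : 0 ≤ 1 / 2 + 1 / (2 * s) := by positivity
  calc _ ≤ (1 / 2 + 1 / (2 * s)) * (s ^ 2 + s ^ 2) + s / 2 * (M + M) := by gcongr
    _ = _ := by field_simp; ring

lemma abs_cov_sub_le [IsProbabilityMeasure μ] {X Y X' Y' : Ω → ℝ} {s M : ℝ}
    (hX : MemLp X 2 μ) (hY : MemLp Y 2 μ) (hX' : MemLp X' 2 μ) (hY' : MemLp Y' 2 μ)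
    (hs : 0 < s) (h1 : ∫ y, (X y - X' y) ^ 2 ∂μ ≤ s ^ 2) (h2 : ∫ y, (Y y - Y' y) ^ 2 ∂μ ≤ s ^ 2)
    (h3 : ∫ y, X' y ^ 2 ∂μ ≤ M) (h4 : ∫ y, Y' y ^ 2 ∂μ ≤ M)
    (h5 : ∫ y, X' y ∂μ = 0) (h6 : ∫ y, Y' y ∂μ = 0) :
    |cov[X, Y; μ] - ∫ y, X' y * Y' y ∂μ| ≤ 2 * s ^ 2 + s * (1 + M) := by
  have a1 : |∫ y, X y ∂μ| ≤ s := by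
    have := abs_integral_le_of_sq (hX.sub hX') hs.le h1
    rwa [integral_sub' (hX.integrable one_le_two) (hX'.integrable one_le_two), h5, sub_zero] at this
  have a2 : |∫ y, Y y ∂μ| ≤ s := by
    have := abs_integral_le_of_sq (hY.sub hY') hs.le h2
    rwa [integral_sub' (hY.integrable one_le_two) (hY'.integrable one_le_two), h6, sub_zero] at this
  have a3 := abs_integral_mul_sub_le hX hY hX' hY' hs h1 h2 h3 h4
  have a4 : |(∫ y, X y ∂μ) * ∫ y, Y y ∂μ| ≤ s ^ 2 := by
    rw [abs_mul, sq]
    exact mul_le_mul a1 a2 (abs_nonneg _) hs.le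
  rw [covariance_eq_sub hX hY]
  have e : ∫ y, (X * Y) y ∂μ = ∫ y, X y * Y y ∂μ := rfl
  rw [e, show ∀ a b c : ℝ, a - b - c = (a - c) - b by intros; ring]
  refine (abs_sub _ _).trans ?_
  linarith

lemma coord_sq_le {d : ℕ} (v : EuclideanSpace ℝ (Fin d)) (i : Fin d) : v i ^ 2 ≤ ‖v‖ ^ 2 := by
  have := PiLp.norm_apply_le v i
  rw [← sq_abs (v i)]
  exact pow_le_pow_left₀ (abs_nonneg _) this 2

lemma lintegral_coord_sq_le {d : ℕ} {A : Ω → EuclideanSpace ℝ (Fin d)} {C : ℝ≥0∞}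
    (h : ∫⁻ y, ENNReal.ofReal (‖A y‖ ^ 2) ∂μ ≤ C) (i : Fin d) :
    ∫⁻ y, ENNReal.ofReal (A y i ^ 2) ∂μ ≤ C :=
  (lintegral_mono fun _ => ENNReal.ofReal_le_ofReal (coord_sq_le _ i)).trans h

lemma aemeasurable_coord {d : ℕ} {A : Ω → EuclideanSpace ℝ (Fin d)} (hA : AEMeasurable A μ)
    (i : Fin d) : AEMeasurable (fun y => A y i) μ := by
  have : Measurable fun v : EuclideanSpace ℝ (Fin d) => v i := by fun_prop
  exact this.comp_aemeasurable hA

/-- Covariance matrices are stable under mean square approximation by a centred vector, with a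
modulus that depends only on a bound for the second moment. -/
lemma exists_covMatrix_close (d : ℕ) {M η : ℝ} (hM : 0 ≤ M) (hη : 0 < η) :
    ∃ ε > 0, ∀ {Ω : Type*} [MeasurableSpace Ω] (μ : Measure Ω) [IsProbabilityMeasure μ]
      (A L : Ω → EuclideanSpace ℝ (Fin d)), AEMeasurable A μ → AEMeasurable L μ →
      ∫⁻ y, ENNReal.ofReal (‖A y - L y‖ ^ 2) ∂μ ≤ ENNReal.ofReal ε →
      ∫⁻ y, ENNReal.ofReal (‖L y‖ ^ 2) ∂μ ≤ ENNReal.ofReal M →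
      (∀ i, ∫ y, L y i ∂μ = 0) →
      ∀ i j, |covMatrix μ A i j - ∫ y, L y i * L y j ∂μ| ≤ η := by
  set s := min 1 (η / (3 + M)) with hs
  have hs0 : 0 < s := lt_min one_pos (by positivity)
  have hs1 : s ≤ 1 := min_le_left _ _
  have hs2 : s * (3 + M) ≤ η := by
    have : s ≤ η / (3 + M) := min_le_right _ _
    rwa [le_div_iff₀ (by positivity)] at this
  refine ⟨s ^ 2, by positivity, fun μ _ A L hA hL h1 h2 h3 i j => ?_⟩
  have hLi : ∀ i, MemLp (fun y => L y i) 2 μ := fun i =>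
    memLp_two_of_lintegral_sq (aemeasurable_coord hL i) (lintegral_coord_sq_le h2 i)
  have hdm : ∀ i, AEMeasurable (fun y => A y i - L y i) μ := fun i =>
    (aemeasurable_coord hA i).sub (aemeasurable_coord hL i)
  have hd : ∀ i, ∫⁻ y, ENNReal.ofReal ((A y i - L y i) ^ 2) ∂μ ≤ ENNReal.ofReal (s ^ 2) :=
    fun i => lintegral_coord_sq_le (A := fun y => A y - L y) h1 i
  have hAi : ∀ i, MemLp (fun y => A y i) 2 μ := fun i => by
    have := (memLp_two_of_lintegral_sq (hdm i) (hd i)).add (hLi i)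
    refine this.ae_eq (ae_of_all _ fun _ => ?_)
    simp
  have := abs_cov_sub_le (hAi i) (hAi j) (hLi i) (hLi j) hs0
    (integral_sq_le_of_lintegral (hdm i) (sq_nonneg s) (hd i))
    (integral_sq_le_of_lintegral (hdm j) (sq_nonneg s) (hd j))
    (integral_sq_le_of_lintegral (aemeasurable_coord hL i) hM (lintegral_coord_sq_le h2 i))
    (integral_sq_le_of_lintegral (aemeasurable_coord hL j) hM (lintegral_coord_sq_le h2 j))
    (h3 i) (h3 j)
  rw [covMatrix, Matrix.of_apply]
  nlinarith

end Moments

/-! ### Asymptotically linear sequences and their covariances -/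

/-- `U` is asymptotically equivalent in probability to `L`, where the `L n` are centred with
covariance matrices `V n` and have uniformly integrable squared norms. The `L n` play the role of
the linear statistics (inverse information times score), so no central limit theorem is needed. -/
structure AsympLinear {S : ℕ → Type*} [∀ n, MeasurableSpace (S n)] {d : ℕ}
    (P : ∀ n, Measure (S n)) (U L : ∀ n, S n → EuclideanSpace ℝ (Fin d))
    (V : ℕ → Matrix (Fin d) (Fin d) ℝ) : Prop where
  measurable : ∀ n, Measurable (U n)
  aemeasurable : ∀ n, AEMeasurable (L n) (P n)
  close : Tendsto (fun x : Σ n, S n => ‖U x.1 x.2 - L x.1 x.2‖) (whp P) (𝓝 0)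
  uiExcess : UIExcess P fun n y => ‖L n y‖ ^ 2
  mean : ∀ᶠ n in atTop, ∀ i, ∫ y, L n y i ∂(P n) = 0
  second : ∀ᶠ n in atTop, ∀ i j, ∫ y, L n y i * L n y j ∂(P n) = V n i j

section AsympLinear

variable {S : ℕ → Type*} [∀ n, MeasurableSpace (S n)] {d : ℕ} {P : ∀ n, Measure (S n)}
  [∀ n, IsProbabilityMeasure (P n)]
  {U L U' L' : ∀ n, S n → EuclideanSpace ℝ (Fin d)} {V V' : ℕ → Matrix (Fin d) (Fin d) ℝ}

/-- If the linear parts satisfy `Cov(L', L) = Var(L')`, the variance of `U - U'` is the difference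
of the variances. -/
lemma AsympLinear.sub (h : AsympLinear P U L V) (h' : AsympLinear P U' L' V')
    (hcross : ∀ᶠ n in atTop, ∀ i j, ∫ y, L' n y i * L n y j ∂(P n) = V' n i j)
    (hsymm : ∀ᶠ n in atTop, (V' n).IsSymm) :
    AsympLinear P (fun n y => U n y - U' n y) (fun n y => L n y - L' n y)
      (fun n => V n - V' n) where
  measurable n := (h.measurable n).sub (h'.measurable n)
  aemeasurable n := (h.aemeasurable n).sub (h'.aemeasurable n)
  close := by
    have := h.close.add h'.close
    rw [add_zero] at this
    refine squeeze_zero (fun _ => norm_nonneg _) (fun x => ?_) this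
    rw [sub_sub_sub_comm]
    exact norm_sub_le _ _
  uiExcess := by
    refine (h.uiExcess.add h'.uiExcess
      fun n => (h.aemeasurable n).norm.pow_const 2).of_le (C := 2) two_pos ?_
    refine .of_forall fun n y => ?_
    have := pow_le_pow_left₀ (norm_nonneg _) (norm_sub_le (L n y) (L' n y)) 2
    nlinarith [sq_nonneg (‖L n y‖ - ‖L' n y‖)]
  mean := by
    obtain ⟨M, hM, hb⟩ := h.uiExcess.exists_bound
    obtain ⟨M', hM', hb'⟩ := h'.uiExcess.exists_bound
    filter_upwards [h.mean, h'.mean, hb, hb'] with n h1 h2 h3 h4 i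
    have m1 := memLp_two_of_lintegral_sq (aemeasurable_coord (h.aemeasurable n) i)
      (lintegral_coord_sq_le h3 i)
    have m2 := memLp_two_of_lintegral_sq (aemeasurable_coord (h'.aemeasurable n) i)
      (lintegral_coord_sq_le h4 i)
    simp only [PiLp.sub_apply]
    rw [integral_sub (m1.integrable one_le_two) (m2.integrable one_le_two), h1, h2, sub_zero]
  second := by
    obtain ⟨M, hM, hb⟩ := h.uiExcess.exists_bound
    obtain ⟨M', hM', hb'⟩ := h'.uiExcess.exists_bound
    filter_upwards [h.second, h'.second, hb, hb', hcross, hsymm] with n h1 h2 h3 h4 h5 h6 i j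
    have m1 : ∀ i, MemLp (fun y => L n y i) 2 (P n) := fun i =>
      memLp_two_of_lintegral_sq (aemeasurable_coord (h.aemeasurable n) i)
        (lintegral_coord_sq_le h3 i)
    have m2 : ∀ i, MemLp (fun y => L' n y i) 2 (P n) := fun i =>
      memLp_two_of_lintegral_sq (aemeasurable_coord (h'.aemeasurable n) i)
        (lintegral_coord_sq_le h4 i)
    have e : ∀ y, (L n y - L' n y) i * (L n y - L' n y) j =
        (L n y i * L n y j - L' n y j * L n y i) -
          (L' n y i * L n y j - L' n y i * L' n y j) := by
      intro y; simp only [PiLp.sub_apply]; ring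
    have k1 : Integrable (fun y => L n y i * L n y j) (P n) := (m1 i).integrable_mul (m1 j)
    have k2 : Integrable (fun y => L' n y j * L n y i) (P n) := (m2 j).integrable_mul (m1 i)
    have k3 : Integrable (fun y => L' n y i * L n y j) (P n) := (m2 i).integrable_mul (m1 j)
    have k4 : Integrable (fun y => L' n y i * L' n y j) (P n) := (m2 i).integrable_mul (m2 j)
    simp_rw [e]
    have k12 : Integrable (fun y => L n y i * L n y j - L' n y j * L n y i) (P n) := k1.sub k2
    have k34 : Integrable (fun y => L' n y i * L n y j - L' n y i * L' n y j) (P n) := k3.sub k4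
    rw [integral_sub k12 k34, integral_sub k1 k2, integral_sub k3 k4,
      h1, h2, h5, h5, Matrix.sub_apply]
    linarith [h6.apply i j]

/-- Covariance ratios of any mean square approximations of the linear parts. -/
lemma exists_ratio_approx (hA : AsympLinear P U L V) (hB : AsympLinear P U' L' V')
    {c M : ℝ} (hc : 0 < c) (hM : 0 ≤ M) (hV' : ∀ᶠ n in atTop, Coercive c (V' n))
    (hV : ∀ᶠ n in atTop, ∀ i j, |V n i j| ≤ M) {R : Matrix (Fin d) (Fin d) ℝ}
    (hR : Tendsto (fun n => V n * (V' n)⁻¹) atTop (𝓝 R)) {ε : ℝ} (hε : 0 < ε) :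
    ∃ κ > 0, ∀ A B : ∀ n, S n → EuclideanSpace ℝ (Fin d), (∀ n, Measurable (A n)) →
      (∀ n, Measurable (B n)) →
      (∀ᶠ n in atTop, ∫⁻ y, ENNReal.ofReal (‖A n y - L n y‖ ^ 2) ∂(P n) ≤ ENNReal.ofReal κ) →
      (∀ᶠ n in atTop, ∫⁻ y, ENNReal.ofReal (‖B n y - L' n y‖ ^ 2) ∂(P n) ≤ ENNReal.ofReal κ) →
      ∀ᶠ n in atTop, IsUnit (covMatrix (P n) (B n)).det ∧
        ∀ i j, |(covMatrix (P n) (A n) * (covMatrix (P n) (B n))⁻¹ - R) i j| < ε := by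
  obtain ⟨η, hη, hclose⟩ := exists_ratio_close (Fin d) hc hM (half_pos hε)
  obtain ⟨M₁, hM₁, hb⟩ := hA.uiExcess.exists_bound
  obtain ⟨M₂, hM₂, hb'⟩ := hB.uiExcess.exists_bound
  obtain ⟨κ₁, hκ₁, hcov₁⟩ := exists_covMatrix_close d hM₁ hη
  obtain ⟨κ₂, hκ₂, hcov₂⟩ := exists_covMatrix_close d hM₂ hη
  refine ⟨min κ₁ κ₂, lt_min hκ₁ hκ₂, fun A B hAm hBm hAc hBc => ?_⟩
  have hR' : ∀ᶠ n in atTop, ∀ i j, |(V n * (V' n)⁻¹ - R) i j| < ε / 2 := by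
    rw [eventually_all]
    intro i
    rw [eventually_all]
    intro j
    have h1 : Tendsto (fun n => (V n * (V' n)⁻¹) i j) atTop (𝓝 (R i j)) :=
      (tendsto_pi_nhds.1 ((tendsto_pi_nhds.1 hR) i)) j
    have := (Metric.tendsto_nhds.1 h1) (ε / 2) (half_pos hε)
    simpa [Real.dist_eq] using this
  filter_upwards [hV', hV, hb, hb', hA.mean, hA.second, hB.mean, hB.second, hAc, hBc, hR'] with
    n h1 h2 h3 h4 h5 h6 h7 h8 h9 h10 h11
  have c1 := hcov₁ (P n) (A n) (L n) (hAm n).aemeasurable (hA.aemeasurable n)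
    (h9.trans (ENNReal.ofReal_le_ofReal (min_le_left _ _))) h3 h5
  have c2 := hcov₂ (P n) (B n) (L' n) (hBm n).aemeasurable (hB.aemeasurable n)
    (h10.trans (ENNReal.ofReal_le_ofReal (min_le_right _ _))) h4 h7
  simp_rw [h6] at c1
  simp_rw [h8] at c2
  obtain ⟨u, hu⟩ := hclose _ _ _ _ h1 h2 c1 c2
  refine ⟨u, fun i j => ?_⟩
  have e : covMatrix (P n) (A n) * (covMatrix (P n) (B n))⁻¹ - R =
      (covMatrix (P n) (A n) * (covMatrix (P n) (B n))⁻¹ - V n * (V' n)⁻¹) +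
        (V n * (V' n)⁻¹ - R) := by abel
  rw [e, Matrix.add_apply]
  have := abs_add_le ((covMatrix (P n) (A n) * (covMatrix (P n) (B n))⁻¹ - V n * (V' n)⁻¹) i j)
    ((V n * (V' n)⁻¹ - R) i j)
  linarith [hu i j, h11 i j]

lemma measurable_truncate (d : ℕ) (K : ℝ) :
    Measurable (truncate K : EuclideanSpace ℝ (Fin d) → EuclideanSpace ℝ (Fin d)) := by
  classical
  unfold truncate
  exact Measurable.ite (measurableSet_le measurable_norm measurable_const) measurable_id
    measurable_const

lemma AsympLinear.exists_truncate_close (h : AsympLinear P U L V) {ε : ℝ} (hε : 0 < ε) :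
    ∃ K₀ : ℝ, ∀ K ≥ K₀, ∀ᶠ n in atTop,
      ∫⁻ y, ENNReal.ofReal (‖truncate K (U n y) - L n y‖ ^ 2) ∂(P n) ≤ ENNReal.ofReal ε := by
  obtain ⟨K₀, hK₀⟩ := exists_trunc_close (fun n => (h.aemeasurable n).norm) h.close h.uiExcess hε
  refine ⟨max K₀ 0, fun K hK => hK₀ K ((le_max_left _ _).trans hK) (truncate K) ?_ ?_ ?_⟩
  · intro u hu
    simp [truncate, hu]
  · intro u
    unfold truncate
    split_ifs <;> simp
  · intro u
    unfold truncate
    split_ifs with hu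
    · exact hu
    · simpa using (le_max_right _ _).trans hK

/-- The ratio of asymptotic variances, through truncations of the estimators. -/
lemma AsympLinear.asympVarRatio (hA : AsympLinear P U L V) (hB : AsympLinear P U' L' V')
    {c M : ℝ} (hc : 0 < c) (hM : 0 ≤ M) (hV' : ∀ᶠ n in atTop, Coercive c (V' n))
    (hV : ∀ᶠ n in atTop, ∀ i j, |V n i j| ≤ M) {R : Matrix (Fin d) (Fin d) ℝ}
    (hR : Tendsto (fun n => V n * (V' n)⁻¹) atTop (𝓝 R)) : AsympVarRatio P U U' R := by
  intro ε hε
  obtain ⟨κ, hκ, h⟩ := exists_ratio_approx hA hB hc hM hV' hV hR hε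
  obtain ⟨K₁, h1⟩ := hA.exists_truncate_close hκ
  obtain ⟨K₂, h2⟩ := hB.exists_truncate_close hκ
  exact ⟨max K₁ K₂, fun K hK => h (fun n y => truncate K (U n y)) (fun n y => truncate K (U' n y))
    (fun n => (measurable_truncate d K).comp (hA.measurable n))
    (fun n => (measurable_truncate d K).comp (hB.measurable n))
    (h1 K ((le_max_left _ _).trans hK)) (h2 K ((le_max_right _ _).trans hK))⟩

/-- If also `‖U‖²` is uniformly integrable, then `U - L → 0` in mean square. -/
lemma AsympLinear.tendsto_meanSquare (h : AsympLinear P U L V)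
    (hU : UIExcess P fun n y => ‖U n y‖ ^ 2) {ε : ℝ} (hε : 0 < ε) :
    ∀ᶠ n in atTop, ∫⁻ y, ENNReal.ofReal (‖U n y - L n y‖ ^ 2) ∂(P n) ≤ ENNReal.ofReal ε := by
  obtain ⟨K₁, h1⟩ := h.exists_truncate_close (ε := ε / 4) (by positivity)
  obtain ⟨K₂, h2⟩ := hU.mono_level (ε := ε / 8) (by positivity)
  set K := max K₁ (max (2 * K₂) 1) with hKdef
  have hK1 : K₁ ≤ K := le_max_left _ _
  have hK2 : 2 * K₂ ≤ K := (le_max_left _ _).trans (le_max_right _ _)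
  have hK3 : 1 ≤ K := (le_max_right _ _).trans (le_max_right _ _)
  filter_upwards [h1 K hK1, h2 (K ^ 2 / 2) (by nlinarith)] with n a1 a2
  have hpt : ∀ y, ENNReal.ofReal (‖U n y - L n y‖ ^ 2) ≤
      ENNReal.ofReal 2 * ENNReal.ofReal (‖truncate K (U n y) - L n y‖ ^ 2) +
        ENNReal.ofReal 4 * ENNReal.ofReal (‖U n y‖ ^ 2 - K ^ 2 / 2) := by
    intro y
    rw [← ENNReal.ofReal_mul (by norm_num), ← ENNReal.ofReal_mul (by norm_num)]
    by_cases hy : ‖U n y‖ ≤ K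
    · refine le_trans (ENNReal.ofReal_le_ofReal ?_) le_self_add
      simp only [truncate, hy, if_true]
      nlinarith [sq_nonneg ‖U n y - L n y‖]
    · refine le_trans (ENNReal.ofReal_le_ofReal ?_) ENNReal.ofReal_add_le
      simp only [truncate, hy, if_false, zero_sub, norm_neg]
      have b1 := pow_le_pow_left₀ (norm_nonneg _) (norm_sub_le (U n y) (L n y)) 2
      have b2 := pow_le_pow_left₀ (by linarith) (le_of_lt (not_le.1 hy)) 2
      nlinarith [sq_nonneg (‖U n y‖ - ‖L n y‖)]
  refine (lintegral_mono hpt).trans ?_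
  have hm : AEMeasurable (fun y => ENNReal.ofReal 4 * ENNReal.ofReal (‖U n y‖ ^ 2 - K ^ 2 / 2))
      (P n) :=
    ((((h.measurable n).norm.pow_const 2).sub_const _).ennreal_ofReal.const_mul _).aemeasurable
  rw [lintegral_add_right' _ hm, lintegral_const_mul' _ _ ENNReal.ofReal_ne_top,
    lintegral_const_mul' _ _ ENNReal.ofReal_ne_top]
  refine (add_le_add (mul_le_mul_right a1 _) (mul_le_mul_right a2 _)).trans (le_of_eq ?_)
  rw [← ENNReal.ofReal_mul (by norm_num), ← ENNReal.ofReal_mul (by norm_num),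
    ← ENNReal.ofReal_add (by positivity) (by positivity)]
  congr 1; ring

lemma covMatrix_smul_sub {Ω : Type*} [MeasurableSpace Ω] {μ : Measure Ω} [IsProbabilityMeasure μ]
    (Z : Ω → EuclideanSpace ℝ (Fin d)) (a : EuclideanSpace ℝ (Fin d)) (r : ℝ)
    (hZ : ∀ i, Integrable (fun y => Z y i) μ) :
    covMatrix μ (fun y => r • (Z y - a)) = r ^ 2 • covMatrix μ Z := by
  ext i j
  simp only [covMatrix, Matrix.of_apply, Matrix.smul_apply, PiLp.smul_apply, PiLp.sub_apply,
    smul_eq_mul]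
  rw [covariance_const_mul_left, covariance_const_mul_right, covariance_sub_const_left (hZ i),
    covariance_sub_const_right (hZ j)]
  ring

lemma isUnit_det_and_ratio_smul {C D : Matrix (Fin d) (Fin d) ℝ} {r : ℝ} (hr : r ≠ 0)
    (hD : IsUnit (r • D).det) : IsUnit D.det ∧ (r • C) * (r • D)⁻¹ = C * D⁻¹ := by
  have h1 : IsUnit D.det := by
    rw [Matrix.det_smul] at hD
    exact isUnit_of_mul_isUnit_right hD
  refine ⟨h1, ?_⟩
  have : (r • D)⁻¹ = r⁻¹ • D⁻¹ := by
    refine Matrix.inv_eq_left_inv ?_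
    rw [Matrix.smul_mul, Matrix.mul_smul, smul_smul, inv_mul_cancel₀ hr,
      Matrix.nonsing_inv_mul _ h1, one_smul]
  rw [this, Matrix.smul_mul, Matrix.mul_smul, smul_smul, mul_inv_cancel₀ hr, one_smul]

end AsympLinear

section VarianceRatio

variable {S : ℕ → Type*} [∀ n, MeasurableSpace (S n)] {d : ℕ} {P : ∀ n, Measure (S n)}
  [∀ n, IsProbabilityMeasure (P n)] {L L' : ∀ n, S n → EuclideanSpace ℝ (Fin d)}
  {V V' : ℕ → Matrix (Fin d) (Fin d) ℝ}

lemma eventually_integrable_coord {N : ℕ → ℝ} (hN : ∀ n, 0 < N n)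
    {X : ∀ n, S n → EuclideanSpace ℝ (Fin d)} {a : EuclideanSpace ℝ (Fin d)}
    (hX : ∀ n, Measurable fun y => √(N n) • (X n y - a))
    (hui : UIExcess P fun n y => ‖√(N n) • (X n y - a)‖ ^ 2) :
    ∀ᶠ n in atTop, ∀ i, Integrable (fun y => X n y i) (P n) := by
  obtain ⟨M, -, hb⟩ := hui.exists_bound
  filter_upwards [hb] with n hn i
  have h1 := (memLp_two_of_lintegral_sq (aemeasurable_coord (hX n).aemeasurable i)
    (lintegral_coord_sq_le hn i)).integrable one_le_two
  have h2 : (fun y => X n y i) =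
      fun y => (√(N n))⁻¹ * (√(N n) • (X n y - a)) i + a i := by
    have : √(N n) ≠ 0 := (Real.sqrt_pos.2 (hN n)).ne'
    funext y
    simp only [PiLp.smul_apply, PiLp.sub_apply, smul_eq_mul]
    field_simp
    ring
  rw [h2]
  exact (h1.const_mul _).add (integrable_const _)

/-- The ratio of the actual variances. The scale `N` and the centring drop out of it. -/
lemma varRatioTendsto_of_asympLinear {N : ℕ → ℝ} (hN : ∀ n, 0 < N n)
    {X X' : ∀ n, S n → EuclideanSpace ℝ (Fin d)} {a a' : EuclideanSpace ℝ (Fin d)}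
    (hA : AsympLinear P (fun n y => √(N n) • (X n y - a)) L V)
    (hB : AsympLinear P (fun n y => √(N n) • (X' n y - a')) L' V')
    (huA : UIExcess P fun n y => ‖√(N n) • (X n y - a)‖ ^ 2)
    (huB : UIExcess P fun n y => ‖√(N n) • (X' n y - a')‖ ^ 2)
    {c M : ℝ} (hc : 0 < c) (hM : 0 ≤ M) (hV' : ∀ᶠ n in atTop, Coercive c (V' n))
    (hV : ∀ᶠ n in atTop, ∀ i j, |V n i j| ≤ M) {R : Matrix (Fin d) (Fin d) ℝ}
    (hR : Tendsto (fun n => V n * (V' n)⁻¹) atTop (𝓝 R)) : VarRatioTendsto P X X' R := by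
  have key : ∀ ε > 0, ∀ᶠ n in atTop, IsUnit (covMatrix (P n) (X' n)).det ∧
      ∀ i j, |(covMatrix (P n) (X n) * (covMatrix (P n) (X' n))⁻¹ - R) i j| < ε := by
    intro ε hε
    obtain ⟨κ, hκ, h⟩ := exists_ratio_approx hA hB hc hM hV' hV hR hε
    filter_upwards [h _ _ hA.measurable hB.measurable (hA.tendsto_meanSquare huA hκ)
      (hB.tendsto_meanSquare huB hκ), eventually_integrable_coord hN hA.measurable huA,
      eventually_integrable_coord hN hB.measurable huB] with n hn i1 i2
    rw [covMatrix_smul_sub _ _ _ i1, covMatrix_smul_sub _ _ _ i2] at hn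
    have hr : √(N n) ^ 2 ≠ 0 := pow_ne_zero 2 (Real.sqrt_pos.2 (hN n)).ne'
    obtain ⟨u, e⟩ := isUnit_det_and_ratio_smul (C := covMatrix (P n) (X n)) hr hn.1
    exact ⟨u, by rw [← e]; exact hn.2⟩
  refine ⟨(key 1 one_pos).mono fun n hn => hn.1, ?_⟩
  refine tendsto_pi_nhds.2 fun i => tendsto_pi_nhds.2 fun j => Metric.tendsto_nhds.2 fun ε hε => ?_
  filter_upwards [key ε hε] with n hn
  simpa [Real.dist_eq] using hn.2 i j

end VarianceRatio

/-! ### Moments of limit laws -/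

/-- Continuous truncation of a real number to `[-K, K]`. -/
def clip (K x : ℝ) : ℝ := max (-K) (min K x)

lemma clip_of_abs_le {K x : ℝ} (h : |x| ≤ K) : clip K x = x := by
  rw [abs_le] at h
  rw [clip, min_eq_right h.2, max_eq_right h.1]

lemma abs_clip_le_abs {K : ℝ} (hK : 0 ≤ K) (x : ℝ) : |clip K x| ≤ |x| := by
  rw [abs_le, clip]
  refine ⟨?_, max_le (by linarith [abs_nonneg x]) ((min_le_right _ _).trans (le_abs_self x))⟩
  rcases le_total K x with h | h
  · rw [min_eq_left h]
    exact (by linarith [abs_nonneg x] : -|x| ≤ K).trans (le_max_right _ _)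
  · rw [min_eq_right h]
    exact (neg_abs_le x).trans (le_max_right _ _)

lemma abs_clip_le {K : ℝ} (hK : 0 ≤ K) (x : ℝ) : |clip K x| ≤ K := by
  rw [abs_le, clip]
  exact ⟨le_max_left _ _, max_le (by linarith) (min_le_left _ _)⟩

lemma continuous_clip (K : ℝ) : Continuous (clip K) := by
  unfold clip; fun_prop

lemma tendsto_clip (x : ℝ) : Tendsto (fun m : ℕ => clip m x) atTop (𝓝 x) := by
  refine tendsto_const_nhds.congr' ?_
  filter_upwards [eventually_ge_atTop ⌈|x|⌉₊] with m hm
  exact (clip_of_abs_le ((Nat.le_ceil _).trans (by exact_mod_cast hm))).symm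

lemma memLp_clip {Ω : Type*} [MeasurableSpace Ω] {μ : Measure Ω} [IsProbabilityMeasure μ]
    {X : Ω → ℝ} (hX : AEMeasurable X μ) {K : ℝ} (hK : 0 ≤ K) :
    MemLp (fun y => clip K (X y)) 2 μ :=
  MemLp.of_bound ((continuous_clip K).measurable.comp_aemeasurable hX).aestronglyMeasurable K
    (ae_of_all _ fun y => abs_clip_le hK (X y))

section LimitLaw

variable {S : ℕ → Type*} [∀ n, MeasurableSpace (S n)] {d : ℕ} {P : ∀ n, Measure (S n)}
  [∀ n, IsProbabilityMeasure (P n)]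
  {U L : ∀ n, S n → EuclideanSpace ℝ (Fin d)} {V : ℕ → Matrix (Fin d) (Fin d) ℝ}

lemma AsympLinear.exists_clip_close (h : AsympLinear P U L V) {η : ℝ} (hη : 0 < η) :
    ∃ K₀ : ℝ, ∀ K ≥ K₀, ∀ᶠ n in atTop, ∀ i j,
      |∫ y, clip K (U n y i) * clip K (U n y j) ∂(P n) - V n i j| ≤ η ∧
      |∫ y, clip K (U n y i) ∂(P n)| ≤ η := by
  obtain ⟨M, hM, hb⟩ := h.uiExcess.exists_bound
  set s := min 1 (η / (2 + M)) with hs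
  have hs0 : 0 < s := lt_min one_pos (by positivity)
  have hs1 : s ≤ 1 := min_le_left _ _
  have hs2 : s * (2 + M) ≤ η := by
    have : s ≤ η / (2 + M) := min_le_right _ _
    rwa [le_div_iff₀ (by positivity)] at this
  have hcoord : ∀ i, ∃ K₀ : ℝ, ∀ K ≥ K₀, ∀ τ : ℝ → ℝ, (∀ u, ‖u‖ ≤ K → τ u = u) →
      (∀ u, ‖τ u‖ ≤ ‖u‖) → (∀ u, ‖τ u‖ ≤ K) → ∀ᶠ n in atTop,
        ∫⁻ y, ENNReal.ofReal (‖τ (U n y i) - L n y i‖ ^ 2) ∂(P n) ≤ ENNReal.ofReal (s ^ 2) := by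
    intro i
    refine exists_trunc_close (fun n => (aemeasurable_coord (h.aemeasurable n) i).norm) ?_ ?_
      (by positivity)
    · refine squeeze_zero (fun _ => norm_nonneg _) (fun x => ?_) h.close
      exact PiLp.norm_apply_le (U x.1 x.2 - L x.1 x.2) i
    · refine h.uiExcess.of_le one_pos (.of_forall fun n y => ?_)
      rw [one_mul]
      exact pow_le_pow_left₀ (norm_nonneg _) (PiLp.norm_apply_le (L n y) i) 2
  choose K₀ hK₀ using hcoord
  refine ⟨∑ i, |K₀ i|, fun K hK => ?_⟩
  have hK0 : 0 ≤ K := (Finset.sum_nonneg fun i _ => abs_nonneg (K₀ i)).trans hK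
  have hKi : ∀ i, K₀ i ≤ K := fun i => (le_abs_self _).trans
    ((Finset.single_le_sum (f := fun i => |K₀ i|) (fun i _ => abs_nonneg _)
      (Finset.mem_univ i)).trans hK)
  have hev : ∀ᶠ n in atTop, ∀ i, ∫⁻ y, ENNReal.ofReal ((clip K (U n y i) - L n y i) ^ 2) ∂(P n) ≤
      ENNReal.ofReal (s ^ 2) := by
    rw [eventually_all]
    intro i
    have := hK₀ i K (hKi i) (clip K) (fun u hu => clip_of_abs_le hu)
      (fun u => abs_clip_le_abs hK0 u) (fun u => abs_clip_le hK0 u)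
    simpa only [Real.norm_eq_abs, sq_abs] using this
  filter_upwards [hev, hb, h.mean, h.second] with n h1 h2 h3 h4 i j
  have hUm := fun i => aemeasurable_coord (h.measurable n).aemeasurable (μ := P n) i
  have hLm := fun i => aemeasurable_coord (h.aemeasurable n) i
  have hc := fun i => memLp_clip (hUm i) hK0
  have hL : ∀ i, MemLp (fun y => L n y i) 2 (P n) := fun i =>
    memLp_two_of_lintegral_sq (hLm i) (lintegral_coord_sq_le h2 i)
  have hd : ∀ i, ∫ y, (clip K (U n y i) - L n y i) ^ 2 ∂(P n) ≤ s ^ 2 := fun i =>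
    integral_sq_le_of_lintegral
      (((continuous_clip K).measurable.comp_aemeasurable (hUm i)).sub (hLm i)) (sq_nonneg s) (h1 i)
  have hLM : ∀ i, ∫ y, L n y i ^ 2 ∂(P n) ≤ M := fun i =>
    integral_sq_le_of_lintegral (hLm i) hM (lintegral_coord_sq_le h2 i)
  constructor
  · have := abs_integral_mul_sub_le (hc i) (hc j) (hL i) (hL j) hs0 (hd i) (hd j) (hLM i) (hLM j)
    rw [h4] at this
    nlinarith
  · have := abs_integral_le_of_sq ((hc i).sub (hL i)) hs0.le (hd i)
    rw [integral_sub' ((hc i).integrable one_le_two) ((hL i).integrable one_le_two), h3,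
      sub_zero] at this
    nlinarith

variable {Ω : Type*} [MeasurableSpace Ω] {ν : Measure Ω} [IsProbabilityMeasure ν]
  {Z : Ω → EuclideanSpace ℝ (Fin d)}

/-- Limit laws of an asymptotically linear sequence have second moments, and these are the limits
of the covariances of the linear parts. -/
lemma AsympLinear.tendsto_covMatrix_limit (h : AsympLinear P U L V) (hZ : Measurable Z)
    (hlim : ∀ f : BoundedContinuousFunction (EuclideanSpace ℝ (Fin d)) ℝ,
      Tendsto (fun n => ∫ y, f (U n y) ∂(P n)) atTop (𝓝 (∫ w, f (Z w) ∂ν))) :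
    (∀ i, MemLp (fun w => Z w i) 2 ν) ∧ Tendsto V atTop (𝓝 (covMatrix ν Z)) := by
  have hZm : ∀ i, Measurable fun w => Z w i := fun i => by
    have : Measurable fun v : EuclideanSpace ℝ (Fin d) => v i := by fun_prop
    exact this.comp hZ
  have hclip : ∀ K : ℝ, 0 ≤ K → ∀ i, Tendsto (fun n => ∫ y, clip K (U n y i) ∂(P n)) atTop
      (𝓝 (∫ w, clip K (Z w i) ∂ν)) := by
    intro K hK i
    let f : BoundedContinuousFunction (EuclideanSpace ℝ (Fin d)) ℝ :=
      BoundedContinuousFunction.ofNormedAddCommGroup (fun v => clip K (v i))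
        ((continuous_clip K).comp (by fun_prop)) K (fun v => abs_clip_le hK _)
    exact hlim f
  have hclip2 : ∀ K : ℝ, 0 ≤ K → ∀ i j, Tendsto
      (fun n => ∫ y, clip K (U n y i) * clip K (U n y j) ∂(P n)) atTop
      (𝓝 (∫ w, clip K (Z w i) * clip K (Z w j) ∂ν)) := by
    intro K hK i j
    let f : BoundedContinuousFunction (EuclideanSpace ℝ (Fin d)) ℝ :=
      BoundedContinuousFunction.ofNormedAddCommGroup (fun v => clip K (v i) * clip K (v j))
        (((continuous_clip K).comp (by fun_prop)).mul ((continuous_clip K).comp (by fun_prop)))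
        (K * K) (fun v => by
          rw [norm_mul]
          exact mul_le_mul (abs_clip_le hK _) (abs_clip_le hK _) (abs_nonneg _) hK)
    exact hlim f
  -- the clipped moments of the limit are, for high levels, close to those of the linear parts
  have hlimit : ∀ η > 0, ∃ K₀ : ℝ, ∀ K ≥ K₀, ∀ i j,
      (∀ᶠ n in atTop, |∫ w, clip K (Z w i) * clip K (Z w j) ∂ν - V n i j| ≤ 2 * η) ∧
      |∫ w, clip K (Z w i) ∂ν| ≤ η := by
    intro η hη
    obtain ⟨K₀, hK₀⟩ := h.exists_clip_close hη
    refine ⟨max K₀ 0, fun K hK i j => ?_⟩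
    have hK0 : 0 ≤ K := (le_max_right _ _).trans hK
    have hev := hK₀ K ((le_max_left _ _).trans hK)
    constructor
    · filter_upwards [hev, (Metric.tendsto_nhds.1 (hclip2 K hK0 i j)) η hη] with n h1 h2
      rw [Real.dist_eq, abs_sub_comm] at h2
      have := abs_sub_le (∫ w, clip K (Z w i) * clip K (Z w j) ∂ν)
        (∫ y, clip K (U n y i) * clip K (U n y j) ∂(P n)) (V n i j)
      linarith [(h1 i j).1]
    · exact le_of_tendsto (hclip K hK0 i).abs (hev.mono fun n hn => (hn i j).2)
  obtain ⟨M, hM, hb⟩ := h.uiExcess.exists_bound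
  have hVM : ∀ᶠ n in atTop, ∀ i, V n i i ≤ M := by
    filter_upwards [hb, h.second] with n h1 h2 i
    rw [← h2]
    simp_rw [← sq]
    exact integral_sq_le_of_lintegral (aemeasurable_coord (h.aemeasurable n) i) hM
      (lintegral_coord_sq_le h1 i)
  -- second moments of the limit by Fatou's lemma as the level increases
  have hZL : ∀ i, MemLp (fun w => Z w i) 2 ν := by
    intro i
    obtain ⟨K₀, hK₀⟩ := hlimit 1 one_pos
    refine memLp_two_of_lintegral_sq (C := M + 2) (hZm i).aemeasurable ?_
    have hpt : ∀ w, ENNReal.ofReal (Z w i ^ 2) ≤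
        liminf (fun m : ℕ => ENNReal.ofReal (clip m (Z w i) ^ 2)) atTop := by
      intro w
      refine (Tendsto.liminf_eq ?_).ge
      exact (ENNReal.continuous_ofReal.tendsto _).comp ((tendsto_clip (Z w i)).pow 2)
    refine (lintegral_mono hpt).trans ((lintegral_liminf_le fun m => ?_).trans ?_)
    · exact (((continuous_clip m).measurable.comp (hZm i)).pow_const 2).ennreal_ofReal
    · refine liminf_le_of_frequently_le' (Eventually.frequently ?_)
      filter_upwards [eventually_ge_atTop ⌈K₀⌉₊] with m hm
      have hmK : K₀ ≤ m := (Nat.le_ceil _).trans (by exact_mod_cast hm)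
      obtain ⟨n, h1, h2⟩ := ((hK₀ m hmK i i).1.and hVM).exists
      rw [← ofReal_integral_eq_lintegral_ofReal
        (memLp_clip (hZm i).aemeasurable (Nat.cast_nonneg m)).integrable_sq
        (ae_of_all _ fun w => sq_nonneg _)]
      refine ENNReal.ofReal_le_ofReal ?_
      simp_rw [sq]
      linarith [(abs_le.1 h1).2, h2 i]
  have hdct2 : ∀ i j, Tendsto (fun m : ℕ => ∫ w, clip m (Z w i) * clip m (Z w j) ∂ν) atTop
      (𝓝 (∫ w, Z w i * Z w j ∂ν)) := by
    intro i j
    refine tendsto_integral_of_dominated_convergence (fun w => |Z w i * Z w j|) (fun m => ?_)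
      ((hZL i).integrable_mul (hZL j)).abs (fun m => ae_of_all _ fun w => ?_)
      (ae_of_all _ fun w => (tendsto_clip _).mul (tendsto_clip _))
    · exact (((continuous_clip m).measurable.comp (hZm i)).mul
        ((continuous_clip m).measurable.comp (hZm j))).aestronglyMeasurable
    · rw [norm_mul, abs_mul]
      exact mul_le_mul (abs_clip_le_abs (Nat.cast_nonneg m) _)
        (abs_clip_le_abs (Nat.cast_nonneg m) _) (abs_nonneg _) (abs_nonneg _)
  have hdct1 : ∀ i, Tendsto (fun m : ℕ => ∫ w, clip m (Z w i) ∂ν) atTop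
      (𝓝 (∫ w, Z w i ∂ν)) := by
    intro i
    refine tendsto_integral_of_dominated_convergence (fun w => |Z w i|) (fun m => ?_)
      ((hZL i).integrable one_le_two).abs (fun m => ae_of_all _ fun w => ?_)
      (ae_of_all _ fun w => tendsto_clip _)
    · exact ((continuous_clip m).measurable.comp (hZm i)).aestronglyMeasurable
    · exact abs_clip_le_abs (Nat.cast_nonneg m) _
  have hmean : ∀ i, ∫ w, Z w i ∂ν = 0 := by
    intro i
    rw [← abs_eq_zero]
    refine le_antisymm (le_of_forall_pos_le_add fun η hη => ?_) (abs_nonneg _)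
    obtain ⟨K₀, hK₀⟩ := hlimit η hη
    rw [zero_add]
    refine le_of_tendsto (hdct1 i).abs ?_
    filter_upwards [eventually_ge_atTop ⌈K₀⌉₊] with m hm
    exact (hK₀ m ((Nat.le_ceil _).trans (by exact_mod_cast hm)) i i).2
  refine ⟨hZL, tendsto_pi_nhds.2 fun i => tendsto_pi_nhds.2 fun j =>
    Metric.tendsto_nhds.2 fun ε hε => ?_⟩
  have hcov : covMatrix ν Z i j = ∫ w, Z w i * Z w j ∂ν := by
    rw [covMatrix, Matrix.of_apply, covariance_eq_sub (hZL i) (hZL j), hmean i]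
    simp
  obtain ⟨K₀, hK₀⟩ := hlimit (ε / 4) (by positivity)
  obtain ⟨m, hm1, hm2⟩ := ((eventually_ge_atTop ⌈K₀⌉₊).and
    ((Metric.tendsto_nhds.1 (hdct2 i j)) (ε / 2) (by positivity))).exists
  filter_upwards [(hK₀ m ((Nat.le_ceil _).trans (by exact_mod_cast hm1)) i j).1] with n hn
  rw [hcov, Real.dist_eq]
  rw [Real.dist_eq] at hm2
  have := abs_sub_le (V n i j) (∫ w, clip m (Z w i) * clip m (Z w j) ∂ν) (∫ w, Z w i * Z w j ∂ν)
  rw [abs_sub_comm] at hn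
  linarith

end LimitLaw

/-! ### Differentiation under the integral sign -/

section Differentiation

variable {S : Type*} [MeasurableSpace S] {μ : Measure S}
  {G : Type*} [NormedAddCommGroup G] [NormedSpace ℝ G]

lemma aestronglyMeasurable_fderiv_apply {F : S → G → ℝ} {ψ : G}
    (hF : ∀ᶠ φ in 𝓝 ψ, AEStronglyMeasurable (fun y => F y φ) μ)
    (hd : ∀ᵐ y ∂μ, DifferentiableAt ℝ (F y) ψ) (v : G) :
    AEStronglyMeasurable (fun y => fderiv ℝ (F y) ψ v) μ := by
  have hc : Tendsto (fun m : ℕ => (m : ℝ)) atTop atTop := tendsto_natCast_atTop_atTop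
  have h1 : Tendsto (fun m : ℕ => ψ + (m : ℝ)⁻¹ • v) atTop (𝓝 ψ) := by
    have := (hc.inv_tendsto_atTop.smul_const v).const_add ψ
    simpa using this
  obtain ⟨m₀, hm₀⟩ := eventually_atTop.1 (h1.eventually hF)
  refine aestronglyMeasurable_of_tendsto_ae atTop (f := fun (m : ℕ) y =>
    ((m + m₀ : ℕ) : ℝ) • (F y (ψ + ((m + m₀ : ℕ) : ℝ)⁻¹ • v) - F y ψ)) (fun m => ?_) ?_
  · exact ((hm₀ (m + m₀) (Nat.le_add_left _ _)).sub hF.self_of_nhds).const_mul _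
  · filter_upwards [hd] with y hy
    have hlim := hy.hasFDerivAt.lim v (tendsto_norm_atTop_atTop.comp hc)
    exact (tendsto_add_atTop_iff_nat m₀).2 hlim

/-- Differentiation under the integral sign along a line, with a dominating function. -/
lemma hasDerivAt_integral_line {F : S → G → ℝ} {ψ : G} {r : ℝ} (hr : 0 < r) {g : S → ℝ}
    (hF : ∀ φ ∈ Metric.ball ψ r, AEStronglyMeasurable (fun y => F y φ) μ)
    (hint : Integrable (fun y => F y ψ) μ) (hg : Integrable g μ)
    (hd : ∀ᵐ y ∂μ, ∀ φ ∈ Metric.ball ψ r, DifferentiableAt ℝ (F y) φ ∧ ‖fderiv ℝ (F y) φ‖ ≤ g y)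
    (v : G) :
    Integrable (fun y => fderiv ℝ (F y) ψ v) μ ∧
      HasDerivAt (fun t : ℝ => ∫ y, F y (ψ + t • v) ∂μ) (∫ y, fderiv ℝ (F y) ψ v ∂μ) 0 := by
  have hline : Continuous fun t : ℝ => ψ + t • v := by fun_prop
  have hs : (fun t : ℝ => ψ + t • v) ⁻¹' Metric.ball ψ r ∈ 𝓝 (0 : ℝ) :=
    hline.continuousAt.preimage_mem_nhds (by simpa using Metric.ball_mem_nhds ψ hr)
  have h := hasDerivAt_integral_of_dominated_loc_of_deriv_le (μ := μ) (𝕜 := ℝ)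
    (F := fun t y => F y (ψ + t • v)) (x₀ := 0) (F' := fun t y => fderiv ℝ (F y) (ψ + t • v) v)
    (bound := fun y => g y * ‖v‖) hs (by filter_upwards [hs] with t ht using hF _ ht)
    (by simpa using hint) ?_ ?_ (hg.mul_const _) ?_
  · simpa using h
  · simp only [zero_smul, add_zero]
    refine aestronglyMeasurable_fderiv_apply
      (by filter_upwards [Metric.ball_mem_nhds ψ hr] with φ hφ using hF φ hφ) ?_ v
    filter_upwards [hd] with y hy using (hy ψ (Metric.mem_ball_self hr)).1
  · filter_upwards [hd] with y hy t ht
    exact (ContinuousLinearMap.le_opNorm _ _).trans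
      (mul_le_mul_of_nonneg_right (hy _ ht).2 (norm_nonneg _))
  · filter_upwards [hd] with y hy t ht
    have h1 : HasDerivAt (fun t : ℝ => ψ + t • v) v t := by
      simpa using ((hasDerivAt_id t).smul_const v).const_add ψ
    exact ((hy _ ht).1.hasFDerivAt).comp_hasDerivAt t h1

end Differentiation

/-! ### Scores and the information identities -/

/-- Local regularity of a single experiment at `ψ₀`: for almost every observation either all
densities vanish or all are positive and the log-likelihood is `C³` near `ψ₀`, and the first two
derivatives of the density are dominated near `ψ₀`. -/
structure LocalReg {S : Type*} [MeasurableSpace S] {d k : ℕ} {Ψ : Set (Param d k)}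
    (E : Experiment S Ψ) (ψ₀ : Param d k) (r : ℝ) (g : S → ℝ) : Prop where
  pos : 0 < r
  ball_subset : Metric.ball ψ₀ r ⊆ Ψ
  smooth : ∀ᵐ y ∂E.ref, ((∀ ψ ∈ Ψ, 0 < E.dens y ψ) ∧
    ContDiffOn ℝ 3 (E.logLik y) (Metric.ball ψ₀ r)) ∨ ∀ ψ ∈ Ψ, E.dens y ψ = 0
  integrable : Integrable g E.ref
  bound : ∀ᵐ y ∂E.ref, ∀ ψ ∈ Metric.ball ψ₀ r, ‖fderiv ℝ (E.dens y) ψ‖ ≤ g y ∧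
      ‖fderiv ℝ (fderiv ℝ (E.dens y)) ψ‖ ≤ g y

section Experiment

variable {S : Type*} [MeasurableSpace S] {d k : ℕ} {Ψ : Set (Param d k)} {E : Experiment S Ψ}

lemma integral_law (ψ : Ψ) (f : S → ℝ) :
    ∫ y, f y ∂(E.law ψ) = ∫ y, E.dens y ψ * f y ∂E.ref := by
  rw [Experiment.law, integral_withDensity_eq_integral_toReal_smul
    (E.measurable_dens ψ).ennreal_ofReal (by simp)]
  simp [E.dens_nonneg]

lemma integrable_law_iff (ψ : Ψ) (f : S → ℝ) :
    Integrable f (E.law ψ) ↔ Integrable (fun y => E.dens y ψ * f y) E.ref := by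
  rw [Experiment.law, integrable_withDensity_iff_integrable_smul'
    (E.measurable_dens ψ).ennreal_ofReal (by simp)]
  simp [E.dens_nonneg]

lemma ae_law_iff (ψ : Ψ) {p : S → Prop} :
    (∀ᵐ y ∂(E.law ψ), p y) ↔ ∀ᵐ y ∂E.ref, 0 < E.dens y ψ → p y := by
  rw [Experiment.law, ae_withDensity_iff (E.measurable_dens ψ).ennreal_ofReal]
  simp

lemma integrable_dens (ψ : Ψ) : Integrable (fun y => E.dens y ψ) E.ref := by
  have := (integrable_law_iff (E := E) ψ fun _ => 1).1 (integrable_const _)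
  simpa using this

lemma integral_dens (ψ : Ψ) : ∫ y, E.dens y ψ ∂E.ref = 1 := by
  have := integral_law (E := E) ψ fun _ => 1
  simpa using this.symm

lemma measurable_logLik (ψ : Param d k) : Measurable fun y => E.logLik y ψ :=
  Real.measurable_log.comp (E.measurable_dens ψ)

variable {ψ₀ : Ψ} {r : ℝ} {g : S → ℝ}

lemma LocalReg.ae_law (h : LocalReg E ψ₀ r g) : ∀ᵐ y ∂(E.law ψ₀),
    (∀ ψ ∈ Ψ, 0 < E.dens y ψ) ∧ ContDiffOn ℝ 3 (E.logLik y) (Metric.ball (ψ₀ : Param d k) r) := by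
  rw [ae_law_iff]
  filter_upwards [h.smooth] with y hy hpos
  rcases hy with hy | hy
  · exact hy
  · exact absurd (hy ψ₀ ψ₀.2) hpos.ne'

lemma contDiffAt_of_ball {G : Type*} [NormedAddCommGroup G] [NormedSpace ℝ G] {f : G → ℝ} {x : G}
    {r : ℝ} (hf : ContDiffOn ℝ 3 f (Metric.ball x r)) {ψ : G} (hψ : ψ ∈ Metric.ball x r) :
    ContDiffAt ℝ 3 f ψ := hf.contDiffAt (Metric.isOpen_ball.mem_nhds hψ)

lemma ContDiffAt.differentiableAt_fderiv_three {G : Type*} [NormedAddCommGroup G]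
    [NormedSpace ℝ G] {f : G → ℝ} {ψ : G} (hf : ContDiffAt ℝ 3 f ψ) :
    DifferentiableAt ℝ (fderiv ℝ f) ψ :=
  (hf.fderiv_right (m := 2) (by norm_num)).differentiableAt (by norm_num)

/-- Almost everywhere the density is `C³` near `ψ₀`, with the usual expressions of its first two
derivatives through those of the log-likelihood. Where the densities vanish both sides are zero. -/
lemma LocalReg.dens_smooth (h : LocalReg E ψ₀ r g) : ∀ᵐ y ∂E.ref,
    ∀ ψ ∈ Metric.ball (ψ₀ : Param d k) r, ContDiffAt ℝ 3 (E.dens y) ψ ∧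
      fderiv ℝ (E.dens y) ψ = E.dens y ψ • fderiv ℝ (E.logLik y) ψ ∧
      ∀ v w, fderiv ℝ (fderiv ℝ (E.dens y)) ψ v w = E.dens y ψ *
        (fderiv ℝ (fderiv ℝ (E.logLik y)) ψ v w +
          fderiv ℝ (E.logLik y) ψ v * fderiv ℝ (E.logLik y) ψ w) := by
  filter_upwards [h.smooth] with y hy
  rcases hy with ⟨hpos, hC⟩ | hzero
  · have hexp : ∀ ψ ∈ Metric.ball (ψ₀ : Param d k) r,
        E.dens y =ᶠ[𝓝 ψ] fun φ => Real.exp (E.logLik y φ) := by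
      intro ψ hψ
      filter_upwards [Metric.isOpen_ball.mem_nhds hψ] with φ hφ
      rw [Experiment.logLik, Real.exp_log (hpos φ (h.ball_subset hφ))]
    have h1 : ∀ ψ ∈ Metric.ball (ψ₀ : Param d k) r,
        fderiv ℝ (E.dens y) ψ = E.dens y ψ • fderiv ℝ (E.logLik y) ψ := by
      intro ψ hψ
      have hd : HasFDerivAt (E.logLik y) (fderiv ℝ (E.logLik y) ψ) ψ :=
        ((contDiffAt_of_ball hC hψ).differentiableAt (by norm_num)).hasFDerivAt
      rw [(hexp ψ hψ).fderiv_eq, hd.exp.fderiv, (hexp ψ hψ).self_of_nhds]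
    intro ψ hψ
    have hCψ := contDiffAt_of_ball hC hψ
    have hdens : ContDiffAt ℝ 3 (E.dens y) ψ := hCψ.exp.congr_of_eventuallyEq (hexp ψ hψ)
    refine ⟨hdens, h1 ψ hψ, fun v w => ?_⟩
    have h2 : fderiv ℝ (E.dens y) =ᶠ[𝓝 ψ] E.dens y • fderiv ℝ (E.logLik y) := by
      filter_upwards [Metric.isOpen_ball.mem_nhds hψ] with φ hφ using h1 φ hφ
    have hp : HasFDerivAt (E.dens y) (fderiv ℝ (E.dens y) ψ) ψ :=
      (hdens.differentiableAt (by norm_num)).hasFDerivAt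
    rw [h2.fderiv_eq, (hp.smul hCψ.differentiableAt_fderiv_three.hasFDerivAt).fderiv, h1 ψ hψ]
    simp
    ring
  · intro ψ hψ
    have hz : E.dens y =ᶠ[𝓝 ψ] fun _ => 0 := by
      filter_upwards [Metric.isOpen_ball.mem_nhds hψ] with φ hφ using hzero φ (h.ball_subset hφ)
    have hz' : fderiv ℝ (E.dens y) =ᶠ[𝓝 ψ] fun _ => 0 := by
      filter_upwards [hz.fderiv (𝕜 := ℝ)] with φ hφ
      rw [hφ]; simp
    refine ⟨contDiffAt_const.congr_of_eventuallyEq hz, ?_, fun v w => ?_⟩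
    · rw [hz'.self_of_nhds, hz.self_of_nhds, zero_smul]
    · rw [hz'.fderiv_eq, hz.self_of_nhds]
      simp

lemma LocalReg.dens_dominated (h : LocalReg E ψ₀ r g) : ∀ᵐ y ∂E.ref,
    ∀ ψ ∈ Metric.ball (ψ₀ : Param d k) r, DifferentiableAt ℝ (E.dens y) ψ ∧
      ‖fderiv ℝ (E.dens y) ψ‖ ≤ g y := by
  filter_upwards [h.dens_smooth, h.bound] with y h1 h2 ψ hψ
  exact ⟨(h1 ψ hψ).1.differentiableAt (by norm_num), (h2 ψ hψ).1⟩

lemma integral_deriv_eq_zero {G : Type*} [NormedAddCommGroup G] [NormedSpace ℝ G] {F : G → ℝ}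
    {ψ v : G} {r c D : ℝ} (hr : 0 < r) (hF : ∀ φ ∈ Metric.ball ψ r, F φ = c)
    (h : HasDerivAt (fun t : ℝ => F (ψ + t • v)) D 0) : D = 0 := by
  have hline : Continuous fun t : ℝ => ψ + t • v := by fun_prop
  have hs : (fun t : ℝ => ψ + t • v) ⁻¹' Metric.ball ψ r ∈ 𝓝 (0 : ℝ) :=
    hline.continuousAt.preimage_mem_nhds (by simpa using Metric.ball_mem_nhds ψ hr)
  have he : (fun t : ℝ => F (ψ + t • v)) =ᶠ[𝓝 0] fun _ => c := by
    filter_upwards [hs] with t ht using hF _ ht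
  exact h.unique ((hasDerivAt_const _ c).congr_of_eventuallyEq he)

lemma LocalReg.integral_fderiv_dens (h : LocalReg E ψ₀ r g) {ψ : Param d k}
    (hψ : ψ ∈ Metric.ball (ψ₀ : Param d k) r) (v : Param d k) :
    Integrable (fun y => fderiv ℝ (E.dens y) ψ v) E.ref ∧
      ∫ y, fderiv ℝ (E.dens y) ψ v ∂E.ref = 0 := by
  have hr' : 0 < r - dist ψ ψ₀ := sub_pos.2 hψ
  have hsub : Metric.ball ψ (r - dist ψ ψ₀) ⊆ Metric.ball (ψ₀ : Param d k) r :=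
    Metric.ball_subset_ball' (by linarith)
  obtain ⟨h1, h2⟩ := hasDerivAt_integral_line hr'
    (fun φ _ => (E.measurable_dens φ).aestronglyMeasurable)
    (integrable_dens ⟨ψ, h.ball_subset hψ⟩) h.integrable
    (by filter_upwards [h.dens_dominated] with y hy φ hφ using hy φ (hsub hφ)) v
  exact ⟨h1, integral_deriv_eq_zero (F := fun φ => ∫ y, E.dens y φ ∂E.ref) hr'
    (fun φ hφ => integral_dens ⟨φ, h.ball_subset (hsub hφ)⟩) h2⟩

lemma LocalReg.integral_fderiv_fderiv_dens (h : LocalReg E ψ₀ r g) (v w : Param d k) :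
    Integrable (fun y => fderiv ℝ (fderiv ℝ (E.dens y)) ψ₀ v w) E.ref ∧
      ∫ y, fderiv ℝ (fderiv ℝ (E.dens y)) ψ₀ v w ∂E.ref = 0 := by
  have hd : ∀ᵐ y ∂E.ref, ∀ φ ∈ Metric.ball (ψ₀ : Param d k) r,
      HasFDerivAt (fun φ => fderiv ℝ (E.dens y) φ w)
        ((ContinuousLinearMap.apply ℝ ℝ w).comp (fderiv ℝ (fderiv ℝ (E.dens y)) φ)) φ := by
    filter_upwards [h.dens_smooth] with y hy φ hφ
    exact (ContinuousLinearMap.apply ℝ ℝ w).hasFDerivAt.comp φ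
      (hy φ hφ).1.differentiableAt_fderiv_three.hasFDerivAt
  obtain ⟨h1, h2⟩ := hasDerivAt_integral_line (μ := E.ref)
    (F := fun y φ => fderiv ℝ (E.dens y) φ w) (g := fun y => ‖w‖ * g y) h.pos
    (fun φ hφ => (h.integral_fderiv_dens hφ w).1.aestronglyMeasurable)
    (h.integral_fderiv_dens (Metric.mem_ball_self h.pos) w).1 (h.integrable.const_mul _)
    (by
      filter_upwards [hd, h.bound] with y hy hb φ hφ
      refine ⟨(hy φ hφ).differentiableAt, ?_⟩
      rw [(hy φ hφ).fderiv]
      refine (ContinuousLinearMap.opNorm_comp_le _ _).trans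
        (mul_le_mul ?_ (hb φ hφ).2 (norm_nonneg _) (norm_nonneg _))
      refine ContinuousLinearMap.opNorm_le_bound _ (norm_nonneg _) fun x => ?_
      rw [mul_comm]
      exact x.le_opNorm w) v
  have he : (fun y => fderiv ℝ (fun φ => fderiv ℝ (E.dens y) φ w) (ψ₀ : Param d k) v) =ᵐ[E.ref]
      fun y => fderiv ℝ (fderiv ℝ (E.dens y)) ψ₀ v w := by
    filter_upwards [hd] with y hy
    rw [(hy ψ₀ (Metric.mem_ball_self h.pos)).fderiv]
    rfl
  refine ⟨h1.congr he, ?_⟩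
  rw [← integral_congr_ae he]
  exact integral_deriv_eq_zero (F := fun φ => ∫ y, fderiv ℝ (E.dens y) φ w ∂E.ref) h.pos
    (fun φ hφ => (h.integral_fderiv_dens hφ w).2) h2

lemma LocalReg.dens_mul_score (h : LocalReg E ψ₀ r g) (a : Fin d ⊕ Fin k) : ∀ᵐ y ∂E.ref,
    fderiv ℝ (E.dens y) ψ₀ (coordVec d k a) = E.dens y ψ₀ * E.score y ψ₀ a := by
  filter_upwards [h.dens_smooth] with y hy
  rw [(hy ψ₀ (Metric.mem_ball_self h.pos)).2.1]
  simp [Experiment.score]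

lemma LocalReg.aestronglyMeasurable_score (h : LocalReg E ψ₀ r g) {ψ : Param d k}
    (hψ : ψ ∈ Metric.ball (ψ₀ : Param d k) r) (a : Fin d ⊕ Fin k) :
    AEStronglyMeasurable (fun y => E.score y ψ a) (E.law ψ₀) := by
  refine aestronglyMeasurable_fderiv_apply
    (.of_forall fun φ => (measurable_logLik φ).aestronglyMeasurable) ?_ _
  filter_upwards [h.ae_law] with y hy
  exact (contDiffAt_of_ball hy.2 hψ).differentiableAt (by norm_num)

/-- The score has mean zero. -/
lemma LocalReg.integral_score (h : LocalReg E ψ₀ r g) (a : Fin d ⊕ Fin k) :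
    ∫ y, E.score y ψ₀ a ∂(E.law ψ₀) = 0 := by
  rw [integral_law, ← integral_congr_ae (h.dens_mul_score a)]
  exact (h.integral_fderiv_dens (Metric.mem_ball_self h.pos) _).2

/-- The information identity: the mean of minus the Hessian is the Fisher information. -/
lemma LocalReg.integral_negHessian (h : LocalReg E ψ₀ r g)
    (hs : ∀ a, MemLp (fun y => E.score y ψ₀ a) 2 (E.law ψ₀)) (a b : Fin d ⊕ Fin k) :
    ∫ y, E.negHessian y ψ₀ a b ∂(E.law ψ₀) = E.fisherInfo ψ₀ a b := by
  have h1 := h.integral_fderiv_fderiv_dens (coordVec d k a) (coordVec d k b)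
  have h2 : Integrable (fun y => E.score y ψ₀ a * E.score y ψ₀ b) (E.law ψ₀) :=
    (hs a).integrable_mul (hs b)
  rw [integrable_law_iff] at h2
  rw [Experiment.fisherInfo, Matrix.of_apply, integral_law, integral_law,
    ← sub_zero (∫ y, E.dens y ψ₀ * (E.score y ψ₀ a * E.score y ψ₀ b) ∂E.ref), ← h1.2,
    ← integral_sub h2 h1.1]
  refine integral_congr_ae ?_
  filter_upwards [h.dens_smooth] with y hy
  rw [(hy ψ₀ (Metric.mem_ball_self h.pos)).2.2]
  simp only [Experiment.negHessian, Matrix.of_apply, Experiment.score]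
  ring

lemma LocalReg.hasDerivAt_integral_mul (h : LocalReg E ψ₀ r g) {u : S → ℝ} (hu : Measurable u)
    {C : ℝ} (hC : ∀ y, |u y| ≤ C) (a : Fin d ⊕ Fin k) :
    HasDerivAt (fun t : ℝ => ∫ y, u y * E.dens y (ψ₀ + t • coordVec d k a) ∂E.ref)
      (∫ y, E.score y ψ₀ a * u y ∂(E.law ψ₀)) 0 := by
  have hd : ∀ᵐ y ∂E.ref, ∀ φ ∈ Metric.ball (ψ₀ : Param d k) r,
      HasFDerivAt (fun φ => u y * E.dens y φ) (u y • fderiv ℝ (E.dens y) φ) φ := by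
    filter_upwards [h.dens_smooth] with y hy φ hφ
    exact ((hy φ hφ).1.differentiableAt (by norm_num)).hasFDerivAt.const_mul (u y)
  have h1 := (hasDerivAt_integral_line (μ := E.ref) (F := fun y φ => u y * E.dens y φ)
    (g := fun y => C * g y) h.pos
    (fun φ _ => (hu.mul (E.measurable_dens φ)).aestronglyMeasurable)
    ((integrable_dens ψ₀).bdd_mul hu.aestronglyMeasurable (ae_of_all _ hC))
    (h.integrable.const_mul _)
    (by
      filter_upwards [hd, h.bound] with y hy hb φ hφ
      refine ⟨(hy φ hφ).differentiableAt, ?_⟩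
      rw [(hy φ hφ).fderiv, norm_smul]
      exact mul_le_mul (hC y) (hb φ hφ).1 (norm_nonneg _) ((abs_nonneg _).trans (hC y)))
    (coordVec d k a)).2
  convert h1 using 1
  rw [integral_law]
  refine integral_congr_ae ?_
  filter_upwards [hd, h.dens_mul_score a] with y hy hs
  rw [(hy ψ₀ (Metric.mem_ball_self h.pos)).fderiv]
  simp only [smul_apply, smul_eq_mul, hs]
  ring

variable {Z : Type*} [MeasurableSpace Z] {E' : Experiment Z Ψ} {T : S → Z} {r' : ℝ} {g' : Z → ℝ}

/-- Expectations of a bounded statistic `u` of the reduced data are the same in both experiments;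
differentiating them at `ψ₀` gives the expectations of `u` times the scores. -/
lemma integral_score_mul_bounded (h : LocalReg E ψ₀ r g) (h' : LocalReg E' ψ₀ r' g')
    (hT : Measurable T) (hlaw : ∀ ψ : Ψ, E'.law ψ = (E.law ψ).map T) {u : Z → ℝ}
    (hu : Measurable u) {C : ℝ} (hC : ∀ z, |u z| ≤ C) (a : Fin d ⊕ Fin k) :
    ∫ y, E.score y ψ₀ a * u (T y) ∂(E.law ψ₀) = ∫ z, E'.score z ψ₀ a * u z ∂(E'.law ψ₀) := by
  have h1 := h.hasDerivAt_integral_mul (hu.comp hT) (fun y => hC (T y)) a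
  have h2 := h'.hasDerivAt_integral_mul hu hC a
  refine h1.unique (h2.congr_of_eventuallyEq ?_)
  have hline : Continuous fun t : ℝ => (ψ₀ : Param d k) + t • coordVec d k a := by fun_prop
  have hs : (fun t : ℝ => (ψ₀ : Param d k) + t • coordVec d k a) ⁻¹'
      Metric.ball (ψ₀ : Param d k) r ∈ 𝓝 (0 : ℝ) :=
    hline.continuousAt.preimage_mem_nhds (by simpa using Metric.ball_mem_nhds _ h.pos)
  filter_upwards [hs] with t ht
  set ψ : Ψ := ⟨ψ₀ + t • coordVec d k a, h.ball_subset ht⟩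
  have e1 := integral_law (E := E) ψ (u ∘ T)
  have e2 := integral_law (E := E') ψ u
  rw [hlaw, integral_map hT.aemeasurable hu.aestronglyMeasurable] at e2
  simp only [Function.comp_apply, mul_comm (u _)]
  rw [← e2]
  exact e1.symm

/-- The score of the reduced data is the conditional expectation of the score of the full data, in
the form needed: their cross moments are the Fisher information of the reduced data. -/
lemma integral_score_mul_score (h : LocalReg E ψ₀ r g) (h' : LocalReg E' ψ₀ r' g')
    (hT : Measurable T) (hlaw : ∀ ψ : Ψ, E'.law ψ = (E.law ψ).map T)
    (hs : ∀ a, MemLp (fun y => E.score y ψ₀ a) 2 (E.law ψ₀))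
    (hs' : ∀ a, MemLp (fun z => E'.score z ψ₀ a) 2 (E'.law ψ₀)) (a b : Fin d ⊕ Fin k) :
    ∫ y, E.score y ψ₀ a * E'.score (T y) ψ₀ b ∂(E.law ψ₀) = E'.fisherInfo ψ₀ a b := by
  have hm := (hs' b).aestronglyMeasurable
  set u := hm.mk with hu
  have hum : Measurable u := hm.stronglyMeasurable_mk.measurable
  have hae : (fun z => E'.score z ψ₀ b) =ᵐ[E'.law ψ₀] u := hm.ae_eq_mk
  have haeT : (fun y => E'.score (T y) ψ₀ b) =ᵐ[E.law ψ₀] fun y => u (T y) := by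
    have := hae
    rw [hlaw] at this
    exact ae_of_ae_map hT.aemeasurable this
  have hu2 : MemLp u 2 (E'.law ψ₀) := (hs' b).ae_eq hae
  have huT : MemLp (fun y => u (T y)) 2 (E.law ψ₀) := by
    rw [hlaw] at hu2
    exact hu2.comp_of_map hT.aemeasurable
  -- a score is not bounded, so it is clipped at a level tending to infinity
  have hclip := fun m : ℕ => integral_score_mul_bounded h h' hT hlaw
    (u := fun z => clip m (u z)) ((continuous_clip m).measurable.comp hum)
    (fun z => abs_clip_le (Nat.cast_nonneg m) _) a
  have l1 : Tendsto (fun m : ℕ => ∫ y, E.score y ψ₀ a * clip m (u (T y)) ∂(E.law ψ₀)) atTop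
      (𝓝 (∫ y, E.score y ψ₀ a * u (T y) ∂(E.law ψ₀))) := by
    refine tendsto_integral_of_dominated_convergence (fun y => |E.score y ψ₀ a * u (T y)|)
      (fun m => ?_) ((hs a).integrable_mul huT).abs (fun m => ae_of_all _ fun y => ?_)
      (ae_of_all _ fun y => (tendsto_clip _).const_mul _)
    · exact (hs a).aestronglyMeasurable.mul
        ((continuous_clip m).measurable.comp (hum.comp hT)).aestronglyMeasurable
    · rw [norm_mul, abs_mul]
      exact mul_le_mul_of_nonneg_left (abs_clip_le_abs (Nat.cast_nonneg m) _) (abs_nonneg _)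
  have l2 : Tendsto (fun m : ℕ => ∫ z, E'.score z ψ₀ a * clip m (u z) ∂(E'.law ψ₀)) atTop
      (𝓝 (∫ z, E'.score z ψ₀ a * u z ∂(E'.law ψ₀))) := by
    refine tendsto_integral_of_dominated_convergence (fun z => |E'.score z ψ₀ a * u z|)
      (fun m => ?_) ((hs' a).integrable_mul hu2).abs (fun m => ae_of_all _ fun z => ?_)
      (ae_of_all _ fun z => (tendsto_clip _).const_mul _)
    · exact (hs' a).aestronglyMeasurable.mul
        ((continuous_clip m).measurable.comp hum).aestronglyMeasurable
    · rw [norm_mul, abs_mul]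
      exact mul_le_mul_of_nonneg_left (abs_clip_le_abs (Nat.cast_nonneg m) _) (abs_nonneg _)
  simp_rw [hclip] at l1
  have e := tendsto_nhds_unique l1 l2
  rw [Experiment.fisherInfo, Matrix.of_apply]
  calc _ = ∫ y, E.score y ψ₀ a * u (T y) ∂(E.law ψ₀) :=
        integral_congr_ae (haeT.mono fun y hy => by simp only [hy])
    _ = ∫ z, E'.score z ψ₀ a * u z ∂(E'.law ψ₀) := e
    _ = _ := integral_congr_ae (hae.mono fun z hz => by simp only [← hz])

end Experiment

/-! ### Coordinates and line integrals of the Hessian -/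

section Coordinates

variable {d k : ℕ}

/-- Coordinates of a full parameter, the index set being that of `coordVec`. -/
noncomputable def coords (ψ : Param d k) : Fin d ⊕ Fin k → ℝ := Sum.elim ψ.1 ψ.2

lemma sum_coords_smul (ψ : Param d k) : ∑ a, coords ψ a • coordVec d k a = ψ := by
  rw [Fintype.sum_sum_type]
  refine Prod.ext ?_ ?_
  · ext i
    simp [coords, coordVec, Prod.fst_sum, Finset.sum_apply, Pi.single_apply]
  · ext i
    simp [coords, coordVec, Prod.snd_sum, Finset.sum_apply, Pi.single_apply]

lemma norm_coordVec_le (a : Fin d ⊕ Fin k) : ‖coordVec d k a‖ ≤ 1 := by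
  rcases a with i | j <;> simp [coordVec, Prod.norm_def]

/-- Minus the Hessian matrix of a function of the full parameter. -/
noncomputable def negHess (f : Param d k → ℝ) (ψ : Param d k) :
    Matrix (Fin d ⊕ Fin k) (Fin d ⊕ Fin k) ℝ :=
  Matrix.of fun a b => -(fderiv ℝ (fderiv ℝ f) ψ (coordVec d k a) (coordVec d k b))

lemma bilin_eq_sum (H : Param d k →L[ℝ] Param d k →L[ℝ] ℝ) (v w : Param d k) :
    H v w = ∑ a, coords v a * H (coordVec d k a) w := by
  conv_lhs => rw [← sum_coords_smul v]
  simp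

lemma lin_eq_sum (l : Param d k →L[ℝ] ℝ) (w : Param d k) :
    l w = ∑ b, coords w b * l (coordVec d k b) := by
  conv_lhs => rw [← sum_coords_smul w]
  simp

lemma fderiv_fderiv_eq_neg (f : Param d k → ℝ) (ψ v w : Param d k) :
    fderiv ℝ (fderiv ℝ f) ψ v w = -(coords v ⬝ᵥ (negHess f ψ).mulVec (coords w)) := by
  rw [bilin_eq_sum, dotProduct, ← Finset.sum_neg_distrib]
  refine Finset.sum_congr rfl fun a _ => ?_
  rw [lin_eq_sum, Matrix.mulVec, dotProduct, ← mul_neg, ← Finset.sum_neg_distrib]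
  congr 1
  refine Finset.sum_congr rfl fun b _ => ?_
  simp only [negHess, Matrix.of_apply]
  ring

lemma coords_eq_zero_iff {v : Param d k} : coords v = 0 ↔ v = 0 := by
  constructor
  · intro h
    rw [← sum_coords_smul v, h]
    simp
  · rintro rfl
    funext a
    rcases a with i | j <;> rfl

end Coordinates

section MeanValue

variable {G : Type*} [NormedAddCommGroup G] [NormedSpace ℝ G]

lemma norm_image_sub_le_of_norm_iteratedFDeriv_one {W : Type*} [NormedAddCommGroup W]
    [NormedSpace ℝ W] {h : G → W} {ψ₀ ψ : G} {r B : ℝ}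
    (hd : ∀ φ ∈ Metric.ball ψ₀ r, DifferentiableAt ℝ h φ)
    (hB : ∀ φ ∈ Metric.ball ψ₀ r, ‖iteratedFDeriv ℝ 1 h φ‖ ≤ B)
    (hψ : ψ ∈ Metric.ball ψ₀ r) : ‖h ψ - h ψ₀‖ ≤ B * ‖ψ - ψ₀‖ := by
  refine (convex_ball ψ₀ r).norm_image_sub_le_of_norm_fderiv_le (𝕜 := ℝ) hd
    (fun φ hφ => ?_) (Metric.mem_ball_self (dist_nonneg.trans_lt hψ)) hψ
  have := hB φ hφ
  rwa [← norm_iteratedFDeriv_fderiv, norm_iteratedFDeriv_zero] at this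

/-- A bound on third derivatives is a Lipschitz bound on the Hessian. -/
lemma norm_fderiv_fderiv_sub_le {f : G → ℝ} {ψ₀ ψ : G} {r B : ℝ}
    (hf : ContDiffOn ℝ 3 f (Metric.ball ψ₀ r))
    (hB : ∀ φ ∈ Metric.ball ψ₀ r, ‖iteratedFDeriv ℝ 3 f φ‖ ≤ B)
    (hψ : ψ ∈ Metric.ball ψ₀ r) :
    ‖fderiv ℝ (fderiv ℝ f) ψ - fderiv ℝ (fderiv ℝ f) ψ₀‖ ≤ B * ‖ψ - ψ₀‖ := by
  refine norm_image_sub_le_of_norm_iteratedFDeriv_one (W := G →L[ℝ] G →L[ℝ] ℝ)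
    (h := fderiv ℝ (fderiv ℝ f)) (fun φ hφ => ?_) (fun φ hφ => ?_) hψ
  · have h1 := contDiffAt_of_ball hf hφ
    exact ((h1.fderiv_right (m := 2) (by norm_num)).fderiv_right (m := 1)
      (by norm_num)).differentiableAt (by norm_num)
  · rw [norm_iteratedFDeriv_fderiv (𝕜 := ℝ), norm_iteratedFDeriv_fderiv (𝕜 := ℝ)]
    exact hB φ hφ

lemma exists_fderiv_apply_sub_eq {f : G → ℝ} {ψ₀ ψ₁ ψ₂ : G} {r : ℝ}
    (hf : ContDiffOn ℝ 3 f (Metric.ball ψ₀ r)) (h₁ : ψ₁ ∈ Metric.ball ψ₀ r)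
    (h₂ : ψ₂ ∈ Metric.ball ψ₀ r) (w : G) :
    ∃ z ∈ Metric.ball ψ₀ r, fderiv ℝ f ψ₂ w - fderiv ℝ f ψ₁ w =
      fderiv ℝ (fderiv ℝ f) z (ψ₂ - ψ₁) w := by
  obtain ⟨z, hz, he⟩ := domain_mvt (f := fun φ => fderiv ℝ f φ w)
    (f' := fun φ => (ContinuousLinearMap.apply ℝ ℝ w).comp (fderiv ℝ (fderiv ℝ f) φ))
    (fun φ hφ => ((ContinuousLinearMap.apply ℝ ℝ w).hasFDerivAt.comp φ
      (contDiffAt_of_ball hf hφ).differentiableAt_fderiv_three.hasFDerivAt).hasFDerivWithinAt)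
    (convex_ball ψ₀ r) h₁ h₂
  exact ⟨z, (convex_ball ψ₀ r).segment_subset h₁ h₂ hz, he⟩

/-- A critical point along a segment is a maximum along it if the Hessian is nonpositive. -/
lemma le_of_fderiv_eq_zero_of_nonpos {f : G → ℝ} {ψ₀ ψ₁ ψ₂ : G} {r : ℝ}
    (hf : ContDiffOn ℝ 3 f (Metric.ball ψ₀ r))
    (hH : ∀ ψ ∈ Metric.ball ψ₀ r, ∀ w, fderiv ℝ (fderiv ℝ f) ψ w w ≤ 0)
    (h₁ : ψ₁ ∈ Metric.ball ψ₀ r) (h₂ : ψ₂ ∈ Metric.ball ψ₀ r)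
    (hcrit : fderiv ℝ f ψ₁ (ψ₂ - ψ₁) = 0) : f ψ₂ ≤ f ψ₁ := by
  obtain ⟨z, hz, he⟩ := domain_mvt (f := f) (f' := fun φ => fderiv ℝ f φ)
    (fun φ hφ => ((contDiffAt_of_ball hf hφ).differentiableAt
      (by norm_num)).hasFDerivAt.hasFDerivWithinAt) (convex_ball ψ₀ r) h₁ h₂
  obtain ⟨z', hz', he'⟩ := exists_fderiv_apply_sub_eq hf h₁
    ((convex_ball ψ₀ r).segment_subset h₁ h₂ hz) (ψ₂ - ψ₁)
  rw [segment_eq_image'] at hz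
  obtain ⟨t, ht, rfl⟩ := hz
  rw [add_sub_cancel_left, map_smul, smul_apply, smul_eq_mul, hcrit, sub_zero] at he'
  have := mul_nonpos_of_nonneg_of_nonpos ht.1 (hH z' hz' (ψ₂ - ψ₁))
  simp only at he
  linarith

end MeanValue

/-! ### The Hessian of the profile likelihood -/

section Profile

variable {E F : Type*} [NormedAddCommGroup E] [NormedSpace ℝ E] [CompleteSpace E]
  [NormedAddCommGroup F] [NormedSpace ℝ F] [FiniteDimensional ℝ F]

lemma isInvertible_of_injective_dual (l : F →L[ℝ] (F →L[ℝ] ℝ)) (hl : Function.Injective l) :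
    l.IsInvertible := by
  have hfin : Module.finrank ℝ F = Module.finrank ℝ (F →L[ℝ] ℝ) := by
    rw [← (LinearMap.toContinuousLinearMap (𝕜 := ℝ) (E := F) (F' := ℝ)).finrank_eq]
    exact (Subspace.dual_finrank_eq (K := ℝ) (V := F)).symm
  let e := (LinearMap.linearEquivOfInjective (l : F →ₗ[ℝ] (F →L[ℝ] ℝ)) hl
    hfin).toContinuousLinearEquiv
  exact ⟨e, by ext; rfl⟩

/-- Near a critical point `ψ` at which `f` is strictly concave, and outside of a neighbourhood of
which `f` is smaller than `f ψ` by a margin, the profile of `f` is `f` along the curve of critical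
points in the second variable given by the implicit function theorem. Hence, with `G` the
derivative of that curve, the Hessian of the profile in direction `u` is the full Hessian in
direction `(u, G u)`, which is orthogonal to the second factor. -/
lemma exists_profile_hessian {f : E × F → ℝ} {Ψ : Set (E × F)} {ψ₀ ψ : E × F} {ρ m : ℝ}
    (hΨ : Metric.ball ψ₀ ρ ⊆ Ψ) (hf : ContDiffOn ℝ 3 f (Metric.ball ψ₀ ρ))
    (hH : ∀ φ ∈ Metric.ball ψ₀ ρ, ∀ w, w ≠ 0 → fderiv ℝ (fderiv ℝ f) φ w w < 0)
    (hψ : ψ ∈ Metric.ball ψ₀ ρ) (hcrit : fderiv ℝ f ψ = 0) (hm : m < f ψ)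
    (hout : ∀ φ ∈ Ψ, φ ∉ Metric.ball ψ₀ ρ → f φ ≤ m) :
    ∃ G : E →L[ℝ] F, ∀ u : E, (∀ v : F, fderiv ℝ (fderiv ℝ f) ψ (u, G u) (0, v) = 0) ∧
      ∀ w : E, fderiv ℝ (fderiv ℝ fun θ => sSup ((fun ξ => f (θ, ξ)) '' {ξ | (θ, ξ) ∈ Ψ})) ψ.1 u w =
        fderiv ℝ (fderiv ℝ f) ψ (u, G u) (w, 0) := by
  have : CompleteSpace F := FiniteDimensional.complete ℝ F
  have hfψ := contDiffAt_of_ball hf hψ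
  set Λ₂ : ((E × F) →L[ℝ] ℝ) →L[ℝ] (F →L[ℝ] ℝ) :=
    (ContinuousLinearMap.compL ℝ F (E × F) ℝ).flip (ContinuousLinearMap.inr ℝ E F) with hΛ₂
  set Λ₁ : ((E × F) →L[ℝ] ℝ) →L[ℝ] (E →L[ℝ] ℝ) :=
    (ContinuousLinearMap.compL ℝ E (E × F) ℝ).flip (ContinuousLinearMap.inl ℝ E F) with hΛ₁
  have hΛ₂a : ∀ (l : (E × F) →L[ℝ] ℝ) v, Λ₂ l v = l (0, v) := fun l v => rfl
  have hΛ₁a : ∀ (l : (E × F) →L[ℝ] ℝ) v, Λ₁ l v = l (v, 0) := fun l v => rfl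
  have hD : HasFDerivAt (fderiv ℝ f) (fderiv ℝ (fderiv ℝ f) ψ) ψ :=
    hfψ.differentiableAt_fderiv_three.hasFDerivAt
  have hqC : ContDiffAt ℝ 2 (fun φ => Λ₂ (fderiv ℝ f φ)) ψ :=
    Λ₂.contDiff.contDiffAt.comp ψ (hfψ.fderiv_right (m := 2) (by norm_num))
  have hq : HasFDerivAt (fun φ => Λ₂ (fderiv ℝ f φ)) (Λ₂.comp (fderiv ℝ (fderiv ℝ f) ψ)) ψ :=
    Λ₂.hasFDerivAt.comp ψ hD
  have hinv : (fderiv ℝ (fun φ => Λ₂ (fderiv ℝ f φ)) ψ ∘L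
      ContinuousLinearMap.inr ℝ E F).IsInvertible := by
    refine isInvertible_of_injective_dual _ ((injective_iff_map_eq_zero _).2 fun v hv => ?_)
    rw [hq.fderiv] at hv
    by_contra hv0
    have h1 : fderiv ℝ (fderiv ℝ f) ψ (0, v) (0, v) = 0 := by
      have := congrArg (fun l => l v) hv
      simpa [hΛ₂a] using this
    exact (hH ψ hψ (0, v) (by simpa using hv0)).ne h1
  set s := hqC.implicitFunction two_ne_zero hinv with hs
  have hs0 : s ψ.1 = ψ.2 := hqC.implicitFunction_apply_self two_ne_zero hinv
  have hsC : ContDiffAt ℝ 2 s ψ.1 := hqC.contDiffAt_implicitFunction two_ne_zero hinv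
  have hsq : ∀ᶠ θ in 𝓝 ψ.1, Λ₂ (fderiv ℝ f (θ, s θ)) = 0 := by
    filter_upwards [hqC.eventually_apply_implicitFunction two_ne_zero hinv] with θ hθ
    rw [hcrit, map_zero] at hθ
    exact hθ
  have hcurve : ContinuousAt (fun θ => (θ, s θ)) ψ.1 := continuousAt_id.prodMk hsC.continuousAt
  have hcurve0 : (ψ.1, s ψ.1) = ψ := by rw [hs0]
  have hball : ∀ᶠ θ in 𝓝 ψ.1, (θ, s θ) ∈ Metric.ball ψ₀ ρ :=
    hcurve.eventually_mem (Metric.isOpen_ball.mem_nhds (by rw [hcurve0]; exact hψ))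
  have hval : ∀ᶠ θ in 𝓝 ψ.1, m < f (θ, s θ) := by
    have hc : ContinuousAt (fun θ => f (θ, s θ)) ψ.1 :=
      ContinuousAt.comp (f := fun θ => (θ, s θ)) (by rw [hcurve0]; exact hfψ.continuousAt) hcurve
    exact hc.eventually_const_lt (show m < f (ψ.1, s ψ.1) by rw [hcurve0]; exact hm)
  have hsd : ∀ᶠ θ in 𝓝 ψ.1, DifferentiableAt ℝ s θ := by
    filter_upwards [hsC.eventually (by simp)] with θ hθ
    exact hθ.differentiableAt (by norm_num)
  -- along the curve the profile is attained
  have hprof : (fun θ => sSup ((fun ξ => f (θ, ξ)) '' {ξ | (θ, ξ) ∈ Ψ})) =ᶠ[𝓝 ψ.1]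
      fun θ => f (θ, s θ) := by
    filter_upwards [hsq, hball, hval] with θ h1 h2 h3
    refine IsGreatest.csSup_eq ⟨⟨s θ, hΨ h2, rfl⟩, ?_⟩
    rintro _ ⟨ξ, hξ, rfl⟩
    by_cases hin : (θ, ξ) ∈ Metric.ball ψ₀ ρ
    · refine le_of_fderiv_eq_zero_of_nonpos hf (fun φ hφ w => ?_) h2 hin ?_
      · rcases eq_or_ne w 0 with rfl | hw
        · simp
        · exact (hH φ hφ w hw).le
      · have := congrArg (fun l => l (ξ - s θ)) h1
        simpa [hΛ₂a] using this
    · exact (hout _ hξ hin).trans h3.le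
  -- the envelope theorem
  have hfirst : fderiv ℝ (fun θ => sSup ((fun ξ => f (θ, ξ)) '' {ξ | (θ, ξ) ∈ Ψ})) =ᶠ[𝓝 ψ.1]
      fun θ => Λ₁ (fderiv ℝ f (θ, s θ)) := by
    filter_upwards [hprof.eventuallyEq_nhds, hsq, hball, hsd] with θ h1 h2 h3 h4
    rw [h1.fderiv_eq]
    have h5 : HasFDerivAt f (fderiv ℝ f (θ, s θ)) (θ, s θ) :=
      ((contDiffAt_of_ball hf h3).differentiableAt (by norm_num)).hasFDerivAt
    have h6 : HasFDerivAt (fun θ => (θ, s θ))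
        ((ContinuousLinearMap.id ℝ E).prod (fderiv ℝ s θ)) θ :=
      (hasFDerivAt_id θ).prodMk h4.hasFDerivAt
    have h7 : HasFDerivAt (fun θ => f (θ, s θ)) _ θ :=
      HasFDerivAt.comp (f := fun θ => (θ, s θ)) θ h5 h6
    rw [h7.fderiv]
    ext u
    have e : ((u, fderiv ℝ s θ u) : E × F) = (u, 0) + (0, fderiv ℝ s θ u) := by simp
    have h8 := congrArg (fun l => l (fderiv ℝ s θ u)) h2
    simp only [hΛ₂a, zero_apply] at h8
    simp only [ContinuousLinearMap.comp_apply, ContinuousLinearMap.prod_apply,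
      ContinuousLinearMap.id_apply, hΛ₁a]
    rw [e, map_add, h8, add_zero]
  have hpath : HasFDerivAt (fun θ => fderiv ℝ f (θ, s θ))
      ((fderiv ℝ (fderiv ℝ f) ψ).comp ((ContinuousLinearMap.id ℝ E).prod (fderiv ℝ s ψ.1))) ψ.1 :=
    HasFDerivAt.comp (f := fun θ => (θ, s θ)) ψ.1 (by rw [hcurve0]; exact hD)
      ((hasFDerivAt_id _).prodMk hsd.self_of_nhds.hasFDerivAt)
  refine ⟨fderiv ℝ s ψ.1, fun u => ⟨fun v => ?_, fun w => ?_⟩⟩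
  · have h1 := Λ₂.hasFDerivAt.comp ψ.1 hpath
    have h2 : (fun θ => Λ₂ (fderiv ℝ f (θ, s θ))) =ᶠ[𝓝 ψ.1] fun _ => 0 := hsq
    have h3 := h1.unique ((hasFDerivAt_const (0 : F →L[ℝ] ℝ) ψ.1).congr_of_eventuallyEq h2)
    have h4 := congrArg (fun l => l u v) h3
    simpa [hΛ₂a] using h4
  · rw [hfirst.fderiv_eq]
    have h1 : HasFDerivAt (fun θ => Λ₁ (fderiv ℝ f (θ, s θ))) _ ψ.1 := Λ₁.hasFDerivAt.comp ψ.1 hpath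
    rw [h1.fderiv]
    rfl

end Profile

section ProfileMatrix

variable {d k : ℕ}

/-- The inverse of the profile information is the block, belonging to the parameter of interest,
of the inverse of the full information. -/
lemma isUnit_and_inv_profile {f : Param d k → ℝ} {Ψ : Set (Param d k)} {ψ₀ ψ : Param d k}
    {ρ m : ℝ} (hΨ : Metric.ball ψ₀ ρ ⊆ Ψ) (hf : ContDiffOn ℝ 3 f (Metric.ball ψ₀ ρ))
    (hH : ∀ φ ∈ Metric.ball ψ₀ ρ, ∃ c > 0, Coercive c (negHess f φ))
    (hψ : ψ ∈ Metric.ball ψ₀ ρ) (hcrit : fderiv ℝ f ψ = 0) (hm : m < f ψ)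
    (hout : ∀ φ ∈ Ψ, φ ∉ Metric.ball ψ₀ ρ → f φ ≤ m) (I : Matrix (Fin d) (Fin d) ℝ)
    (hI : ∀ i j, I i j = -(fderiv ℝ (fderiv ℝ fun θ => sSup ((fun ξ => f (θ, ξ)) ''
      {ξ | (θ, ξ) ∈ Ψ})) ψ.1 (EuclideanSpace.single i 1) (EuclideanSpace.single j 1))) :
    IsUnit I.det ∧ I⁻¹ = (negHess f ψ)⁻¹.toBlocks₁₁ := by
  have hneg : ∀ φ ∈ Metric.ball ψ₀ ρ, ∀ w, w ≠ 0 → fderiv ℝ (fderiv ℝ f) φ w w < 0 := by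
    intro φ hφ w hw
    obtain ⟨c, hc, hcoer⟩ := hH φ hφ
    have h1 := hcoer (coords w)
    have h2 : 0 < coords w ⬝ᵥ coords w := by
      refine lt_of_le_of_ne (dotProduct_self_nonneg_real _) fun h => hw ?_
      exact coords_eq_zero_iff.1 (dotProduct_self_eq_zero.1 h.symm)
    rw [fderiv_fderiv_eq_neg]
    nlinarith
  obtain ⟨G, hG⟩ := exists_profile_hessian hΨ hf hneg hψ hcrit hm hout
  obtain ⟨c, hc, hcoer⟩ := hH ψ hψ
  set A := negHess f ψ with hA
  set C : Matrix (Fin d) (Fin d ⊕ Fin k) ℝ := Matrix.of fun i =>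
    coords (EuclideanSpace.single i 1, G (EuclideanSpace.single i 1)) with hC
  have hrow : ∀ i b, (C * A) i b = -(fderiv ℝ (fderiv ℝ f) ψ
      (EuclideanSpace.single i 1, G (EuclideanSpace.single i 1)) (coordVec d k b)) := by
    intro i b
    rw [bilin_eq_sum, Matrix.mul_apply, ← Finset.sum_neg_distrib]
    refine Finset.sum_congr rfl fun a _ => ?_
    simp [hC, hA, negHess]
  have hl : ∀ i j, (C * A) i (Sum.inl j) = I i j := by
    intro i j
    rw [hrow, hI, (hG _).2]
    rfl
  have hr : ∀ i j, (C * A) i (Sum.inr j) = 0 := by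
    intro i j
    rw [hrow]
    exact neg_eq_zero.2 ((hG _).1 _)
  -- `C A = (I, 0)`, and the first block of the columns of `C` is the identity matrix
  have hone : I * A⁻¹.toBlocks₁₁ = 1 := by
    have h1 : C = C * A * A⁻¹ := by
      rw [Matrix.mul_assoc, Matrix.mul_nonsing_inv _ (hcoer.isUnit_det hc), Matrix.mul_one]
    ext i j
    have h2 : C i (Sum.inl j) = (C * A * A⁻¹) i (Sum.inl j) := congrFun (congrFun h1 i) _
    rw [Matrix.mul_apply, Fintype.sum_sum_type] at h2
    simp only [hl, hr, zero_mul, Finset.sum_const_zero, add_zero] at h2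
    rw [Matrix.mul_apply]
    simp only [Matrix.toBlocks₁₁, Matrix.of_apply]
    rw [← h2, Matrix.one_apply]
    simp [hC, coords, Pi.single_apply, eq_comm]
  exact ⟨Matrix.isUnit_det_of_right_inverse hone, Matrix.inv_eq_right_inv hone⟩

end ProfileMatrix

/-! ### Maximum likelihood estimates on the event of a good Hessian -/

section Deterministic

variable {d k : ℕ} {f : Param d k → ℝ} {ψ₀ ψ : Param d k} {ρ N κ c : ℝ}
  {A : Matrix (Fin d ⊕ Fin k) (Fin d ⊕ Fin k) ℝ}

lemma inv_smul_apply {ι : Type*} [Fintype ι] [DecidableEq ι] {H : Matrix ι ι ℝ} {N : ℝ}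
    (hN : N ≠ 0) (hH : IsUnit H.det) (a b : ι) : (N⁻¹ • H)⁻¹ a b = N * H⁻¹ a b := by
  have : (N⁻¹ • H)⁻¹ = N • H⁻¹ := by
    refine Matrix.inv_eq_left_inv ?_
    rw [Matrix.smul_mul, Matrix.mul_smul, smul_smul, mul_inv_cancel₀ hN,
      Matrix.nonsing_inv_mul _ hH, one_smul]
  rw [this, Matrix.smul_apply, smul_eq_mul]

lemma coercive_of_close {ι : Type*} [Fintype ι] {A H : Matrix ι ι ℝ} {N κ c : ℝ} (hN : 0 < N)
    (hA : Coercive c A) (hκ0 : 0 ≤ κ) (hκ : Fintype.card ι * κ ≤ c / 2)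
    (h : ∀ a b, |H a b - N * A a b| ≤ κ * N) :
    Coercive (c / 2) (N⁻¹ • H) ∧ (∀ a b, |(N⁻¹ • H) a b - A a b| ≤ κ) := by
  have h1 : ∀ a b, |(N⁻¹ • H) a b - A a b| ≤ κ := by
    intro a b
    have e : (N⁻¹ • H) a b - A a b = (H a b - N * A a b) / N := by
      rw [Matrix.smul_apply, smul_eq_mul]; field_simp
    rw [e, abs_div, abs_of_pos hN, div_le_iff₀ hN]
    exact h a b
  exact ⟨(hA.perturb h1 hκ0).mono (by linarith), h1⟩

lemma coercive_of_smul {ι : Type*} [Fintype ι] {H : Matrix ι ι ℝ} {N c : ℝ} (hN : 0 < N)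
    (h : Coercive c (N⁻¹ • H)) : Coercive (N * c) H := by
  intro v
  have h1 := h v
  rw [Matrix.smul_mulVec, dotProduct_smul, smul_eq_mul, inv_mul_eq_div, le_div_iff₀ hN] at h1
  linarith

/-- Expansion of a critical point: by the mean value theorem in each coordinate, the score at `ψ₀`
is the Hessian times the error, up to a relative error `κ`. -/
lemma sub_inv_mulVec_le (hN : 0 < N) (hf : ContDiffOn ℝ 3 f (Metric.ball ψ₀ ρ))
    (hc : 0 < c) (hA : Coercive c A) (hsymm : A.IsSymm) (hκ0 : 0 ≤ κ)
    (hκ : (Fintype.card (Fin d ⊕ Fin k) : ℝ) * κ ≤ c / 2)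
    (hclose : ∀ φ ∈ Metric.ball ψ₀ ρ, ∀ a b, |negHess f φ a b - N * A a b| ≤ κ * N)
    (hψ : ψ ∈ Metric.ball ψ₀ ρ) (hcrit : fderiv ℝ f ψ = 0)
    {s : Fin d ⊕ Fin k → ℝ} (hs : ∀ a, s a = (√N)⁻¹ * fderiv ℝ f ψ₀ (coordVec d k a)) {Q : ℝ}
    (hQ : s ⬝ᵥ s ≤ Q ^ 2) :
    (√N • coords (ψ - ψ₀) - A⁻¹.mulVec s) ⬝ᵥ (√N • coords (ψ - ψ₀) - A⁻¹.mulVec s) ≤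
      (2 * Fintype.card (Fin d ⊕ Fin k) * κ * Q / c ^ 2) ^ 2 := by
  set p : ℝ := (Fintype.card (Fin d ⊕ Fin k) : ℝ) with hp
  have hp0 : 0 ≤ p := Nat.cast_nonneg _
  have hρ : 0 < ρ := dist_nonneg.trans_lt hψ
  have hsN : 0 < √N := Real.sqrt_pos.2 hN
  set δ := coords (ψ - ψ₀) with hδ
  set u := √N • δ with hu
  set e := s - A.mulVec u with he
  have hNN : √N * √N = N := Real.mul_self_sqrt hN.le
  have hea : ∀ a, |e a| ≤ κ * ∑ b, |u b| := by
    intro a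
    obtain ⟨z, hz, hzeq⟩ := exists_fderiv_apply_sub_eq hf (Metric.mem_ball_self hρ) hψ
      (coordVec d k a)
    rw [hcrit, bilin_eq_sum, zero_apply, zero_sub] at hzeq
    have h1 : fderiv ℝ f ψ₀ (coordVec d k a) = ∑ b, δ b * negHess f z b a := by
      rw [← neg_inj, hzeq, ← Finset.sum_neg_distrib]
      refine Finset.sum_congr rfl fun b _ => ?_
      simp only [negHess, Matrix.of_apply, hδ]
      ring
    have h2 : e a = ∑ b, (√N)⁻¹ * δ b * (negHess f z b a - N * A b a) := by
      rw [he, Pi.sub_apply, hs, h1, Matrix.mulVec, dotProduct, Finset.mul_sum,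
        ← Finset.sum_sub_distrib]
      refine Finset.sum_congr rfl fun b _ => ?_
      rw [hsymm.apply b a, hu, Pi.smul_apply, smul_eq_mul]
      have : (√N)⁻¹ * N = √N := by rw [inv_mul_eq_div, div_eq_iff hsN.ne', hNN]
      linear_combination (δ b * A b a) * this
    rw [h2, Finset.mul_sum]
    refine (Finset.abs_sum_le_sum_abs _ _).trans (Finset.sum_le_sum fun b _ => ?_)
    rw [abs_mul, abs_mul, hu, Pi.smul_apply, smul_eq_mul, abs_mul, abs_of_pos hsN,
      abs_of_pos (inv_pos.2 hsN)]
    calc (√N)⁻¹ * |δ b| * |negHess f z b a - N * A b a| ≤ (√N)⁻¹ * |δ b| * (κ * N) := by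
          gcongr
          exact hclose z hz b a
      _ = κ * (√N * |δ b|) := by
          nth_rw 2 [← hNN]; field_simp
  have hee : e ⬝ᵥ e ≤ (p * κ) ^ 2 * (u ⬝ᵥ u) := by
    have h1 : e ⬝ᵥ e ≤ ∑ _a : Fin d ⊕ Fin k, κ ^ 2 * (p * (u ⬝ᵥ u)) := by
      refine Finset.sum_le_sum fun a _ => ?_
      rw [← sq, ← sq_abs]
      refine (pow_le_pow_left₀ (abs_nonneg _) (hea a) 2).trans ?_
      rw [mul_pow]
      exact mul_le_mul_of_nonneg_left (sum_abs_sq_le u) (sq_nonneg _)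
    refine h1.trans (le_of_eq ?_)
    rw [Finset.sum_const, Finset.card_univ, nsmul_eq_mul, ← hp]
    ring
  have hdecomp : u - A⁻¹.mulVec s = -A⁻¹.mulVec e := by
    rw [he, Matrix.mulVec_sub, Matrix.mulVec_mulVec, Matrix.nonsing_inv_mul _ (hA.isUnit_det hc),
      Matrix.one_mulVec]
    abel
  have hs1 := hA.inv_mulVec_le hc s
  have he1 := hA.inv_mulVec_le hc e
  have hu1 : u ⬝ᵥ u ≤ 2 * (A⁻¹.mulVec s ⬝ᵥ A⁻¹.mulVec s) + 2 * (A⁻¹.mulVec e ⬝ᵥ A⁻¹.mulVec e) := by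
    have h1 : u = A⁻¹.mulVec s - A⁻¹.mulVec e := by
      rw [sub_eq_iff_eq_add] at hdecomp
      rw [hdecomp]; abel
    rw [h1, dotProduct, dotProduct, dotProduct, Finset.mul_sum, Finset.mul_sum,
      ← Finset.sum_add_distrib]
    refine Finset.sum_le_sum fun a _ => ?_
    rw [Pi.sub_apply]
    nlinarith [sq_nonneg (A⁻¹.mulVec s a + A⁻¹.mulVec e a)]
  have huu := dotProduct_self_nonneg_real u
  have hpκ : (p * κ) ^ 2 ≤ c ^ 2 / 4 := by
    have := pow_le_pow_left₀ (mul_nonneg hp0 hκ0) hκ 2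
    linarith
  have hu2 : c ^ 2 * (u ⬝ᵥ u) ≤ 4 * Q ^ 2 := by nlinarith
  rw [hdecomp, neg_dotProduct_neg]
  have h3 : c ^ 2 * (c ^ 2 * (A⁻¹.mulVec e ⬝ᵥ A⁻¹.mulVec e)) ≤ (p * κ) ^ 2 * (4 * Q ^ 2) := by
    calc _ ≤ c ^ 2 * ((p * κ) ^ 2 * (u ⬝ᵥ u)) :=
          mul_le_mul_of_nonneg_left (he1.trans hee) (sq_nonneg c)
      _ = (p * κ) ^ 2 * (c ^ 2 * (u ⬝ᵥ u)) := by ring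
      _ ≤ _ := mul_le_mul_of_nonneg_left hu2 (sq_nonneg _)
  rw [div_pow, le_div_iff₀ (by positivity)]
  nlinarith

lemma abs_inv_negHess_le (hN : 0 < N) (hc : 0 < c) (hA : Coercive c A) (hκ0 : 0 ≤ κ)
    (hκ : (Fintype.card (Fin d ⊕ Fin k) : ℝ) * κ ≤ c / 2)
    (hclose : ∀ a b, |negHess f ψ a b - N * A a b| ≤ κ * N) (a b : Fin d ⊕ Fin k) :
    |N * (negHess f ψ)⁻¹ a b - A⁻¹ a b| ≤
      (Fintype.card (Fin d ⊕ Fin k) : ℝ) ^ 2 * κ / (c * (c / 2)) := by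
  obtain ⟨h1, h2⟩ := coercive_of_close hN hA hκ0 hκ hclose
  have hc2 : 0 < c / 2 := by positivity
  have h3 := Coercive.abs_inv_sub_inv_le hc hc2 hA h1 h2 a b
  rwa [Matrix.sub_apply, inv_smul_apply hN.ne'
    ((coercive_of_smul hN h1).isUnit_det (by positivity))] at h3

end Deterministic

/-! ### The linear statistic and its moments -/

section LinStat

variable {S : Type*} [MeasurableSpace S] {d k : ℕ} {Ψ : Set (Param d k)}

/-- The Fisher information per unit of information size. -/
noncomputable def scaledInfo (E : Experiment S Ψ) (N : ℝ) (ψ : Ψ) :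
    Matrix (Fin d ⊕ Fin k) (Fin d ⊕ Fin k) ℝ := N⁻¹ • E.fisherInfo ψ

/-- The asymptotic covariance matrix of the maximum likelihood estimator of the parameter of
interest: the corresponding block of the inverse information. -/
noncomputable def asympVar (E : Experiment S Ψ) (N : ℝ) (ψ : Ψ) : Matrix (Fin d) (Fin d) ℝ :=
  (scaledInfo E N ψ)⁻¹.toBlocks₁₁

/-- The linear statistic approximating the scaled error of the estimator: the component along the
parameter of interest of the inverse information times the score. -/
noncomputable def linStat (E : Experiment S Ψ) (N : ℝ) (ψ : Ψ) (y : S) :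
    EuclideanSpace ℝ (Fin d) :=
  WithLp.toLp 2 fun i =>
    (scaledInfo E N ψ)⁻¹.mulVec (fun a => (√N)⁻¹ * E.score y ψ a) (Sum.inl i)

variable {E : Experiment S Ψ} {N : ℝ} {ψ₀ : Ψ} {r : ℝ} {g : S → ℝ}

lemma linStat_apply (y : S) (i : Fin d) : linStat E N ψ₀ y i =
    ∑ a, (scaledInfo E N ψ₀)⁻¹ (Sum.inl i) a * ((√N)⁻¹ * E.score y ψ₀ a) := rfl

lemma scaledInfo_isSymm : (scaledInfo E N ψ₀).IsSymm := by
  ext a b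
  simp [scaledInfo, Experiment.fisherInfo, mul_comm]

lemma asympVar_isSymm : (asympVar E N ψ₀).IsSymm := by
  have h : ((scaledInfo E N ψ₀)⁻¹).IsSymm := by
    rw [Matrix.IsSymm, Matrix.transpose_nonsing_inv, scaledInfo_isSymm]
  ext i j
  exact h.apply (Sum.inl i) (Sum.inl j)

lemma LocalReg.aemeasurable_linStat (h : LocalReg E ψ₀ r g) :
    AEMeasurable (linStat E N ψ₀) (E.law ψ₀) := by
  have h1 : AEMeasurable (fun y i => ∑ a, (scaledInfo E N ψ₀)⁻¹ (Sum.inl i) a *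
      ((√N)⁻¹ * E.score y ψ₀ a)) (E.law ψ₀) := by
    refine aemeasurable_pi_lambda _ fun i => Finset.aemeasurable_fun_sum _ fun a _ => ?_
    exact (((h.aestronglyMeasurable_score (Metric.mem_ball_self h.pos) a).aemeasurable).const_mul
      _).const_mul _
  exact (WithLp.measurable_toLp 2 (Fin d → ℝ)).comp_aemeasurable h1

lemma LocalReg.integral_linStat (h : LocalReg E ψ₀ r g)
    (hs : ∀ a, MemLp (fun y => E.score y ψ₀ a) 2 (E.law ψ₀)) (i : Fin d) :
    ∫ y, linStat E N ψ₀ y i ∂(E.law ψ₀) = 0 := by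
  simp_rw [linStat_apply]
  rw [integral_finsetSum _ fun a _ =>
    (((hs a).integrable one_le_two).const_mul _).const_mul _]
  refine Finset.sum_eq_zero fun a _ => ?_
  rw [integral_const_mul, integral_const_mul, h.integral_score]
  simp

variable {Z : Type*} [MeasurableSpace Z] {E' : Experiment Z Ψ} {T : S → Z} {r' : ℝ} {g' : Z → ℝ}

/-- The covariance of the linear statistics of full and reduced data is the variance of that of
the full data. -/
lemma integral_linStat_mul_linStat (h : LocalReg E ψ₀ r g) (h' : LocalReg E' ψ₀ r' g')
    (hT : Measurable T) (hlaw : ∀ ψ : Ψ, E'.law ψ = (E.law ψ).map T)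
    (hs : ∀ a, MemLp (fun y => E.score y ψ₀ a) 2 (E.law ψ₀))
    (hs' : ∀ a, MemLp (fun z => E'.score z ψ₀ a) 2 (E'.law ψ₀)) (hN : 0 < N)
    (hdet : IsUnit (scaledInfo E' N ψ₀).det) (i j : Fin d) :
    ∫ y, linStat E N ψ₀ y i * linStat E' N ψ₀ (T y) j ∂(E.law ψ₀) = asympVar E N ψ₀ i j := by
  set A := scaledInfo E N ψ₀ with hA
  set B := scaledInfo E' N ψ₀ with hB
  have hsT : ∀ a, MemLp (fun y => E'.score (T y) ψ₀ a) 2 (E.law ψ₀) := fun a => by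
    have := hs' a
    rw [hlaw] at this
    exact this.comp_of_map hT.aemeasurable
  have hint : ∀ a b, Integrable (fun y => E.score y ψ₀ a * E'.score (T y) ψ₀ b) (E.law ψ₀) :=
    fun a b => (hs a).integrable_mul (hsT b)
  have hNN : (√N)⁻¹ * (√N)⁻¹ = N⁻¹ := by rw [← mul_inv, Real.mul_self_sqrt hN.le]
  have e : ∀ y, linStat E N ψ₀ y i * linStat E' N ψ₀ (T y) j = ∑ a, ∑ b,
      A⁻¹ (Sum.inl i) a * B⁻¹ (Sum.inl j) b * N⁻¹ * (E.score y ψ₀ a * E'.score (T y) ψ₀ b) := by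
    intro y
    rw [linStat_apply, linStat_apply, Finset.sum_mul_sum]
    refine Finset.sum_congr rfl fun a _ => Finset.sum_congr rfl fun b _ => ?_
    rw [← hNN]; ring
  simp_rw [e]
  rw [integral_finsetSum _ fun a _ => integrable_finsetSum _ fun b _ => (hint a b).const_mul _]
  have e2 : ∀ a, ∫ y, ∑ b, A⁻¹ (Sum.inl i) a * B⁻¹ (Sum.inl j) b * N⁻¹ *
      (E.score y ψ₀ a * E'.score (T y) ψ₀ b) ∂(E.law ψ₀) =
      A⁻¹ (Sum.inl i) a * (B * B⁻¹) a (Sum.inl j) := by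
    intro a
    rw [integral_finsetSum _ fun b _ => (hint a b).const_mul _, Matrix.mul_apply, Finset.mul_sum]
    refine Finset.sum_congr rfl fun b _ => ?_
    have hBs : B⁻¹ (Sum.inl j) b = B⁻¹ b (Sum.inl j) := by
      have : (B⁻¹).IsSymm := by
        rw [Matrix.IsSymm, Matrix.transpose_nonsing_inv, hB, scaledInfo_isSymm]
      exact this.apply _ _
    rw [integral_const_mul, integral_score_mul_score h h' hT hlaw hs hs', hBs, hB]
    simp only [scaledInfo, Matrix.smul_apply, smul_eq_mul]
    ring
  simp_rw [e2]
  rw [Matrix.mul_nonsing_inv _ hdet]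
  simp [Matrix.one_apply, asympVar, Matrix.toBlocks₁₁, hA]

lemma norm_linStat_sq_le {c : ℝ} (hc : 0 < c) (hA : Coercive c (scaledInfo E N ψ₀)) (hN : 0 < N)
    (y : S) : ‖linStat E N ψ₀ y‖ ^ 2 ≤ (c ^ 2)⁻¹ * ((∑ a, E.score y ψ₀ a ^ 2) / N) := by
  have h1 := hA.inv_mulVec_le hc (fun a => (√N)⁻¹ * E.score y ψ₀ a)
  set w := (scaledInfo E N ψ₀)⁻¹.mulVec (fun a => (√N)⁻¹ * E.score y ψ₀ a) with hw
  have h2 : ‖linStat E N ψ₀ y‖ ^ 2 ≤ w ⬝ᵥ w := by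
    rw [EuclideanSpace.real_norm_sq_eq, dotProduct, Fintype.sum_sum_type]
    have : 0 ≤ ∑ x : Fin k, w (Sum.inr x) * w (Sum.inr x) :=
      Finset.sum_nonneg fun x _ => mul_self_nonneg _
    have e : ∑ i, linStat E N ψ₀ y i ^ 2 = ∑ x : Fin d, w (Sum.inl x) * w (Sum.inl x) :=
      Finset.sum_congr rfl fun i _ => sq _
    linarith
  have h3 : (fun a => (√N)⁻¹ * E.score y ψ₀ a) ⬝ᵥ (fun a => (√N)⁻¹ * E.score y ψ₀ a) =
      (∑ a, E.score y ψ₀ a ^ 2) / N := by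
    have hNN : (√N)⁻¹ * (√N)⁻¹ = N⁻¹ := by rw [← mul_inv, Real.mul_self_sqrt hN.le]
    rw [dotProduct, Finset.sum_div]
    refine Finset.sum_congr rfl fun a _ => ?_
    rw [div_eq_mul_inv, ← hNN]; ring
  rw [h3] at h1
  rw [inv_mul_eq_div, le_div_iff₀ (by positivity)]
  nlinarith [sq_nonneg c]

end LinStat

/-! ### Consequences of the regularity conditions -/

section Regular

variable {S : ℕ → Type*} [∀ n, MeasurableSpace (S n)] {d D : ℕ} {k : ℕ → ℕ}
  {Ψ : ∀ n, Set (Param d (k n))} {N : ℕ → ℝ} {E : ∀ n, Experiment (S n) (Ψ n)} {ψ₀ : ∀ n, Ψ n}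

lemma Multiphase.Regular.exists_localReg (h : Regular N E ψ₀) (n : ℕ) :
    ∃ r g, LocalReg (E n) (ψ₀ n) r g := by
  obtain ⟨r, hr, C, hC⟩ := h.third_derivative
  obtain ⟨hball, B, -, -, hB⟩ := hC n
  obtain ⟨U, hU, g, hg, hbound⟩ := h.dominated n
  obtain ⟨r', hr', hrU⟩ := Metric.mem_nhds_iff.1 hU
  have hsub : Metric.ball (ψ₀ n : Param d (k n)) (min r r') ⊆ Metric.ball (ψ₀ n) r :=
    Metric.ball_subset_ball (min_le_left _ _)
  refine ⟨min r r', g, lt_min hr hr', hsub.trans hball, ?_, hg, ?_⟩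
  · rw [ae_law_iff] at hB
    filter_upwards [h.common_support n, hB] with y h1 h2
    by_cases hpos : 0 < (E n).dens y (ψ₀ n)
    · exact Or.inl ⟨fun ψ hψ => h1 _ (ψ₀ n).2 ψ hψ hpos, (h2 hpos).1.mono hsub⟩
    · refine Or.inr fun ψ hψ => le_antisymm (not_lt.1 fun h3 => hpos ?_) ((E n).dens_nonneg _ _)
      exact h1 ψ hψ _ (ψ₀ n).2 h3
  · filter_upwards [hbound] with y hy ψ hψ
    exact hy ψ (hrU (Metric.ball_subset_ball (min_le_right _ _) hψ))

lemma Multiphase.Regular.aemeasurable_score (h : Regular N E ψ₀) (n : ℕ)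
    (a : Fin d ⊕ Fin (k n)) :
    AEMeasurable (fun y => (E n).score y (ψ₀ n) a) ((E n).law (ψ₀ n)) := by
  obtain ⟨r, g, hL⟩ := h.exists_localReg n
  exact (hL.aestronglyMeasurable_score (Metric.mem_ball_self hL.pos) a).aemeasurable

lemma Multiphase.Regular.aemeasurable_sum_score_sq (h : Regular N E ψ₀) (n : ℕ) :
    AEMeasurable (fun y => (∑ a, (E n).score y (ψ₀ n) a ^ 2) / N n) ((E n).law (ψ₀ n)) :=
  (Finset.aemeasurable_fun_sum _ fun a _ => (h.aemeasurable_score n a).pow_const 2).div_const _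

lemma Multiphase.Regular.memLp_score (h : Regular N E ψ₀) (hN : ∀ n, 0 < N n) (n : ℕ)
    (a : Fin d ⊕ Fin (k n)) : MemLp (fun y => (E n).score y (ψ₀ n) a) 2 ((E n).law (ψ₀ n)) := by
  obtain ⟨K, hK⟩ := h.score_unifInt.excess one_pos
  have h1 := lintegral_le_of_excess zero_le_one (hK n)
  refine memLp_two_of_lintegral_sq (h.aemeasurable_score n a) (C := N n * (|K| + 1)) ?_
  calc ∫⁻ y, ENNReal.ofReal ((E n).score y (ψ₀ n) a ^ 2) ∂((E n).law (ψ₀ n))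
      ≤ ∫⁻ y, ENNReal.ofReal (N n) * ENNReal.ofReal ((∑ a, (E n).score y (ψ₀ n) a ^ 2) / N n)
          ∂((E n).law (ψ₀ n)) := by
        refine lintegral_mono fun y => ?_
        rw [← ENNReal.ofReal_mul (hN n).le, mul_div_cancel₀ _ (hN n).ne']
        exact ENNReal.ofReal_le_ofReal (Finset.single_le_sum
          (f := fun a => (E n).score y (ψ₀ n) a ^ 2) (fun a _ => sq_nonneg _) (Finset.mem_univ a))
    _ = ENNReal.ofReal (N n) * _ := lintegral_const_mul' _ _ ENNReal.ofReal_ne_top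
    _ ≤ ENNReal.ofReal (N n) * ENNReal.ofReal (|K| + 1) := by gcongr
    _ = _ := (ENNReal.ofReal_mul (hN n).le).symm

lemma Multiphase.Regular.exists_coercive (h : Regular N E ψ₀) (hN : ∀ n, 0 < N n) :
    ∃ c > 0, ∀ᶠ n in atTop, Coercive c (scaledInfo (E n) (N n) (ψ₀ n)) := by
  obtain ⟨c, hc, hev⟩ := h.full_rank
  refine ⟨c, hc, hev.mono fun n hn v => ?_⟩
  rw [scaledInfo, Matrix.smul_mulVec, dotProduct_smul, smul_eq_mul, inv_mul_eq_div,
    le_div_iff₀ (hN n)]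
  linarith [hn v]

lemma Multiphase.Regular.exists_bound (h : Regular N E ψ₀) (hN : ∀ n, 0 < N n) :
    ∃ M, 0 ≤ M ∧ ∀ᶠ n in atTop, ∀ a b, |scaledInfo (E n) (N n) (ψ₀ n) a b| ≤ M := by
  obtain ⟨M, hM, hb⟩ := h.score_unifInt.uiExcess.exists_bound
  refine ⟨M, hM, hb.mono fun n hn a b => ?_⟩
  have hsq : ∀ a, ∫ y, (E n).score y (ψ₀ n) a ^ 2 ∂((E n).law (ψ₀ n)) ≤ N n * M := by
    intro a
    refine integral_sq_le_of_lintegral (h.aemeasurable_score n a) (mul_nonneg (hN n).le hM) ?_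
    calc ∫⁻ y, ENNReal.ofReal ((E n).score y (ψ₀ n) a ^ 2) ∂((E n).law (ψ₀ n))
        ≤ ∫⁻ y, ENNReal.ofReal (N n) * ENNReal.ofReal ((∑ a, (E n).score y (ψ₀ n) a ^ 2) / N n)
            ∂((E n).law (ψ₀ n)) := by
          refine lintegral_mono fun y => ?_
          rw [← ENNReal.ofReal_mul (hN n).le, mul_div_cancel₀ _ (hN n).ne']
          exact ENNReal.ofReal_le_ofReal (Finset.single_le_sum
            (f := fun a => (E n).score y (ψ₀ n) a ^ 2) (fun a _ => sq_nonneg _)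
            (Finset.mem_univ a))
      _ = ENNReal.ofReal (N n) * _ := lintegral_const_mul' _ _ ENNReal.ofReal_ne_top
      _ ≤ ENNReal.ofReal (N n) * ENNReal.ofReal M := by gcongr
      _ = _ := (ENNReal.ofReal_mul (hN n).le).symm
  have hab : |(E n).fisherInfo (ψ₀ n) a b| ≤ N n * M := by
    rw [Experiment.fisherInfo, Matrix.of_apply]
    have ia := (h.memLp_score hN n a).integrable_sq
    have ib := (h.memLp_score hN n b).integrable_sq
    have iab : Integrable (fun y => (E n).score y (ψ₀ n) a * (E n).score y (ψ₀ n) b)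
      ((E n).law (ψ₀ n)) := (h.memLp_score hN n a).integrable_mul (h.memLp_score hN n b)
    have h2 : ∫ y, |(E n).score y (ψ₀ n) a * (E n).score y (ψ₀ n) b| ∂((E n).law (ψ₀ n)) ≤
        ∫ y, ((E n).score y (ψ₀ n) a ^ 2 + (E n).score y (ψ₀ n) b ^ 2) / 2
          ∂((E n).law (ψ₀ n)) := by
      refine integral_mono iab.abs ((ia.add ib).div_const 2) fun y => ?_
      show |(E n).score y (ψ₀ n) a * (E n).score y (ψ₀ n) b| ≤
        ((E n).score y (ψ₀ n) a ^ 2 + (E n).score y (ψ₀ n) b ^ 2) / 2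
      rw [abs_mul, ← sq_abs ((E n).score y (ψ₀ n) a), ← sq_abs ((E n).score y (ψ₀ n) b)]
      nlinarith [sq_nonneg (|(E n).score y (ψ₀ n) a| - |(E n).score y (ψ₀ n) b|)]
    rw [integral_div, integral_add ia ib] at h2
    refine abs_integral_le_integral_abs.trans (h2.trans ?_)
    linarith [hsq a, hsq b]
  rw [scaledInfo, Matrix.smul_apply, smul_eq_mul, abs_mul, abs_of_pos (inv_pos.2 (hN n)),
    inv_mul_eq_div, div_le_iff₀ (hN n), mul_comm]
  exact hab

lemma card_le_cast {m : ℕ} (hm : m ≤ D) :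
    (Fintype.card (Fin d ⊕ Fin m) : ℝ) ≤ (d + D : ℕ) := by
  have : Fintype.card (Fin d ⊕ Fin m) ≤ d + D := by simpa using hm
  exact_mod_cast this

lemma Multiphase.Regular.asympVar_bounds (h : Regular N E ψ₀) (hN : ∀ n, 0 < N n)
    (hk : ∀ n, k n ≤ D) : ∃ c > 0, ∃ M, 0 ≤ M ∧
      ∀ᶠ n in atTop, Coercive c (asympVar (E n) (N n) (ψ₀ n)) ∧
        ∀ i j, |asympVar (E n) (N n) (ψ₀ n) i j| ≤ M := by
  obtain ⟨c, hc, h1⟩ := h.exists_coercive hN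
  obtain ⟨M, hM, h2⟩ := h.exists_bound hN
  refine ⟨c / (((d + D : ℕ) * M) ^ 2 + 1), by positivity, 1 / c, by positivity, ?_⟩
  filter_upwards [h1, h2] with n hn1 hn2
  refine ⟨Coercive.toBlocks₁₁ ((hn1.inv hc hn2).mono ?_), fun i j => hn1.abs_inv_le hc _ _⟩
  have := card_le_cast (d := d) (hk n)
  gcongr

/-- The variable that controls third derivatives is bounded in probability together with the
score. -/
lemma Multiphase.Regular.exists_tight (h : Regular N E ψ₀) (hN : ∀ n, 0 < N n) :
    ∃ r > 0, (∀ n, Metric.ball (ψ₀ n : Param d (k n)) r ⊆ Ψ n) ∧ ∃ B : ∀ n, S n → ℝ,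
      (∀ n, ∀ᵐ y ∂((E n).law (ψ₀ n)), 0 ≤ B n y ∧
        ContDiffOn ℝ 3 ((E n).logLik y) (Metric.ball (ψ₀ n : Param d (k n)) r) ∧
        ∀ ψ ∈ Metric.ball (ψ₀ n : Param d (k n)) r,
          ‖iteratedFDeriv ℝ 3 ((E n).logLik y) ψ‖ ≤ B n y) ∧
      Tight (fun n => (E n).law (ψ₀ n))
        (fun n y => B n y / N n + (∑ a, (E n).score y (ψ₀ n) a ^ 2) / N n) := by
  obtain ⟨r, hr, C, hC⟩ := h.third_derivative
  choose hball B hBint hBC hB using hC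
  have hB0 : ∀ n, ∀ᵐ y ∂((E n).law (ψ₀ n)), 0 ≤ B n y := fun n => by
    filter_upwards [hB n] with y hy
    exact (norm_nonneg _).trans (hy.2 _ (Metric.mem_ball_self hr))
  refine ⟨r, hr, hball, B, fun n => (hB0 n).and (hB n), ?_⟩
  obtain ⟨M, hM, hb⟩ := h.score_unifInt.uiExcess.exists_bound
  refine tight_of_lintegral_le (C := |C| + M) (fun n =>
    ((hBint n).aestronglyMeasurable.aemeasurable.div_const _).add
      (h.aemeasurable_sum_score_sq n)) (hb.mono fun n hn => ?_)
  have h1 : ∫⁻ y, ENNReal.ofReal (B n y / N n) ∂((E n).law (ψ₀ n)) ≤ ENNReal.ofReal |C| := by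
    rw [← ofReal_integral_eq_lintegral_ofReal ((hBint n).div_const _)
      (by filter_upwards [hB0 n] with y hy using div_nonneg hy (hN n).le), integral_div]
    refine ENNReal.ofReal_le_ofReal ?_
    rw [div_le_iff₀ (hN n)]
    exact (hBC n).trans (mul_le_mul_of_nonneg_right (le_abs_self C) (hN n).le)
  calc _ ≤ ∫⁻ y, (ENNReal.ofReal (B n y / N n) +
        ENNReal.ofReal ((∑ a, (E n).score y (ψ₀ n) a ^ 2) / N n)) ∂((E n).law (ψ₀ n)) :=
        lintegral_mono fun y => ENNReal.ofReal_add_le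
    _ = _ := lintegral_add_left' ((hBint n).aestronglyMeasurable.aemeasurable.div_const
        _).ennreal_ofReal _
    _ ≤ ENNReal.ofReal |C| + ENNReal.ofReal M := add_le_add h1 hn
    _ = _ := (ENNReal.ofReal_add (abs_nonneg _) hM).symm

lemma norm_sub_linStat_sq_le {T : Type*} [MeasurableSpace T] {m : ℕ} {Θ : Set (Param d m)}
    (e : Experiment T Θ) (ν : ℝ) (φ₀ : Θ) (φ : Param d m) (y : T)
    (w : Fin d ⊕ Fin m → ℝ)
    (hw : w = √ν • coords (φ - (φ₀ : Param d m)) -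
      (scaledInfo e ν φ₀)⁻¹.mulVec (fun a => (√ν)⁻¹ * e.score y φ₀ a)) :
    ‖√ν • (φ.1 - (φ₀ : Param d m).1) - linStat e ν φ₀ y‖ ^ 2 ≤ w ⬝ᵥ w := by
  rw [EuclideanSpace.real_norm_sq_eq, dotProduct, Fintype.sum_sum_type]
  have h0 : 0 ≤ ∑ x : Fin m, w (Sum.inr x) * w (Sum.inr x) :=
    Finset.sum_nonneg fun x _ => mul_self_nonneg _
  have h1 : ∑ i, (√ν • (φ.1 - (φ₀ : Param d m).1) - linStat e ν φ₀ y) i ^ 2 =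
      ∑ x : Fin d, w (Sum.inl x) * w (Sum.inl x) := by
    refine Finset.sum_congr rfl fun i _ => ?_
    rw [hw, sq]
    rfl
  linarith

lemma exists_precision {c ε p Q : ℝ} (hc : 0 < c) (hε : 0 < ε) (hp0 : 0 ≤ p) (hQ0 : 0 < Q) :
    ∃ κ > 0, p * κ ≤ c / 2 ∧ 2 * p * κ * Q / c ^ 2 ≤ ε ∧ p ^ 2 * κ / (c * (c / 2)) ≤ ε := by
  have e1 : 0 < c / (2 * (p + 1)) := by positivity
  have e2 : 0 < ε * c ^ 2 / (2 * (p + 1) * Q) := by positivity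
  have e3 : 0 < ε * (c * (c / 2)) / (p ^ 2 + 1) := by positivity
  refine ⟨min (c / (2 * (p + 1))) (min (ε * c ^ 2 / (2 * (p + 1) * Q))
    (ε * (c * (c / 2)) / (p ^ 2 + 1))), lt_min e1 (lt_min e2 e3), ?_, ?_, ?_⟩
  all_goals set κ := min (c / (2 * (p + 1))) (min (ε * c ^ 2 / (2 * (p + 1) * Q))
    (ε * (c * (c / 2)) / (p ^ 2 + 1))) with hκdef
  all_goals have hκ0 : 0 < κ := lt_min e1 (lt_min e2 e3)
  · have : κ ≤ c / (2 * (p + 1)) := min_le_left _ _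
    rw [le_div_iff₀ (by positivity)] at this
    linarith
  · have : κ ≤ ε * c ^ 2 / (2 * (p + 1) * Q) := (min_le_right _ _).trans (min_le_left _ _)
    rw [le_div_iff₀ (by positivity)] at this
    rw [div_le_iff₀ (by positivity)]
    have : 0 ≤ κ * Q := by positivity
    linarith
  · have : κ ≤ ε * (c * (c / 2)) / (p ^ 2 + 1) := (min_le_right _ _).trans (min_le_right _ _)
    rw [le_div_iff₀ (by positivity)] at this
    rw [div_le_iff₀ (by positivity)]
    linarith

/-- A Hessian that is close to a matrix at the centre stays close to it in a small ball, by the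
bound on third derivatives. -/
lemma abs_negHess_sub_le {m : ℕ} {f : Param d m → ℝ} {φ₀ : Param d m} {r ρ b Q κ ν : ℝ}
    {H : Matrix (Fin d ⊕ Fin m) (Fin d ⊕ Fin m) ℝ} (hf : ContDiffOn ℝ 3 f (Metric.ball φ₀ r))
    (hb : ∀ φ ∈ Metric.ball φ₀ r, ‖iteratedFDeriv ℝ 3 f φ‖ ≤ b) (hbQ : b ≤ Q * ν) (hρr : ρ ≤ r)
    (hρQ : Q * ρ ≤ κ / 2) (hν : 0 ≤ ν)
    (h₀ : ∀ i j, |negHess f φ₀ i j - H i j| ≤ κ / 2 * ν) :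
    ∀ φ ∈ Metric.ball φ₀ ρ, ∀ i j, |negHess f φ i j - H i j| ≤ κ * ν := by
  intro φ hφ i j
  have g1 := norm_fderiv_fderiv_sub_le hf hb (Metric.ball_subset_ball hρr hφ)
  have hb0 : 0 ≤ b := (norm_nonneg _).trans (hb φ (Metric.ball_subset_ball hρr hφ))
  have g2 : negHess f φ i j - negHess f φ₀ i j =
      -((fderiv ℝ (fderiv ℝ f) φ - fderiv ℝ (fderiv ℝ f) φ₀) (coordVec d m i)
        (coordVec d m j)) := by
    simp only [negHess, Matrix.of_apply, sub_apply]
    ring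
  have g3 : ‖φ - φ₀‖ ≤ ρ := by
    rw [← dist_eq_norm]
    exact (Metric.mem_ball.1 hφ).le
  have g4 : |negHess f φ i j - negHess f φ₀ i j| ≤ κ / 2 * ν := by
    rw [g2, abs_neg, ← Real.norm_eq_abs]
    refine (ContinuousLinearMap.le_opNorm₂ _ _ _).trans ?_
    have hρ0 : 0 ≤ ρ := (norm_nonneg _).trans g3
    calc _ ≤ (Q * ν * ρ) * 1 * 1 := by
          refine mul_le_mul (mul_le_mul (g1.trans (mul_le_mul hbQ g3 (norm_nonneg _)
            (hb0.trans hbQ))) (norm_coordVec_le i) (norm_nonneg _)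
            (mul_nonneg (hb0.trans hbQ) hρ0)) (norm_coordVec_le j) (norm_nonneg _)
            (by simpa using mul_nonneg (hb0.trans hbQ) hρ0)
      _ = Q * ρ * ν := by ring
      _ ≤ _ := mul_le_mul_of_nonneg_right hρQ hν
  have e4 := abs_sub_le (negHess f φ i j) (negHess f φ₀ i j) (H i j)
  linarith [h₀ i j]

/-- The two conclusions about a maximum likelihood estimate on the event that minus the Hessian
is close to the information near the truth and that the likelihood is small away from it. -/
lemma Multiphase.Experiment.IsMLE.expansion {T : Type*} [MeasurableSpace T] {m : ℕ}
    {Θ : Set (Param d m)} {e : Experiment T Θ} {y : T} {ψ : Param d m} (hψ : e.IsMLE y ψ)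
    {ν κ ρ c gap Q : ℝ} {φ₀ : Θ} (hν : 0 < ν) (hc : 0 < c) (hA : Coercive c (scaledInfo e ν φ₀))
    (hκ0 : 0 ≤ κ) (hκ : (Fintype.card (Fin d ⊕ Fin m) : ℝ) * κ ≤ c / 2)
    (hball : Metric.ball (φ₀ : Param d m) ρ ⊆ Θ)
    (hsmooth : ContDiffOn ℝ 3 (e.logLik y) (Metric.ball (φ₀ : Param d m) ρ))
    (hpos : ∀ φ ∈ Θ, 0 < e.dens y φ)
    (hclose : ∀ φ ∈ Metric.ball (φ₀ : Param d m) ρ, ∀ a b,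
      |negHess (e.logLik y) φ a b - ν * scaledInfo e ν φ₀ a b| ≤ κ * ν)
    (hgap : 0 < gap) (hout : ∀ φ ∈ Θ, ρ ≤ dist φ (φ₀ : Param d m) →
      e.logLik y φ < e.logLik y φ₀ - gap) (hQ0 : 0 ≤ Q)
    (hsum : (∑ a, e.score y φ₀ a ^ 2) / ν ≤ Q ^ 2) :
    ‖√ν • (ψ.1 - (φ₀ : Param d m).1) - linStat e ν φ₀ y‖ ≤
        2 * Fintype.card (Fin d ⊕ Fin m) * κ * Q / c ^ 2 ∧
      IsUnit (e.profileInfo y ψ.1).det ∧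
      ∀ i j, |ν * (e.profileInfo y ψ.1)⁻¹ i j - asympVar e ν φ₀ i j| ≤
        (Fintype.card (Fin d ⊕ Fin m) : ℝ) ^ 2 * κ / (c * (c / 2)) := by
  set f := e.logLik y with hf
  -- the estimate is an interior maximum of the log-likelihood
  have hmax : ∀ φ ∈ Θ, f φ ≤ f ψ := fun φ hφ => Real.log_le_log (hpos φ hφ) (hψ.2 φ hφ)
  have hψball : ψ ∈ Metric.ball (φ₀ : Param d m) ρ := by
    by_contra hcon
    have e1 := hout ψ hψ.1 (not_lt.1 hcon)
    have e2 := hmax _ φ₀.2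
    linarith
  have hcrit : fderiv ℝ f ψ = 0 := by
    refine IsLocalMax.fderiv_eq_zero ?_
    filter_upwards [Metric.isOpen_ball.mem_nhds hψball] with φ hφ using hmax φ (hball hφ)
  refine ⟨?_, ?_⟩
  · have hs : (fun a => (√ν)⁻¹ * e.score y φ₀ a) ⬝ᵥ (fun a => (√ν)⁻¹ * e.score y φ₀ a) ≤
        Q ^ 2 := by
      have e1 : (fun a => (√ν)⁻¹ * e.score y φ₀ a) ⬝ᵥ (fun a => (√ν)⁻¹ * e.score y φ₀ a) =
          (∑ a, e.score y φ₀ a ^ 2) / ν := by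
        have hNN : (√ν)⁻¹ * (√ν)⁻¹ = ν⁻¹ := by rw [← mul_inv, Real.mul_self_sqrt hν.le]
        rw [dotProduct, Finset.sum_div]
        refine Finset.sum_congr rfl fun a _ => ?_
        rw [div_eq_mul_inv, ← hNN]; ring
      rw [e1]
      exact hsum
    have e1 := sub_inv_mulVec_le hν hsmooth hc hA scaledInfo_isSymm hκ0 hκ hclose
      hψball hcrit (s := fun a => (√ν)⁻¹ * e.score y φ₀ a) (fun a => rfl) hs
    have e2 := norm_sub_linStat_sq_le e ν φ₀ ψ y _ rfl
    have e4 : 0 ≤ 2 * Fintype.card (Fin d ⊕ Fin m) * κ * Q / c ^ 2 := by positivity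
    exact (abs_le_of_sq_le_sq' (e2.trans e1) e4).2
  · have hHc : ∀ φ ∈ Metric.ball (φ₀ : Param d m) ρ, ∃ c' > 0,
        Coercive c' (negHess f φ) := fun φ hφ => ⟨ν * (c / 2), by positivity,
      coercive_of_smul hν (coercive_of_close hν hA hκ0 hκ (hclose φ hφ)).1⟩
    obtain ⟨u, e1⟩ := isUnit_and_inv_profile hball hsmooth hHc hψball hcrit
      (m := f φ₀ - gap) (by
        have e2 := hmax _ φ₀.2
        linarith)
      (fun φ hφ hφout => (hout φ hφ (not_lt.1 hφout)).le) (e.profileInfo y ψ.1) (fun i j => rfl)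
    refine ⟨u, fun i j => ?_⟩
    rw [e1]
    exact abs_inv_negHess_le hν hc hA hκ0 hκ (hclose ψ hψball) (Sum.inl i) (Sum.inl j)

/-- With probability tending to one, every maximum likelihood estimate is close to the linear
statistic after scaling, and the inverse of its observed profile information is close to the
asymptotic variance. -/
lemma Multiphase.Regular.eventually_mle (h : Regular N E ψ₀) (hN : ∀ n, 0 < N n)
    (hk : ∀ n, k n ≤ D) {ε : ℝ} (hε : 0 < ε) :
    ∀ᶠ x : Σ n, S n in whp (fun n => (E n).law (ψ₀ n)), ∀ ψ, (E x.1).IsMLE x.2 ψ →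
      ‖√(N x.1) • (ψ.1 - (ψ₀ x.1 : Param d (k x.1)).1) - linStat (E x.1) (N x.1) (ψ₀ x.1) x.2‖
        ≤ ε ∧
      IsUnit ((E x.1).profileInfo x.2 ψ.1).det ∧
      ∀ i j, |N x.1 * ((E x.1).profileInfo x.2 ψ.1)⁻¹ i j -
        asympVar (E x.1) (N x.1) (ψ₀ x.1) i j| ≤ ε := by
  obtain ⟨c, hc, hcoer⟩ := h.exists_coercive hN
  obtain ⟨r, hr, hball, B, hB, htight⟩ := h.exists_tight hN
  refine htight.eventually_whp fun K => ?_
  set p : ℝ := ((d + D : ℕ) : ℝ) with hp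
  have hp0 : 0 ≤ p := Nat.cast_nonneg _
  set Q : ℝ := max K 1 with hQ
  have hQ1 : 1 ≤ Q := le_max_right _ _
  have hKQ : K ≤ Q := le_max_left _ _
  -- `κ` is the precision needed of the Hessian, and `ρ` the radius on which it is achieved
  obtain ⟨κ, hκ0, hκ1, hκ2, hκ3⟩ := exists_precision hc hε hp0 (one_pos.trans_le hQ1)
  set ρ := min r (κ / (2 * Q)) with hρ
  have hρ0 : 0 < ρ := lt_min hr (by positivity)
  have hρr : ρ ≤ r := min_le_left _ _
  have hρQ : Q * ρ ≤ κ / 2 := by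
    have : ρ ≤ κ / (2 * Q) := min_le_right _ _
    rw [le_div_iff₀ (by positivity)] at this
    linarith
  obtain ⟨c₁, hc₁, hid⟩ := h.identifiable ρ hρ0
  have hlln := h.hessian_lln (κ / 2) (by positivity)
  have hlln' : ∀ᶠ x : Σ n, S n in whp (fun n => (E n).law (ψ₀ n)), ¬ ∃ a b, κ / 2 * N x.1 ≤
      |(E x.1).negHessian x.2 (ψ₀ x.1) a b -
        ∫ y', (E x.1).negHessian y' (ψ₀ x.1) a b ∂((E x.1).law (ψ₀ x.1))| := by
    rw [eventually_whp]
    simpa only [not_not] using hlln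
  have hid' : ∀ᶠ x : Σ n, S n in whp (fun n => (E n).law (ψ₀ n)),
      ¬ ∃ ψ : Param d (k x.1), ψ ∈ Ψ x.1 ∧
      ρ ≤ dist ψ (ψ₀ x.1 : Param d (k x.1)) ∧
      (E x.1).logLik x.2 (ψ₀ x.1) - c₁ * N x.1 ≤ (E x.1).logLik x.2 ψ := by
    rw [eventually_whp]
    simpa only [not_not] using hid
  have hpos : ∀ᶠ x : Σ n, S n in whp (fun n => (E n).law (ψ₀ n)),
      ∀ ψ : Param d (k x.1), ψ ∈ Ψ x.1 → 0 < (E x.1).dens x.2 ψ := by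
    refine eventually_whp_of_ae (.of_forall fun n => ?_)
    obtain ⟨r', g, hL⟩ := h.exists_localReg n
    filter_upwards [hL.ae_law] with y hy using hy.1
  have hB' : ∀ᶠ x : Σ n, S n in whp (fun n => (E n).law (ψ₀ n)), 0 ≤ B x.1 x.2 ∧
      ContDiffOn ℝ 3 ((E x.1).logLik x.2) (Metric.ball (ψ₀ x.1 : Param d (k x.1)) r) ∧
      ∀ ψ ∈ Metric.ball (ψ₀ x.1 : Param d (k x.1)) r,
        ‖iteratedFDeriv ℝ 3 ((E x.1).logLik x.2) ψ‖ ≤ B x.1 x.2 :=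
    eventually_whp_of_ae (p := fun x : Σ n, S n => 0 ≤ B x.1 x.2 ∧
      ContDiffOn ℝ 3 ((E x.1).logLik x.2) (Metric.ball (ψ₀ x.1 : Param d (k x.1)) r) ∧
      ∀ ψ ∈ Metric.ball (ψ₀ x.1 : Param d (k x.1)) r,
        ‖iteratedFDeriv ℝ 3 ((E x.1).logLik x.2) ψ‖ ≤ B x.1 x.2) (.of_forall hB)
  have hcoer' : ∀ᶠ x : Σ n, S n in whp (fun n => (E n).law (ψ₀ n)),
      Coercive c (scaledInfo (E x.1) (N x.1) (ψ₀ x.1)) := eventually_whp_of_eventually hcoer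
  filter_upwards [hlln', hid', hpos, hB',
    hcoer'] with x hx1 hx2 hx3 hx4 hx5 hxK ψ hψ
  obtain ⟨n, y⟩ := x
  simp only at hx1 hx2 hx3 hx4 hx5 hxK hψ ⊢
  push Not at hx1 hx2
  obtain ⟨hB0, hsmooth, hBbound⟩ := hx4
  have hNn := hN n
  have hsum0 : 0 ≤ (∑ a, (E n).score y (ψ₀ n) a ^ 2) / N n :=
    div_nonneg (Finset.sum_nonneg fun a _ => sq_nonneg _) hNn.le
  have hBN : B n y ≤ Q * N n := by
    have : B n y / N n ≤ Q := by linarith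
    rwa [div_le_iff₀ hNn] at this
  have hsmooth' : ContDiffOn ℝ 3 ((E n).logLik y) (Metric.ball (ψ₀ n : Param d (k n)) ρ) :=
    hsmooth.mono (Metric.ball_subset_ball hρr)
  have hballρ : Metric.ball (ψ₀ n : Param d (k n)) ρ ⊆ Ψ n :=
    (Metric.ball_subset_ball hρr).trans (hball n)
  have hclose : ∀ φ ∈ Metric.ball (ψ₀ n : Param d (k n)) ρ, ∀ a b,
      |negHess ((E n).logLik y) φ a b - N n * scaledInfo (E n) (N n) (ψ₀ n) a b| ≤ κ * N n := by
    obtain ⟨r', g, hL⟩ := h.exists_localReg n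
    refine abs_negHess_sub_le (H := N n • scaledInfo (E n) (N n) (ψ₀ n)) hsmooth hBbound hBN hρr
      hρQ hNn.le fun a b => ?_
    have e1 := hx1 a b
    rw [hL.integral_negHessian (h.memLp_score hN n)] at e1
    rw [scaledInfo, smul_smul, mul_inv_cancel₀ hNn.ne', one_smul]
    exact e1.le
  have hcard := card_le_cast (d := d) (hk n)
  rw [← hp] at hcard
  have hκcard : (Fintype.card (Fin d ⊕ Fin (k n)) : ℝ) * κ ≤ c / 2 :=
    (mul_le_mul_of_nonneg_right hcard hκ0.le).trans hκ1
  -- both terms of the tight variable are at most `Q`, and `1 ≤ Q`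
  have hsum : (∑ a, (E n).score y (ψ₀ n) a ^ 2) / N n ≤ Q ^ 2 := by
    have e2 : 0 ≤ B n y / N n := div_nonneg hB0 hNn.le
    nlinarith
  obtain ⟨m1, m2, m3⟩ := hψ.expansion hNn hc hx5 hκ0.le hκcard hballρ hsmooth' hx3 hclose
    (by positivity : 0 < c₁ * N n) (fun φ hφ h => hx2 φ hφ h) (one_pos.le.trans hQ1) hsum
  refine ⟨m1.trans (le_trans ?_ hκ2), m2, fun i j => (m3 i j).trans (le_trans ?_ hκ3)⟩ <;> gcongr

end Regular

/-! ### Asymptotics of the estimator of the parameter of interest -/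

section Estimator

variable {S R : ℕ → Type*} [∀ n, MeasurableSpace (S n)] [∀ n, MeasurableSpace (R n)] {d D : ℕ}
  {k : ℕ → ℕ} {Ψ : ∀ n, Set (Param d (k n))} {N : ℕ → ℝ} {E : ∀ n, Experiment (R n) (Ψ n)}
  {ψ₀ : ∀ n, Ψ n} {P : ∀ n, Measure (S n)} {T : ∀ n, S n → R n}

/-- The estimates from data `T` that are a function of what is observed: the probability is that of
the underlying experiment, and the linear statistic is evaluated at `T`. -/
lemma Multiphase.Regular.eventually_mle_of_map (h : Regular N E ψ₀) (hN : ∀ n, 0 < N n)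
    (hk : ∀ n, k n ≤ D) (hT : ∀ n, Measurable (T n))
    (hlaw : ∀ n, (E n).law (ψ₀ n) = (P n).map (T n)) {mle : ∀ n, S n → Param d (k n)}
    (hmle : ∀ᶠ x : Σ n, S n in whp P, (E x.1).IsMLE (T x.1 x.2) (mle x.1 x.2))
    {ε : ℝ} (hε : 0 < ε) :
    ∀ᶠ x : Σ n, S n in whp P,
      ‖√(N x.1) • ((mle x.1 x.2).1 - (ψ₀ x.1 : Param d (k x.1)).1) -
        linStat (E x.1) (N x.1) (ψ₀ x.1) (T x.1 x.2)‖ ≤ ε ∧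
      IsUnit ((E x.1).profileInfo (T x.1 x.2) (mle x.1 x.2).1).det ∧
      ∀ i j, |N x.1 * ((E x.1).profileInfo (T x.1 x.2) (mle x.1 x.2).1)⁻¹ i j -
        asympVar (E x.1) (N x.1) (ψ₀ x.1) i j| ≤ ε := by
  have h1 := h.eventually_mle hN hk hε
  simp_rw [hlaw] at h1
  filter_upwards [eventually_whp_of_map hT h1, hmle] with x hx hx'
  exact hx _ hx'

/-- The maximum likelihood estimator of the parameter of interest, from data `T`, is asymptotically
linear. -/
lemma Multiphase.Regular.asympLinear (h : Regular N E ψ₀) (hN : ∀ n, 0 < N n)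
    (hk : ∀ n, k n ≤ D) (hT : ∀ n, Measurable (T n))
    (hlaw : ∀ n, (E n).law (ψ₀ n) = (P n).map (T n)) {mle : ∀ n, S n → Param d (k n)}
    (hmeas : ∀ n, Measurable (mle n))
    (hmle : ∀ᶠ x : Σ n, S n in whp P, (E x.1).IsMLE (T x.1 x.2) (mle x.1 x.2))
    {θ₀ : EuclideanSpace ℝ (Fin d)} (hθ₀ : ∀ n, (ψ₀ n : Param d (k n)).1 = θ₀) :
    AsympLinear P (fun n y => √(N n) • ((mle n y).1 - θ₀))
      (fun n y => linStat (E n) (N n) (ψ₀ n) (T n y)) (fun n => asympVar (E n) (N n) (ψ₀ n)) := by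
  have hLm : ∀ n, AEMeasurable (linStat (E n) (N n) (ψ₀ n)) ((P n).map (T n)) := fun n => by
    obtain ⟨r, g, hL⟩ := h.exists_localReg n
    rw [← hlaw]
    exact hL.aemeasurable_linStat
  obtain ⟨c, hc, hcoer⟩ := h.exists_coercive hN
  refine ⟨fun n => Measurable.const_smul (g := fun y => (mle n y).1 - θ₀)
    ((hmeas n).fst.sub_const θ₀) (√(N n)),
    fun n => (hLm n).comp_measurable (hT n), ?_, ?_, ?_, ?_⟩
  · refine Metric.tendsto_nhds.2 fun ε hε => ?_
    filter_upwards [h.eventually_mle_of_map hN hk hT hlaw hmle (half_pos hε)] with x hx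
    rw [dist_zero_right, norm_norm, ← hθ₀ x.1]
    exact hx.1.trans_lt (half_lt_self hε)
  · have h1 : UIExcess P fun n y => (∑ a, (E n).score (T n y) (ψ₀ n) a ^ 2) / N n := by
      intro ε hε
      obtain ⟨K, hK⟩ := h.score_unifInt.uiExcess ε hε
      refine ⟨K, hK.mono fun n hn => ?_⟩
      have hm := (h.aemeasurable_sum_score_sq n).sub_const K |>.ennreal_ofReal
      beta_reduce at hn
      rw [hlaw] at hn hm
      rwa [lintegral_map' hm (hT n).aemeasurable] at hn
    refine h1.of_le (C := (c ^ 2)⁻¹) (by positivity) (hcoer.mono fun n hn y => ?_)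
    exact norm_linStat_sq_le hc hn (hN n) (T n y)
  · refine .of_forall fun n i => ?_
    obtain ⟨r, g, hL⟩ := h.exists_localReg n
    have h1 := hL.integral_linStat (N := N n) (h.memLp_score hN n) i
    rw [hlaw, integral_map (hT n).aemeasurable
      (aemeasurable_coord (hLm n) i).aestronglyMeasurable] at h1
    exact h1
  · filter_upwards [hcoer] with n hn i j
    obtain ⟨r, g, hL⟩ := h.exists_localReg n
    have h1 := integral_linStat_mul_linStat hL hL measurable_id (fun ψ => Measure.map_id.symm)
      (h.memLp_score hN n) (h.memLp_score hN n) (hN n) (hn.isUnit_det hc) i j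
    rw [hlaw] at h1
    exact (integral_map (hT n).aemeasurable ((aemeasurable_coord (hLm n) i).mul
      (aemeasurable_coord (hLm n) j)).aestronglyMeasurable).symm.trans h1

end Estimator

/-! ### Ratios of limits -/

section Ratio

variable {d : ℕ} {V V' : ℕ → Matrix (Fin d) (Fin d) ℝ} {R : Matrix (Fin d) (Fin d) ℝ}

lemma eventually_abs_sub_le {W : ℕ → Matrix (Fin d) (Fin d) ℝ} {A : Matrix (Fin d) (Fin d) ℝ}
    (h : Tendsto W atTop (𝓝 A)) {η : ℝ} (hη : 0 < η) :
    ∀ᶠ n in atTop, ∀ i j, |A i j - W n i j| ≤ η := by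
  rw [eventually_all]
  intro i
  rw [eventually_all]
  intro j
  have h1 : Tendsto (fun n => W n i j) atTop (𝓝 (A i j)) :=
    (tendsto_pi_nhds.1 ((tendsto_pi_nhds.1 h) i)) j
  filter_upwards [Metric.tendsto_nhds.1 h1 η hη] with n hn
  rw [dist_comm] at hn
  exact hn.le

/-- The ratio of the limits is the limit of the ratios, the denominators being coercive. -/
lemma ratio_eq_of_tendsto {A B : Matrix (Fin d) (Fin d) ℝ} (hA : Tendsto V atTop (𝓝 A))
    (hB : Tendsto V' atTop (𝓝 B)) {c M : ℝ} (hc : 0 < c) (hM : 0 ≤ M)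
    (hV' : ∀ᶠ n in atTop, Coercive c (V' n)) (hV : ∀ᶠ n in atTop, ∀ i j, |V n i j| ≤ M)
    (hR : Tendsto (fun n => V n * (V' n)⁻¹) atTop (𝓝 R)) : IsUnit B.det ∧ A * B⁻¹ = R := by
  have key : ∀ ε > 0, IsUnit B.det ∧ ∀ i j, |(A * B⁻¹) i j - R i j| ≤ ε := by
    intro ε hε
    obtain ⟨η, hη, h⟩ := exists_ratio_close (Fin d) hc hM (half_pos hε)
    obtain ⟨n, h1, h2, h3, h4, h5⟩ := (hV'.and (hV.and ((eventually_abs_sub_le hA hη).and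
      ((eventually_abs_sub_le hB hη).and (eventually_abs_sub_le hR (half_pos hε)))))).exists
    obtain ⟨u, h6⟩ := h A B _ _ h1 h2 h3 h4
    refine ⟨u, fun i j => ?_⟩
    have h7 := h6 i j
    rw [Matrix.sub_apply] at h7
    have h8 := h5 i j
    rw [abs_sub_comm] at h8
    have := abs_sub_le ((A * B⁻¹) i j) ((V n * (V' n)⁻¹) i j) (R i j)
    linarith
  refine ⟨(key 1 one_pos).1, ?_⟩
  ext i j
  rw [← sub_eq_zero, ← abs_eq_zero]
  exact le_antisymm (le_of_forall_pos_le_add fun ε hε => by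
    rw [zero_add]; exact (key ε hε).2 i j) (abs_nonneg _)

/-- The fraction of missing information in terms of asymptotic variances: a limit in probability
of ratios of observed informations is the limit of the deterministic ratios that they estimate. -/
lemma tendsto_ratio_of_observed {S : ℕ → Type*} [∀ n, MeasurableSpace (S n)]
    {P : ∀ n, Measure (S n)} [∀ n, IsProbabilityMeasure (P n)] {N : ℕ → ℝ} (hN : ∀ n, 0 < N n)
    {I I' : ∀ n, S n → Matrix (Fin d) (Fin d) ℝ} {c M : ℝ} (hc : 0 < c) (hM : 0 ≤ M)
    (hV' : ∀ᶠ n in atTop, Coercive c (V' n)) (hV : ∀ᶠ n in atTop, ∀ i j, |V n i j| ≤ M)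
    (hI : ∀ ε > 0, ∀ᶠ x : Σ n, S n in whp P, IsUnit (I x.1 x.2).det ∧
      ∀ i j, |N x.1 * (I x.1 x.2)⁻¹ i j - V x.1 i j| ≤ ε)
    (hI' : ∀ ε > 0, ∀ᶠ x : Σ n, S n in whp P, IsUnit (I' x.1 x.2).det ∧
      ∀ i j, |N x.1 * (I' x.1 x.2)⁻¹ i j - V' x.1 i j| ≤ ε)
    {F : Matrix (Fin d) (Fin d) ℝ}
    (hF : ∀ ε > 0, Tendsto (fun n => P n {y | ∃ i j,
      ε ≤ |((I n y)⁻¹ * (I n y - I' n y) - F) i j|}) atTop (𝓝 0)) :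
    Tendsto (fun n => V n * (V' n)⁻¹) atTop (𝓝 (1 - F)) := by
  refine tendsto_pi_nhds.2 fun i => tendsto_pi_nhds.2 fun j => Metric.tendsto_nhds.2 fun ε hε => ?_
  obtain ⟨η, hη, h⟩ := exists_ratio_close (Fin d) hc hM (half_pos hε)
  have hF' : ∀ᶠ x : Σ n, S n in whp P, ¬ ∃ i j,
      ε / 2 ≤ |((I x.1 x.2)⁻¹ * (I x.1 x.2 - I' x.1 x.2) - F) i j| := by
    rw [eventually_whp]
    simpa only [not_not] using hF (ε / 2) (half_pos hε)
  have hcoer : ∀ᶠ x : Σ n, S n in whp P, Coercive c (V' x.1) := eventually_whp_of_eventually hV'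
  have hbd : ∀ᶠ x : Σ n, S n in whp P, ∀ i j, |V x.1 i j| ≤ M := eventually_whp_of_eventually hV
  refine eventually_of_eventually_whp (P := P)
    (p := fun n => dist ((V n * (V' n)⁻¹) i j) ((1 - F) i j) < ε) ?_
  filter_upwards [hF', hI η hη, hI' η hη, hcoer, hbd] with x h1 h2 h3 h4 h5
  push Not at h1
  obtain ⟨-, h6⟩ := h (N x.1 • (I x.1 x.2)⁻¹) (N x.1 • (I' x.1 x.2)⁻¹) _ _ h4 h5
    (fun i j => h2.2 i j) (fun i j => h3.2 i j)
  have e1 : (N x.1 • (I' x.1 x.2)⁻¹)⁻¹ = (N x.1)⁻¹ • I' x.1 x.2 := by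
    refine Matrix.inv_eq_left_inv ?_
    rw [Matrix.smul_mul, Matrix.mul_smul, smul_smul, inv_mul_cancel₀ (hN _).ne',
      Matrix.mul_nonsing_inv _ h3.1, one_smul]
  have e2 : N x.1 • (I x.1 x.2)⁻¹ * (N x.1 • (I' x.1 x.2)⁻¹)⁻¹ =
      (I x.1 x.2)⁻¹ * I' x.1 x.2 := by
    rw [e1, Matrix.smul_mul, Matrix.mul_smul, smul_smul, mul_inv_cancel₀ (hN _).ne', one_smul]
  have e3 : (I x.1 x.2)⁻¹ * (I x.1 x.2 - I' x.1 x.2) = 1 - (I x.1 x.2)⁻¹ * I' x.1 x.2 := by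
    rw [Matrix.mul_sub, Matrix.nonsing_inv_mul _ h2.1]
  have h7 := h6 i j
  have h8 := h1 i j
  rw [e2, Matrix.sub_apply] at h7
  rw [e3, Matrix.sub_apply, Matrix.sub_apply] at h8
  rw [Real.dist_eq, Matrix.sub_apply]
  rw [abs_lt] at h7 h8 ⊢
  constructor <;> linarith [h7.1, h7.2, h8.1, h8.2]

end Ratio

/-! ### Limit laws of pairs -/

section Pair

variable {S : ℕ → Type*} [∀ n, MeasurableSpace (S n)] {P : ∀ n, Measure (S n)}
  [∀ n, IsProbabilityMeasure (P n)] {d : ℕ}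

lemma tendsto_integral_of_tendstoInDistribution {G G' : Type*} [TopologicalSpace G]
    [MeasurableSpace G] [OpensMeasurableSpace G] [TopologicalSpace G']
    {X : ∀ n, S n → G} {L : ProbabilityMeasure G}
    (h : TendstoInDistribution X atTop id P (L : Measure G)) {φ : G → G'} (hφ : Continuous φ)
    (f : BoundedContinuousFunction G' ℝ) :
    Tendsto (fun n => ∫ y, f (φ (X n y)) ∂(P n)) atTop (𝓝 (∫ w, f (φ w) ∂(L : Measure G))) := by
  have h1 := ProbabilityMeasure.tendsto_iff_forall_integral_tendsto.1 h.tendsto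
    (f.compContinuous ⟨φ, hφ⟩)
  have hm : ∀ μ : Measure G, AEStronglyMeasurable (f.compContinuous ⟨φ, hφ⟩) μ := fun μ =>
    (f.compContinuous ⟨φ, hφ⟩).continuous.measurable.aestronglyMeasurable
  simp only [ProbabilityMeasure.coe_mk, Measure.map_id] at h1
  refine h1.congr fun n => ?_
  rw [integral_map (h.forall_aemeasurable n) (hm _)]
  rfl

lemma memLp_id_prod {ν : Measure (EuclideanSpace ℝ (Fin d) × EuclideanSpace ℝ (Fin d))}
    (h₁ : ∀ i, MemLp (fun w => w.1 i) 2 ν) (h₂ : ∀ i, MemLp (fun w => w.2 i) 2 ν) :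
    MemLp id 2 ν := by
  rw [memLp_two_iff_integrable_sq_norm aestronglyMeasurable_id]
  have hint : Integrable (fun w : EuclideanSpace ℝ (Fin d) × EuclideanSpace ℝ (Fin d) =>
      ∑ i, w.1 i ^ 2 + ∑ i, w.2 i ^ 2) ν :=
    (integrable_finsetSum _ fun i _ => (h₁ i).integrable_sq).add
      (integrable_finsetSum _ fun i _ => (h₂ i).integrable_sq)
  refine hint.mono' (aestronglyMeasurable_id.norm.pow 2) (ae_of_all _ fun w => ?_)
  rw [← EuclideanSpace.real_norm_sq_eq, ← EuclideanSpace.real_norm_sq_eq, Real.norm_eq_abs,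
    abs_of_nonneg (sq_nonneg _), id, Prod.norm_def]
  rcases le_total ‖w.1‖ ‖w.2‖ with h | h
  · rw [max_eq_right h]; linarith [sq_nonneg ‖w.1‖]
  · rw [max_eq_left h]; linarith [sq_nonneg ‖w.2‖]

end Pair

theorem theorem4 {X Y Z : ℕ → Type*} [∀ n, MeasurableSpace (X n)] [∀ n, MeasurableSpace (Y n)]
    [∀ n, MeasurableSpace (Z n)] {d D : ℕ} {k : ℕ → ℕ} (hk : ∀ n, k n ≤ D)
    {Ψ : ∀ n, Set (Param d (k n))}
    (N : ℕ → ℝ) (hNpos : ∀ n, 0 < N n) (hN : Tendsto N atTop atTop)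
    -- the two-phase models, and the true parameter values
    (M : ∀ n, TwoPhaseModel (X n) (Y n) (Ψ n))
    (θ₀ : EuclideanSpace ℝ (Fin d)) (ξ₀ : ∀ n, EuclideanSpace ℝ (Fin (k n)))
    (hψ₀ : ∀ n, (θ₀, ξ₀ n) ∈ Ψ n)
    -- the preprocessing, and the experiment of observing its output only
    (T : ∀ n, Y n → Z n) (hT : ∀ n, Measurable (T n))
    (ET : ∀ n, Experiment (Z n) (Ψ n))
    (hET : ∀ n (ψ : Ψ n), (ET n).law ψ = ((M n).marginal.law ψ).map (T n))
    -- regularity of both likelihoods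
    (hregY : Regular N (fun n => (M n).marginal) (fun n => ⟨(θ₀, ξ₀ n), hψ₀ n⟩))
    (hregT : Regular N ET (fun n => ⟨(θ₀, ξ₀ n), hψ₀ n⟩))
    (P : ∀ n, Measure (Y n)) (hP : ∀ n, P n = (M n).marginal.law ⟨(θ₀, ξ₀ n), hψ₀ n⟩)
    [∀ n, IsProbabilityMeasure (P n)]
    -- maximum likelihood estimators from the raw data and from the preprocessed data
    (mleY : ∀ n, Y n → Param d (k n)) (mleT : ∀ n, Z n → Param d (k n))
    (hmleY_meas : ∀ n, Measurable (mleY n)) (hmleT_meas : ∀ n, Measurable (mleT n))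
    (hmleY : Tendsto (fun n => P n {y | ¬ (M n).marginal.IsMLE y (mleY n y)}) atTop (𝓝 0))
    (hmleT : Tendsto (fun n => P n {y | ¬ (ET n).IsMLE (T n y) (mleT n (T n y))}) atTop (𝓝 0))
    (θY θT : ∀ n, Y n → EuclideanSpace ℝ (Fin d))
    (hθY : ∀ n y, θY n y = (mleY n y).1) (hθT : ∀ n y, θT n y = (mleT n (T n y)).1)
    -- the observed Fisher informations of the profile likelihoods
    (IY IT : ∀ n, Y n → Matrix (Fin d) (Fin d) ℝ)
    (hIY : ∀ n y, IY n y = (M n).marginal.profileInfo y (θY n y))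
    (hIT : ∀ n y, IT n y = (ET n).profileInfo (T n y) (θT n y))
    -- the limiting fraction of missing information
    (F : Matrix (Fin d) (Fin d) ℝ)
    (hF : ∀ ε > 0, Tendsto
      (fun n => P n {y | ∃ i j, ε ≤ |((IY n y)⁻¹ * (IY n y - IT n y) - F) i j|}) atTop (𝓝 0)) :
    -- ratios of asymptotic variances
    (AsympVarRatio P (fun n y => √(N n) • (θT n y - θY n y)) (fun n y => √(N n) • (θT n y - θ₀)) F
      ∧ AsympVarRatio P (fun n y => √(N n) • (θY n y - θ₀)) (fun n y => √(N n) • (θT n y - θ₀))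
        (1 - F))
    -- ratios of the variances of the limit law, whenever the scaled estimators have one
    ∧ (∀ L : ProbabilityMeasure (EuclideanSpace ℝ (Fin d) × EuclideanSpace ℝ (Fin d)),
        TendstoInDistribution
          (fun n y => (√(N n) • (θY n y - θ₀), √(N n) • (θT n y - θ₀))) atTop id P
          (L : Measure (EuclideanSpace ℝ (Fin d) × EuclideanSpace ℝ (Fin d))) →
        MemLp id 2 (L : Measure (EuclideanSpace ℝ (Fin d) × EuclideanSpace ℝ (Fin d))) ∧
        IsUnit (covMatrix L.toMeasure (fun w => w.2)).det ∧
        covMatrix L.toMeasure (fun w => w.2 - w.1) * (covMatrix L.toMeasure (fun w => w.2))⁻¹ = F ∧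
        covMatrix L.toMeasure (fun w => w.1) * (covMatrix L.toMeasure (fun w => w.2))⁻¹ = 1 - F)
    -- ratios of the actual variances, whenever the scaled squared errors are uniformly integrable
    ∧ (UnifInt P (fun n y => N n * ‖θY n y - θ₀‖ ^ 2) →
        UnifInt P (fun n y => N n * ‖θT n y - θ₀‖ ^ 2) →
        VarRatioTendsto P (fun n y => θT n y - θY n y) θT F ∧
        VarRatioTendsto P θY θT (1 - F)) := by
  set ψ₀ : ∀ n, Ψ n := fun n => ⟨(θ₀, ξ₀ n), hψ₀ n⟩ with hψ₀def
  obtain rfl : P = fun n => (M n).marginal.law (ψ₀ n) := funext hP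
  obtain rfl : θY = fun n y => (mleY n y).1 := funext fun n => funext (hθY n)
  obtain rfl : θT = fun n y => (mleT n (T n y)).1 := funext fun n => funext (hθT n)
  set P : ∀ n, Measure (Y n) := fun n => (M n).marginal.law (ψ₀ n) with hPdef
  set VY : ℕ → Matrix (Fin d) (Fin d) ℝ := fun n => asympVar (M n).marginal (N n) (ψ₀ n) with hVY
  set VT : ℕ → Matrix (Fin d) (Fin d) ℝ := fun n => asympVar (ET n) (N n) (ψ₀ n) with hVT
  have hlawY : ∀ n, (M n).marginal.law (ψ₀ n) = (P n).map id := fun n => Measure.map_id.symm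
  have hlawT : ∀ n, (ET n).law (ψ₀ n) = (P n).map (T n) := fun n => hET n _
  have hmY : ∀ᶠ x : Σ n, Y n in whp P, (M x.1).marginal.IsMLE (id x.2) (mleY x.1 x.2) := hmleY
  have hmT : ∀ᶠ x : Σ n, Y n in whp P, (ET x.1).IsMLE (T x.1 x.2) (mleT x.1 (T x.1 x.2)) := hmleT
  have hLY := hregY.asympLinear hNpos hk (fun n => measurable_id) hlawY hmleY_meas hmY
    (θ₀ := θ₀) (fun n => rfl)
  have hLT := hregT.asympLinear hNpos hk hT hlawT (fun n => (hmleT_meas n).comp (hT n)) hmT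
    (θ₀ := θ₀) (fun n => rfl)
  obtain ⟨cY, hcY, MY, hMY, hbY⟩ := hregY.asympVar_bounds hNpos hk
  obtain ⟨cT, hcT, MT, hMT, hbT⟩ := hregT.asympVar_bounds hNpos hk
  have hVTc : ∀ᶠ n in atTop, Coercive cT (VT n) := hbT.mono fun n hn => hn.1
  have hVYb : ∀ᶠ n in atTop, ∀ i j, |VY n i j| ≤ MY := hbY.mono fun n hn => hn.2
  have hVDb : ∀ᶠ n in atTop, ∀ i j, |(VT - VY) n i j| ≤ MT + MY := by
    filter_upwards [hbT, hbY] with n h1 h2 i j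
    exact (abs_sub _ _).trans (add_le_add (h1.2 i j) (h2.2 i j))
  -- the linear statistics of both data sets have covariance equal to the variance of the first
  have hcross : ∀ᶠ n in atTop, ∀ i j, ∫ y, linStat (M n).marginal (N n) (ψ₀ n) (id y) i *
      linStat (ET n) (N n) (ψ₀ n) (T n y) j ∂(P n) = VY n i j := by
    obtain ⟨c, hc, hcoer⟩ := hregT.exists_coercive hNpos
    filter_upwards [hcoer] with n hn i j
    obtain ⟨r, g, hL⟩ := hregY.exists_localReg n
    obtain ⟨r', g', hL'⟩ := hregT.exists_localReg n
    exact integral_linStat_mul_linStat hL hL' (hT n) (hET n) (hregY.memLp_score hNpos n)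
      (hregT.memLp_score hNpos n) (hNpos n) (hn.isUnit_det hc) i j
  have hLD := hLT.sub hLY hcross (.of_forall fun n => asympVar_isSymm)
  have hdiff : (fun n y => √(N n) • ((mleT n (T n y)).1 - θ₀) - √(N n) • ((mleY n y).1 - θ₀)) =
      fun n y => √(N n) • ((mleT n (T n y)).1 - (mleY n y).1) := by
    funext n y
    rw [← smul_sub, sub_sub_sub_cancel_right]
  have hLD' : AsympLinear P (fun n y => √(N n) • ((mleT n (T n y)).1 - (mleY n y).1))
      (fun n y => linStat (ET n) (N n) (ψ₀ n) (T n y) -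
        linStat (M n).marginal (N n) (ψ₀ n) (id y)) (VT - VY) := by
    rw [← hdiff]; exact hLD
  have hRY : Tendsto (fun n => VY n * (VT n)⁻¹) atTop (𝓝 (1 - F)) := by
    refine tendsto_ratio_of_observed (P := P) hNpos (I := IY) (I' := IT) hcT hMY hVTc hVYb ?_ ?_ hF
    · intro ε hε
      filter_upwards [hregY.eventually_mle_of_map hNpos hk (fun n => measurable_id) hlawY hmY hε]
        with x hx
      rw [hIY]
      exact hx.2
    · intro ε hε
      filter_upwards [hregT.eventually_mle_of_map hNpos hk hT hlawT
        (mle := fun n y => mleT n (T n y)) hmT hε] with x hx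
      rw [hIT]
      exact hx.2
  have hRD : Tendsto (fun n => (VT - VY) n * (VT n)⁻¹) atTop (𝓝 F) := by
    have h1 : Tendsto (fun n => 1 - VY n * (VT n)⁻¹) atTop (𝓝 (1 - (1 - F))) :=
      tendsto_const_nhds.sub hRY
    rw [sub_sub_cancel] at h1
    refine h1.congr' ?_
    filter_upwards [hVTc] with n hn
    rw [Pi.sub_apply, Matrix.sub_mul, Matrix.mul_nonsing_inv _ (hn.isUnit_det hcT)]
  have hMD : 0 ≤ MT + MY := add_nonneg hMT hMY
  refine ⟨⟨hLD'.asympVarRatio hLT hcT hMD hVTc hVDb hRD,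
    hLY.asympVarRatio hLT hcT hMY hVTc hVYb hRY⟩, fun L hL => ?_, fun huY huT => ?_⟩
  · obtain ⟨mY, tY⟩ := hLY.tendsto_covMatrix_limit (ν := L.toMeasure)
      (Z := fun w : EuclideanSpace ℝ (Fin d) × EuclideanSpace ℝ (Fin d) => w.1)
      measurable_fst fun f => tendsto_integral_of_tendstoInDistribution hL continuous_fst f
    obtain ⟨mT, tT⟩ := hLT.tendsto_covMatrix_limit (ν := L.toMeasure)
      (Z := fun w : EuclideanSpace ℝ (Fin d) × EuclideanSpace ℝ (Fin d) => w.2)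
      measurable_snd fun f => tendsto_integral_of_tendstoInDistribution hL continuous_snd f
    obtain ⟨-, tD⟩ := hLD.tendsto_covMatrix_limit (ν := L.toMeasure)
      (Z := fun w : EuclideanSpace ℝ (Fin d) × EuclideanSpace ℝ (Fin d) => w.2 - w.1)
      (measurable_snd.sub measurable_fst) fun f =>
        tendsto_integral_of_tendstoInDistribution hL (continuous_snd.sub continuous_fst) f
    obtain ⟨u, eY⟩ := ratio_eq_of_tendsto tY tT hcT hMY hVTc hVYb hRY
    obtain ⟨-, eD⟩ := ratio_eq_of_tendsto tD tT hcT hMD hVTc hVDb hRD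
    exact ⟨memLp_id_prod mY mT, u, eD, eY⟩
  · have hsq : ∀ n (z : EuclideanSpace ℝ (Fin d)), ‖√(N n) • z‖ ^ 2 = N n * ‖z‖ ^ 2 := by
      intro n z
      rw [norm_smul, mul_pow, Real.norm_eq_abs, sq_abs, Real.sq_sqrt (hNpos n).le]
    have uY : UIExcess P fun n y => ‖√(N n) • ((mleY n y).1 - θ₀)‖ ^ 2 := by
      simp_rw [hsq]; exact huY.uiExcess
    have uT : UIExcess P fun n y => ‖√(N n) • ((mleT n (T n y)).1 - θ₀)‖ ^ 2 := by
      simp_rw [hsq]; exact huT.uiExcess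
    have uD : UIExcess P fun n y => ‖√(N n) • ((mleT n (T n y)).1 - (mleY n y).1 - 0)‖ ^ 2 := by
      refine (uT.add uY fun n => ((hLT.measurable n).norm.pow_const 2).aemeasurable).of_le
        (C := 2) two_pos (.of_forall fun n y => ?_)
      rw [sub_zero, ← congrFun (congrFun hdiff n) y]
      have := pow_le_pow_left₀ (norm_nonneg _) (norm_sub_le (√(N n) • ((mleT n (T n y)).1 - θ₀))
        (√(N n) • ((mleY n y).1 - θ₀))) 2
      nlinarith [sq_nonneg (‖√(N n) • ((mleT n (T n y)).1 - θ₀)‖ -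
        ‖√(N n) • ((mleY n y).1 - θ₀)‖)]
    refine ⟨varRatioTendsto_of_asympLinear (a := 0) hNpos (by simpa only [sub_zero] using hLD') hLT
      uD uT hcT hMD hVTc hVDb hRD,
      varRatioTendsto_of_asympLinear hNpos hLY hLT uY uT hcT hMY hVTc hVYb hRY⟩
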